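/- Consider propositional logic over atoms $p_0,p_1,p_2,\dots$; an interpretation is a set of atoms (the true ones), $\varphi\models\psi$ means that every model of $\varphi$ is a model of $\psi$, and $\varphi\equiv\psi$ means $\varphi\models\psi$ and $\psi\models\varphi$. For a formula $\varphi$ and a finite set $V$ of atoms, $\mathrm{Forget}(\varphi,V)$ is defined by $\mathrm{Forget}(\varphi,\emptyset)=\varphi$ and $\mathrm{Forget}(\varphi,V\cup\{p\})=\mathrm{Forget}(\varphi[p/\top]\vee\varphi[p/\bot],V)$ (up to equivalence the order of the atoms is irrelevant). A Krom (2-CNF) theory is a finite set, read as a conjunction, of clauses each consisting of at most two literals and containing no pair of complementary literals (the empty clause is false); $\mathrm{Var}(\Sigma)$ is the set of atoms occurring in $\Sigma$. Given Krom theories $\Pi,\Sigma$ and a finite set $V$ of atoms (written as a word over a fixed finite alphabet, with the atoms numbered in binary), each of the following problems is decidable by a Turing machine in time polynomial in the length of the input: 1. deciding whether $\Pi\models\mathrm{Forget}(\Sigma,V)$; 2. deciding whether $\mathrm{Forget}(\Pi,V)\models\Sigma$; 3. deciding whether $\mathrm{Forget}(\Pi,V)\models\mathrm{Forget}(\Sigma,V)$;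 4. deciding whether $\Pi\equiv\mathrm{Forget}(\Sigma,V)$; 5. deciding whether $\mathrm{Forget}(\Pi,V)\equiv\mathrm{Forget}(\Sigma,V)$; 6. deciding whether $\mathrm{Forget}(\Pi,V)\equiv\Pi$ (here the input is $\Pi,V$). Moreover, there is a polynomial-time computable function that maps a Krom theory $\Sigma$ and a finite set $V$ of atoms to a Krom theory $F(\Sigma,V)$ with $F(\Sigma,V)\equiv\mathrm{Forget}(\Sigma,V)$ whose clauses, regarded as sets of literals, are exactly the clauses $c$ with at most two literals (including the empty clause), without complementary literals, such that $\mathrm{Var}(c)\subseteq\mathrm{Var}(\Sigma)\setminus V$ and $\Sigma\models c$. -/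

import Mathlib

namespace KromForget

open Computability Turing

/-! ### Propositional formulas and forgetting. Atoms are natural numbers, so that the finite
signature of an instance is not bounded in advance. -/

/-- Propositional formulas over the atoms `0, 1, 2, …`. -/
inductive Formula : Type
  | top : Formula
  | bot : Formula
  | atom (p : ℕ) : Formula
  | neg (a : Formula) : Formula
  | and (a b : Formula) : Formula
  | or (a b : Formula) : Formula
  | imp (a b : Formula) : Formula
  | iff (a b : Formula) : Formula

namespace Formula

/-- Satisfaction: an interpretation is the set of the atoms that it makes true. -/
def Sat (I : Set ℕ) : Formula → Prop
  | top => True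
  | bot => False
  | atom p => p ∈ I
  | neg a => ¬ Sat I a
  | and a b => Sat I a ∧ Sat I b
  | or a b => Sat I a ∨ Sat I b
  | imp a b => Sat I a → Sat I b
  | iff a b => (Sat I a ↔ Sat I b)

/-- The set of atoms occurring in a formula. -/
def vars : Formula → Set ℕ
  | top => ∅
  | bot => ∅
  | atom p => {p}
  | neg a => vars a
  | and a b => vars a ∪ vars b
  | or a b => vars a ∪ vars b
  | imp a b => vars a ∪ vars b
  | iff a b => vars a ∪ vars b

/-- `subst p c a` is `a` with every occurrence of the atom `p` replaced by `c`. -/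
def subst (p : ℕ) (c : Formula) : Formula → Formula
  | top => top
  | bot => bot
  | atom q => if q = p then c else atom q
  | neg a => neg (subst p c a)
  | and a b => and (subst p c a) (subst p c b)
  | or a b => or (subst p c a) (subst p c b)
  | imp a b => imp (subst p c a) (subst p c b)
  | iff a b => iff (subst p c a) (subst p c b)

/-- Forgetting the atoms listed in `V`, one after the other:
`Forget(φ, ∅) = φ`, `Forget(φ, V ∪ {p}) = Forget(φ[p/⊤] ∨ φ[p/⊥], V)`. -/
def forget : Formula → List ℕ → Formula
  | φ, [] => φ
  | φ, p :: V => forget (or (subst p top φ) (subst p bot φ)) V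

/-- Logical consequence: every model of `φ` is a model of `ψ`. -/
def Entails (φ ψ : Formula) : Prop := ∀ I : Set ℕ, Sat I φ → Sat I ψ

/-- Logical equivalence. -/
def Equivalent (φ ψ : Formula) : Prop := Entails φ ψ ∧ Entails ψ φ

end Formula

/-! ### Clauses and Krom theories -/

/-- A literal: an atom with its sign (`true` for the atom, `false` for its negation). -/
structure Literal : Type where
  sign : Bool
  atom : ℕ

/-- The complement of a literal. -/
def Literal.compl (l : Literal) : Literal := ⟨!l.sign, l.atom⟩

def Literal.toFormula (l : Literal) : Formula :=
  if l.sign then .atom l.atom else .neg (.atom l.atom)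

/-- The disjunction of a list of literals; the empty disjunction is false. -/
def disj : List Literal → Formula
  | [] => .bot
  | l :: c => .or l.toFormula (disj c)

/-- The conjunction of a list of clauses; the empty conjunction is true. -/
def conj : List (List Literal) → Formula
  | [] => .top
  | c :: T => .and (disj c) (conj T)

/-- A list of literals is a Krom clause if it has at most two entries and contains no pair of
complementary literals. -/
def IsKromClause (c : List Literal) : Prop :=
  c.length ≤ 2 ∧ ∀ l ∈ c, l.compl ∉ c

/-- A Krom theory (a 2-CNF formula), given as a list of Krom clauses. -/
def KromTheory : Type := {T : List (List Literal) // ∀ c ∈ T, IsKromClause c}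

def KromTheory.toFormula (T : KromTheory) : Formula := conj T.1

/-! ### Instances as words over the alphabet `Γ'` (blank, two bits, two brackets, comma).
Atoms are written in binary. -/

def encodeAtom (p : ℕ) : List Γ' := Γ'.comma :: (encodeNat p).map Γ'.bit

def encodeLiteral (l : Literal) : List Γ' :=
  Γ'.comma :: Γ'.bit l.sign :: (encodeNat l.atom).map Γ'.bit

def encodeClause (c : List Literal) : List Γ' :=
  Γ'.bra :: c.flatMap encodeLiteral ++ [Γ'.ket]

def encodeAtoms (V : List ℕ) : List Γ' := V.flatMap encodeAtom

def encodeTheory (T : KromTheory) : List Γ' := T.1.flatMap encodeClause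

/-- The word for an instance consisting of one Krom theory and a list of atoms. -/
def encodeOne (x : KromTheory × List ℕ) : List Γ' :=
  encodeTheory x.1 ++ Γ'.blank :: encodeAtoms x.2

/-- The word for an instance consisting of two Krom theories and a list of atoms. -/
def encodeTwo (x : KromTheory × KromTheory × List ℕ) : List Γ' :=
  encodeTheory x.1 ++ Γ'.blank :: encodeOne x.2

/-! The encodings are injective, by means of a parser that reads a word from right to left. -/

/-- The state of the parser: the current bits, the current list of bit strings, the current list of
clauses, and the completed blocks. -/
structure ParseState : Type where
  bits : List Bool
  strings : List (List Bool)
  clauses : List (List (List Bool))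
  blocks : List (List (List (List Bool)) × List (List Bool))

def parseStep : Γ' → ParseState → ParseState
  | .bit b, s => { s with bits := b :: s.bits }
  | .comma, s => { s with bits := [], strings := s.bits :: s.strings }
  | .bra, s => { s with strings := [], clauses := s.strings :: s.clauses }
  | .ket, s => s
  | .blank, s => ⟨[], [], [], (s.clauses, s.strings) :: s.blocks⟩

def parse (w : List Γ') : ParseState := w.foldr parseStep ⟨[], [], [], []⟩

theorem foldr_bits (u : List Bool) (s : ParseState) :
    (u.map Γ'.bit).foldr parseStep s = { s with bits := u ++ s.bits } := by
  induction u with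
  | nil => rfl
  | cons b u ih => simp [ih, parseStep]

theorem foldr_atoms (V : List ℕ) (S C B) :
    (encodeAtoms V).foldr parseStep ⟨[], S, C, B⟩ = ⟨[], V.map encodeNat ++ S, C, B⟩ := by
  induction V with
  | nil => rfl
  | cons p V ih =>
    simp only [encodeAtoms] at ih
    simp [encodeAtoms, encodeAtom, ih, foldr_bits, parseStep]

theorem foldr_literals (c : List Literal) (S C B) :
    (c.flatMap encodeLiteral).foldr parseStep ⟨[], S, C, B⟩ =
      ⟨[], c.map (fun l => l.sign :: encodeNat l.atom) ++ S, C, B⟩ := by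
  induction c with
  | nil => rfl
  | cons l c ih => simp [encodeLiteral, ih, foldr_bits, parseStep]

theorem foldr_clauses (T : List (List Literal)) (C B) :
    (T.flatMap encodeClause).foldr parseStep ⟨[], [], C, B⟩ =
      ⟨[], [], T.map (List.map fun l => l.sign :: encodeNat l.atom) ++ C, B⟩ := by
  induction T with
  | nil => rfl
  | cons c T ih => simp [encodeClause, ih, foldr_literals, parseStep]

theorem encodeNat_inj : Function.Injective encodeNat :=
  Function.LeftInverse.injective decode_encodeNat

theorem clauses_inj :
    Function.Injective (List.map (List.map fun l : Literal => l.sign :: encodeNat l.atom)) := by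
  refine List.map_injective_iff.2 (List.map_injective_iff.2 ?_)
  rintro ⟨a, p⟩ ⟨b, q⟩ h
  obtain ⟨h₁, h₂⟩ := List.cons.inj h
  cases h₁
  cases encodeNat_inj h₂
  rfl

theorem encodeTheory_injective : Function.Injective encodeTheory := by
  intro S T h
  have h' := congrArg parse h
  simp only [encodeTheory, parse, foldr_clauses, ParseState.mk.injEq, List.append_nil] at h'
  exact Subtype.ext (clauses_inj h'.2.2.1)

theorem encodeOne_injective : Function.Injective encodeOne := by
  rintro ⟨S, V⟩ ⟨T, W⟩ h
  have h' := congrArg parse h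
  simp [encodeOne, encodeTheory, parse, List.foldr_append, foldr_clauses, foldr_atoms,
    parseStep] at h'
  exact Prod.ext (Subtype.ext (clauses_inj h'.1))
    (List.map_injective_iff.2 encodeNat_inj h'.2)

theorem encodeTwo_injective : Function.Injective encodeTwo := by
  rintro ⟨P, S, V⟩ ⟨Q, T, W⟩ h
  have h' := congrArg parse h
  simp [encodeTwo, encodeOne, encodeTheory, parse, List.foldr_append, foldr_clauses, foldr_atoms,
    parseStep] at h'
  exact Prod.ext (Subtype.ext (clauses_inj h'.1)) (Prod.ext (Subtype.ext (clauses_inj h'.2.1))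
    (List.map_injective_iff.2 encodeNat_inj h'.2.2))

/-! ### Polynomial time -/

/-- The function `f` is computed, with respect to the given encodings, by a Turing machine in a
number of steps that is polynomial in the length of the input word. -/
def PolyTimeComputable {α β : Type} (ea : α → List Γ') {Δ : Type} (eb : β → List Δ)
    (f : α → β) : Prop :=
  Nonempty (TM2ComputableInPolyTime ea eb f)

/-- The property `p` of instances is decided by a Turing machine in polynomial time. -/
def Tractable {α : Type} (ea : α → List Γ') (p : α → Prop) : Prop :=
  ∃ f : α → Bool, (∀ x, f x = true ↔ p x) ∧ PolyTimeComputable ea encodeBool f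

end KromForget

/-! Forgetting is existential projection: `I` satisfies `Forget(φ, V)` iff some model of `φ` agrees
with `I` outside `V` (`Formula.sat_forget`). The models of a set of clauses with at most two
literals are closed under majority (`Binary.majority`), and a set of interpretations with this
closure, restricted to finitely many atoms, is determined by its restrictions to pairs of atoms
(`exists_agree`). Hence `Forget(Σ, V)` is equivalent to the conjunction of the implied clauses with
at most two literals over `Var(Σ) \ V` (`Represents.sat_forget_iff`), of which there are
quadratically many.

This reduces `Π ⊨ Forget(Σ, V)` to polynomially many questions of the form "does a Krom theory imply
this clause?". For `Forget(Π, V) ⊨ Σ`, each clause of `Σ` loses its literals over `V`, and the rest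
must follow from `Π` (`Represents.forget_entails_iff`). Since `Forget(Σ, V)` does not depend on `V`,
forgetting on the left makes no difference to entailing it (`forget_entails_forget_iff`), and the
other problems are combinations of these two.

Implication of a clause is decided by unit propagation (`implied_iff`). With clauses of two
literals, a propagation without conflict leaves a partial assignment that makes true every clause in
which it makes a literal false. Such assignments can be merged, one taking precedence over the other
(`Good.merge`), so the clause is not implied exactly if its negation propagates without conflict and
every atom has a value that does.

Polynomial time is obtained for actual stack machines. The input becomes a list of tokens carrying
finitely many marks. A small command language sets marks, moves pointers, reads atoms bit by bit,
emits symbols, and repeats a command as often as there are cells on the main stack. No command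
changes the number of cells, so nested loops multiply polynomial bounds, and every command compiles
to a polynomial-time machine (`compiles`). The algorithms are commands, verified on the abstract
semantics `run` by loop invariants; `Represents` links the tokens to the theories. -/

namespace KromForget

open Computability Turing

set_option linter.unusedSectionVars false
set_option linter.constructorNameAsVariable false

/-! ### Fragments of stack machines -/

section Fragments

variable {K : Type} [DecidableEq K] {Γ : K → Type} {σ Λ Λ' : Type}

/-- Relabel the jumps of a statement by `g` and replace `halt` by `e`. -/
def substStmt (g : Λ → Λ') (e : TM2.Stmt Γ Λ' σ) : TM2.Stmt Γ Λ σ → TM2.Stmt Γ Λ' σ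
  | .push k f q => .push k f (substStmt g e q)
  | .peek k f q => .peek k f (substStmt g e q)
  | .pop k f q => .pop k f (substStmt g e q)
  | .load f q => .load f (substStmt g e q)
  | .branch f q r => .branch f (substStmt g e q) (substStmt g e r)
  | .goto f => .goto fun v => g (f v)
  | .halt => e

/-- The configuration after `substStmt`, given the configuration without it. -/
def substCfg (g : Λ → Λ') (e : TM2.Stmt Γ Λ' σ) : TM2.Cfg Γ Λ σ → TM2.Cfg Γ Λ' σ
  | ⟨some l, v, S⟩ => ⟨some (g l), v, S⟩
  | ⟨none, v, S⟩ => TM2.stepAux e v S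

theorem stepAux_substStmt (g : Λ → Λ') (e : TM2.Stmt Γ Λ' σ) (q : TM2.Stmt Γ Λ σ) (v : σ)
    (S : ∀ k, List (Γ k)) :
    TM2.stepAux (substStmt g e q) v S = substCfg g e (TM2.stepAux q v S) := by
  induction q generalizing v S with
  | branch f q r ihq ihr =>
    simp only [substStmt, TM2.stepAux]
    cases f v
    · exact ihr v S
    · exact ihq v S
  | goto f => rfl
  | halt => rfl
  | _ => simp_all [substStmt]

/-- `ReachIn M n c c'`: the machine goes from `c` to `c'` in exactly `n` steps. -/
inductive ReachIn (M : Λ → TM2.Stmt Γ Λ σ) : ℕ → TM2.Cfg Γ Λ σ → TM2.Cfg Γ Λ σ → Prop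
  | refl (c) : ReachIn M 0 c c
  | head {n c c' c''} : TM2.step M c = some c' → ReachIn M n c' c'' → ReachIn M (n + 1) c c''

theorem ReachIn.trans {M : Λ → TM2.Stmt Γ Λ σ} {m n c c' c''} (h : ReachIn M m c c')
    (h' : ReachIn M n c' c'') : ReachIn M (m + n) c c'' := by
  induction h with
  | refl c => simpa using h'
  | @head k _ _ _ hs _ ih =>
    rw [Nat.add_right_comm]
    exact .head hs (ih h')

theorem ReachIn.iterate {M : Λ → TM2.Stmt Γ Λ σ} {n c c'} (h : ReachIn M n c c') :
    (flip bind (TM2.step M))^[n] (some c) = some c' := by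
  induction h with
  | refl c => rfl
  | head hs _ ih =>
    rw [Function.iterate_succ_apply]
    simpa [flip, hs] using ih

/-- A run of a fragment that ends in its exit is a run of any machine containing it. -/
theorem ReachIn.subst {M : Λ → TM2.Stmt Γ Λ σ} {M' : Λ' → TM2.Stmt Γ Λ' σ} {g : Λ → Λ'}
    {e : TM2.Stmt Γ Λ' σ} (hM : ∀ l, M' (g l) = substStmt g e (M l)) {n l v S v' S'}
    (h : ReachIn M n ⟨some l, v, S⟩ ⟨none, v', S'⟩) :
    ReachIn M' n ⟨some (g l), v, S⟩ (TM2.stepAux e v' S') := by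
  induction n generalizing l v S with
  | zero => cases h
  | succ n ih =>
    obtain _ | ⟨hs, hr⟩ := h
    rename_i c'
    simp only [TM2.step, Option.some.injEq] at hs
    have hs' : TM2.step M' ⟨some (g l), v, S⟩ = some (substCfg g e c') := by
      simp [TM2.step, hM, stepAux_substStmt, hs]
    refine .head hs' ?_
    obtain ⟨_ | l', w, T⟩ := c'
    · cases hr with
      | refl => exact .refl _
      | head h _ => simp [TM2.step] at h
    · exact ih hr

variable (Γ σ) in
/-- A piece of machine code with an entry; it is left by `halt`. -/
structure Frag where
  Lab : Type
  fin : Fintype Lab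
  entry : Lab
  code : Lab → TM2.Stmt Γ Lab σ

/-- `F` transforms the stacks `S` into `S'` in at most `t` steps, whatever the internal state. -/
def Frag.Runs (F : Frag Γ σ) (S S' : ∀ k, List (Γ k)) (t : ℕ) : Prop :=
  ∀ v, ∃ v' n, n ≤ t ∧ ReachIn F.code n ⟨some F.entry, v, S⟩ ⟨none, v', S'⟩

theorem Frag.Runs.mono {F : Frag Γ σ} {S S' t t'} (h : F.Runs S S' t) (ht : t ≤ t') :
    F.Runs S S' t' := fun v =>
  let ⟨v', n, hn, hr⟩ := h v
  ⟨v', n, hn.trans ht, hr⟩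

/-- Run one fragment after the other. -/
def Frag.seq (F G : Frag Γ σ) : Frag Γ σ where
  Lab := F.Lab ⊕ G.Lab
  fin := letI := F.fin; letI := G.fin; inferInstance
  entry := .inl F.entry
  code
    | .inl l => substStmt .inl (.goto fun _ => .inr G.entry) (F.code l)
    | .inr l => substStmt .inr .halt (G.code l)

theorem Frag.Runs.seq {F G : Frag Γ σ} {S S' S'' t t'} (h : F.Runs S S' t)
    (h' : G.Runs S' S'' t') : (F.seq G).Runs S S'' (t + t') := by
  intro v
  obtain ⟨v', n, hn, hr⟩ := h v
  obtain ⟨v'', n', hn', hr'⟩ := h' v'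
  refine ⟨v'', n + n', Nat.add_le_add hn hn', ?_⟩
  exact (hr.subst (M' := (F.seq G).code) (g := .inl) fun _ => rfl).trans
    (hr'.subst (M' := (F.seq G).code) (g := .inr) (e := .halt) fun _ => rfl)

/-- Pop `k`; run the body and repeat as long as the popped symbol satisfies `p`. -/
def Frag.loop (F : Frag Γ σ) (k : K) (rd : σ → Option (Γ k) → σ) (p : σ → Bool) : Frag Γ σ where
  Lab := Option F.Lab
  fin := letI := F.fin; inferInstance
  entry := none
  code
    | none => .pop k rd (.branch p (.goto fun _ => some F.entry) .halt)
    | some l => substStmt some (.goto fun _ => none) (F.code l)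

/-- The test must have the same outcome for every internal state `v`: the register it inspects has
just been overwritten by the popped symbol. The symbol that ends the loop is consumed too. -/
theorem Frag.loop_runs_exit (F : Frag Γ σ) (k : K) (rd : σ → Option (Γ k) → σ) (p : σ → Bool)
    {S : ∀ k, List (Γ k)} (h : ∀ v, p (rd v (S k).head?) = false) :
    (F.loop k rd p).Runs S (Function.update S k (S k).tail) 1 := fun v =>
  ⟨_, 1, le_rfl, .head (by simp [Frag.loop, h]; rfl) (.refl _)⟩

theorem Frag.loop_runs_step (F : Frag Γ σ) (k : K) (rd : σ → Option (Γ k) → σ) (p : σ → Bool)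
    {S S' S'' : ∀ k, List (Γ k)} {t t' : ℕ} (h : ∀ v, p (rd v (S k).head?) = true)
    (hF : F.Runs (Function.update S k (S k).tail) S' t) (hL : (F.loop k rd p).Runs S' S'' t') :
    (F.loop k rd p).Runs S S'' (t + 1 + t') := by
  intro v
  obtain ⟨v', n, hn, hr⟩ := hF (rd v (S k).head?)
  obtain ⟨v'', n', hn', hr'⟩ := hL v'
  refine ⟨v'', n + n' + 1, by omega, ?_⟩
  refine .head (c' := ⟨some (some F.entry), rd v (S k).head?,
    Function.update S k (S k).tail⟩) ?_ ?_
  · simp [Frag.loop, h]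
  · exact (hr.subst (M' := (F.loop k rd p).code) (g := some) fun _ => rfl).trans hr'

end Fragments

/-! ### The stacks used here -/

/-- The stacks: input, main, auxiliary, loop counter, reversed output, output. -/
inductive Stk
  | inp | main | aux | ctr | out | res
  deriving DecidableEq

instance : Fintype Stk :=
  ⟨{.inp, .main, .aux, .ctr, .out, .res}, fun x => by cases x <;> simp⟩

/-- The alphabets of the stacks. -/
abbrev StkSym (C D : Type) : Stk → Type
  | .inp => Γ'
  | .main => C
  | .aux => C
  | .ctr => Bool
  | .out => D
  | .res => D

/-- The internal state: the symbols read last. -/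
structure Reg (C D : Type) where
  i : Option Γ'
  c : Option C
  b : Option Bool
  d : Option D

noncomputable instance {C D : Type} [Finite C] [Finite D] : Fintype (Reg C D) := by
  have : Function.Injective (fun r : Reg C D => (r.i, r.c, r.b, r.d)) := by
    rintro ⟨_, _, _, _⟩ ⟨_, _, _, _⟩ h
    simpa using h
  have := Finite.of_injective _ this
  exact Fintype.ofFinite _

section Machine

variable {C D : Type}

def store (i : List Γ') (m a : List C) (c : List Bool) (o r : List D) :
    ∀ k, List (StkSym C D k)
  | .inp => i
  | .main => m
  | .aux => a
  | .ctr => c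
  | .out => o
  | .res => r

variable (i : List Γ') (m a : List C) (c : List Bool) (o r : List D)

@[simp] theorem update_inp (x) :
    Function.update (store i m a c o r) .inp x = store x m a c o r := by
  funext k; cases k <;> rfl
@[simp] theorem update_main (x) :
    Function.update (store i m a c o r) .main x = store i x a c o r := by
  funext k; cases k <;> rfl
@[simp] theorem update_aux (x) :
    Function.update (store i m a c o r) .aux x = store i m x c o r := by
  funext k; cases k <;> rfl
@[simp] theorem update_ctr (x) :
    Function.update (store i m a c o r) .ctr x = store i m a x o r := by
  funext k; cases k <;> rfl
@[simp] theorem update_out (x) :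
    Function.update (store i m a c o r) .out x = store i m a c x r := by
  funext k; cases k <;> rfl
@[simp] theorem update_res (x) :
    Function.update (store i m a c o r) .res x = store i m a c o x := by
  funext k; cases k <;> rfl
@[simp] theorem store_inp : store i m a c o r .inp = i := rfl
@[simp] theorem store_main : store i m a c o r .main = m := rfl
@[simp] theorem store_aux : store i m a c o r .aux = a := rfl
@[simp] theorem store_ctr : store i m a c o r .ctr = c := rfl
@[simp] theorem store_out : store i m a c o r .out = o := rfl
@[simp] theorem store_res : store i m a c o r .res = r := rfl

variable [Inhabited C] [Inhabited D]

/-- Push an optional symbol on the output stack. -/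
def pushOut {Λ : Type} (f : Reg C D → Option D) (q : TM2.Stmt (StkSym C D) Λ (Reg C D)) :
    TM2.Stmt (StkSym C D) Λ (Reg C D) :=
  .branch (fun v => (f v).isSome) (.push .out (fun v => (f v).getD default) q) q

theorem stepAux_pushOut {Λ : Type} (f : Reg C D → Option D)
    (q : TM2.Stmt (StkSym C D) Λ (Reg C D)) (v) :
    TM2.stepAux (pushOut f q) v (store i m a c o r) =
      TM2.stepAux q v (store i m a c ((f v).toList ++ o) r) := by
  unfold pushOut
  cases h : f v <;> simp [h]

variable (C D) in
/-- A transducer that reads the main stack downwards, rewriting it and emitting symbols, and then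
reads it upwards, rewriting it again. -/
structure Sweep where
  Qf : Type
  Qb : Type
  finf : Fintype Qf
  finb : Fintype Qb
  init : Qf
  fwd : Qf → C → Qf × C
  em₁ : Qf → C → Option D := fun _ _ => none
  em₂ : Qf → C → Option D := fun _ _ => none
  turn : Qf → Qb
  bwd : Qb → C → Qb × C

/-- The final state and the rewritten list of a transducer reading a list from the left. -/
def mapF {Q : Type} (f : Q → C → Q × C) (q : Q) : List C → Q × List C
  | [] => (q, [])
  | x :: l => ((mapF f (f q x).1 l).1, (f q x).2 :: (mapF f (f q x).1 l).2)

/-- The symbols emitted by a transducer reading a list from the left. -/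
def emF {Q : Type} (f : Q → C → Q × C) (e₁ e₂ : Q → C → Option D) (q : Q) : List C → List D
  | [] => []
  | x :: l => (e₁ q x).toList ++ (e₂ q x).toList ++ emF f e₁ e₂ (f q x).1 l

/-- The final state and the rewritten list of a transducer reading a list from the right. -/
def mapB {Q : Type} (f : Q → C → Q × C) (q : Q) : List C → Q × List C
  | [] => (q, [])
  | x :: l => ((f (mapB f q l).1 x).1, (f (mapB f q l).1 x).2 :: (mapB f q l).2)

theorem mapB_append {Q : Type} (f : Q → C → Q × C) (q : Q) (l l' : List C) :
    mapB f q (l ++ l') =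
      ((mapB f (mapB f q l').1 l).1, (mapB f (mapB f q l').1 l).2 ++ (mapB f q l').2) := by
  induction l with
  | nil => rfl
  | cons x l ih => simp [mapB, ih]

/-! ### One pass down and up the main stack. -/

namespace Sweep

variable (s : Sweep C D)

/-- The downward pass moves the main stack to `aux`, the upward pass moves it back. With `tick`,
each cell also pushes a `true` on `ctr`, which leaves the length of the main stack there in unary.
-/
def frag (tick : Bool) : Frag (StkSym C D) (Reg C D) where
  Lab := s.Qf ⊕ s.Qb
  fin := letI := s.finf; letI := s.finb; inferInstance
  entry := .inl s.init
  code
    | .inl q => .pop .main (fun v x => { v with c := x }) <| .branch (fun v => v.c.isSome)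
        (pushOut (fun v => s.em₁ q (v.c.getD default)) <|
          pushOut (fun v => s.em₂ q (v.c.getD default)) <|
          .push .aux (fun v => (s.fwd q (v.c.getD default)).2) <|
          .branch (fun _ => tick)
            (.push .ctr (fun _ => true) (.goto fun v => .inl (s.fwd q (v.c.getD default)).1))
            (.goto fun v => .inl (s.fwd q (v.c.getD default)).1))
        (.goto fun _ => .inr (s.turn q))
    | .inr q => .pop .aux (fun v x => { v with c := x }) <| .branch (fun v => v.c.isSome)
        (.push .main (fun v => (s.bwd q (v.c.getD default)).2) <|
          .goto fun v => .inr (s.bwd q (v.c.getD default)).1)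
        .halt

/-- The list into which the main stack is rewritten. -/
def result (l : List C) : List C :=
  (mapB s.bwd (s.turn (mapF s.fwd s.init l).1) (mapF s.fwd s.init l).2).2

/-- The emitted symbols. -/
def emitted (l : List C) : List D := emF s.fwd s.em₁ s.em₂ s.init l

theorem reach_inl (tick : Bool) (q v) : ∃ v',
    ReachIn (s.frag tick).code (m.length + 1) ⟨some (.inl q), v, store i m a c o r⟩
      ⟨some (.inr (s.turn (mapF s.fwd q m).1)), v',
        store i [] ((mapF s.fwd q m).2.reverse ++ a)
          (List.replicate (if tick then m.length else 0) true ++ c)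
          ((emF s.fwd s.em₁ s.em₂ q m).reverse ++ o) r⟩ := by
  induction m generalizing q v a c o with
  | nil => exact ⟨_, .head (by simp [frag]; rfl) (by cases tick <;> exact .refl _)⟩
  | cons x m ih =>
    obtain ⟨v', h⟩ := ih ((s.fwd q x).2 :: a) (if tick then true :: c else c)
      ((s.em₂ q x).toList ++ ((s.em₁ q x).toList ++ o)) (s.fwd q x).1 { v with c := some x }
    refine ⟨v', .head (c' := ⟨some (.inl (s.fwd q x).1), { v with c := some x },
      store i m ((s.fwd q x).2 :: a) (if tick then true :: c else c)
        ((s.em₂ q x).toList ++ ((s.em₁ q x).toList ++ o)) r⟩) ?_ ?_⟩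
    · cases tick <;> simp [frag, stepAux_pushOut]
    · convert h using 3
      · simp
      · rfl
      · simp [mapF]
      · cases tick <;> simp [List.replicate_succ']
      · cases h₁ : s.em₁ q x <;> cases h₂ : s.em₂ q x <;> simp [emF, h₁, h₂]

theorem reach_inr (tick : Bool) (q v) : ∃ v',
    ReachIn (s.frag tick).code (a.length + 1) ⟨some (.inr q), v, store i m a c o r⟩
      ⟨none, v', store i ((mapB s.bwd q a.reverse).2 ++ m) [] c o r⟩ := by
  induction a generalizing q v m with
  | nil => exact ⟨_, .head (by simp [frag]; rfl) (by exact .refl _)⟩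
  | cons x a ih =>
    obtain ⟨v', h⟩ := ih ((s.bwd q x).2 :: m) (s.bwd q x).1 { v with c := some x }
    refine ⟨v', .head (c' := ⟨some (.inr (s.bwd q x).1), { v with c := some x },
      store i ((s.bwd q x).2 :: m) a c o r⟩) ?_ ?_⟩
    · simp [frag]
    · simpa [mapB_append, mapB] using h

theorem length_mapF {Q : Type} (f : Q → C → Q × C) (q : Q) (l : List C) :
    (mapF f q l).2.length = l.length := by
  induction l generalizing q with
  | nil => rfl
  | cons x l ih => simp [mapF, ih]

/-- Each direction costs one step per cell and one more to find its stack empty. -/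
theorem runs (tick : Bool) : (s.frag tick).Runs (store i m [] c o r)
    (store i (s.result m) [] (List.replicate (if tick then m.length else 0) true ++ c)
      ((s.emitted m).reverse ++ o) r) (2 * m.length + 2) := by
  intro v
  obtain ⟨v', h⟩ := s.reach_inl i m [] c o r tick s.init v
  obtain ⟨v'', h'⟩ := s.reach_inr i [] ((mapF s.fwd s.init m).2.reverse ++ [])
    (List.replicate (if tick then m.length else 0) true ++ c)
    ((emF s.fwd s.em₁ s.em₂ s.init m).reverse ++ o) r tick _ v'
  simp only [List.append_nil, List.reverse_reverse, List.length_reverse, length_mapF] at h h'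
  exact ⟨v'', _, by omega, h.trans h'⟩

end Sweep

/-! ### Loops -/

/-- Push a loop marker. -/
def markFrag : Frag (StkSym C D) (Reg C D) where
  Lab := Unit
  fin := inferInstance
  entry := ()
  code _ := .push .ctr (fun _ => false) .halt

theorem markFrag_runs : (markFrag : Frag (StkSym C D) (Reg C D)).Runs (store i m a c o r)
    (store i m a (false :: c) o r) 1 := fun v =>
  ⟨v, 1, le_rfl, .head (by simp [markFrag]) (.refl _)⟩

/-- The sweep that changes nothing. -/
def idSweep : Sweep C D where
  Qf := Unit
  Qb := Unit
  finf := inferInstance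
  finb := inferInstance
  init := ()
  fwd _ x := ((), x)
  turn := id
  bwd _ x := ((), x)

theorem idSweep_result : (idSweep : Sweep C D).result m = m := by
  have hF : ∀ l : List C, (mapF (fun (_ : Unit) x => ((), x)) () l).2 = l := fun l => by
    induction l with
    | nil => rfl
    | cons x l ih => simp [mapF, ih]
  have hB : ∀ l : List C, (mapB (fun (_ : Unit) x => ((), x)) () l).2 = l := fun l => by
    induction l with
    | nil => rfl
    | cons x l ih => simp [mapB, ih]
  simp [Sweep.result, idSweep, hF, hB]

theorem idSweep_emitted : (idSweep : Sweep C D).emitted m = [] := by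
  have : ∀ l : List C, emF (fun (_ : Unit) x => ((), x)) (fun _ _ => none)
      (fun _ _ => none) () l = ([] : List D) := fun l => by
    induction l with
    | nil => rfl
    | cons x l ih => simp [emF, ih]
  exact this m

/-- Each round consumes a `true`; the loop ends at the `false` marker below. All nested loops share
`ctr`, and the markers separate their counters. -/
def ctrLoop (F : Frag (StkSym C D) (Reg C D)) : Frag (StkSym C D) (Reg C D) :=
  F.loop .ctr (fun v x => { v with b := x }) fun v => v.b.getD false

/-- Run `F` as many times as there are symbols on the main stack. -/
def repFrag (F : Frag (StkSym C D) (Reg C D)) : Frag (StkSym C D) (Reg C D) :=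
  markFrag.seq ((idSweep.frag true).seq (ctrLoop F))

/-- The abstract state space `X` lets the effect of the loop be an iterate of `h`. The body is
assumed to restore any content of `ctr`, which is what allows it to contain further loops. -/
theorem ctrLoop_runs {X : Type} {st : X → List Bool → ∀ k, List (StkSym C D k)} {h : X → X}
    {F : Frag (StkSym C D) (Reg C D)} {t : ℕ} (hst : ∀ x c, st x c .ctr = c)
    (hupd : ∀ x c c', Function.update (st x c) .ctr c' = st x c')
    (hF : ∀ x c, F.Runs (st x c) (st (h x) c) t) (n : ℕ) (x : X) (c : List Bool) :
    (ctrLoop F).Runs (st x (List.replicate n true ++ false :: c)) (st (h^[n] x) c)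
      (n * (t + 1) + 1) := by
  induction n generalizing x with
  | zero =>
    have := F.loop_runs_exit .ctr (fun v x => { v with b := x }) (fun v => v.b.getD false)
      (S := st x (false :: c)) (by simp [hst])
    rw [hst, hupd] at this
    rw [Nat.zero_mul]
    exact this
  | succ n ih =>
    have := F.loop_runs_step .ctr (fun v x => { v with b := x }) (fun v => v.b.getD false)
      (S := st x (List.replicate (n + 1) true ++ false :: c)) (t := t)
      (S' := st (h x) (List.replicate n true ++ false :: c)) (by simp [hst, List.replicate_succ])
      (by rw [hst, hupd]; exact hF _ _) (ih _)
    exact this.mono (by rw [Nat.succ_mul]; omega)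

/-- The bound is the sum of 1 for the marker, `2 * n + 2` for the counting sweep and `n * (t + 1) +
1` for the loop. -/
theorem repFrag_runs {X : Type} {F : Frag (StkSym C D) (Reg C D)} {h : X → X}
    {main : X → List C} {out : X → List D} {n t : ℕ} (hn : ∀ x, (main x).length = n)
    (hF : ∀ x c, F.Runs (store i (main x) [] c (out x) r)
      (store i (main (h x)) [] c (out (h x)) r) t) (x : X) :
    (repFrag F).Runs (store i (main x) [] c (out x) r)
      (store i (main (h^[n] x)) [] c (out (h^[n] x)) r) (n * (t + 3) + 4) := by
  have h₁ := (markFrag_runs i (main x) [] c (out x) r).seq <|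
    ((idSweep : Sweep C D).runs i (main x) (false :: c) (out x) r true).seq (by
      rw [idSweep_result, idSweep_emitted, List.reverse_nil, List.nil_append, if_pos rfl, hn x]
      exact ctrLoop_runs (st := fun x c => store i (main x) [] c (out x) r) (h := h)
        (by simp) (by simp) hF n x c)
  exact h₁.mono (by rw [hn x]; ring_nf; omega)

/-! ### The first and the last phase of a machine -/

/-- Read the input by a transducer, and put its output on the main stack, followed by `z`. -/
def readFrag {Q : Type} (fin : Fintype Q) (init : Q) (f : Q → Γ' → Q × Option C) (z : C) :
    Frag (StkSym C D) (Reg C D) where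
  Lab := Option (Q ⊕ Unit)
  fin := inferInstance
  entry := none
  code
    | none => .push .main (fun _ => z) (.goto fun _ => some (.inl init))
    | some (.inl q) => .pop .inp (fun v x => { v with i := x }) <| .branch (fun v => v.i.isSome)
        (.branch (fun v => (f q (v.i.getD default)).2.isSome)
          (.push .aux (fun v => (f q (v.i.getD default)).2.getD default)
            (.goto fun v => some (.inl (f q (v.i.getD default)).1)))
          (.goto fun v => some (.inl (f q (v.i.getD default)).1)))
        (.goto fun _ => some (.inr ()))
    | some (.inr _) => .pop .aux (fun v x => { v with c := x }) <| .branch (fun v => v.c.isSome)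
        (.push .main (fun v => v.c.getD default) <| .goto fun _ => some (.inr ()))
        .halt

/-- The output of a transducer. -/
def transduce {Q : Type} (f : Q → Γ' → Q × Option C) (q : Q) : List Γ' → List C
  | [] => []
  | x :: l => (f q x).2.toList ++ transduce f (f q x).1 l

theorem length_transduce {Q : Type} (f : Q → Γ' → Q × Option C) (q : Q) (l : List Γ') :
    (transduce f q l).length ≤ l.length := by
  induction l generalizing q with
  | nil => simp [transduce]
  | cons x l ih =>
    have := ih (f q x).1
    cases h : (f q x).2 <;> simp [transduce, h] <;> omega

/-- One step pushes `z`, the input is read onto `aux` in reverse, and moving it to the main stack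
restores the order. At most one cell per input symbol is produced, whence the bound. -/
theorem readFrag_runs {Q : Type} (fin : Fintype Q) (init : Q) (f : Q → Γ' → Q × Option C) (z : C) :
    (readFrag (D := D) fin init f z).Runs (store i [] [] c o r)
      (store [] (transduce f init i ++ [z]) [] c o r) (2 * i.length + 3) := by
  have h₁ : ∀ i q v m a, ∃ v', ReachIn (readFrag (D := D) fin init f z).code (i.length + 1)
      ⟨some (some (.inl q)), v, store i m a c o r⟩
      ⟨some (some (.inr ())), v', store [] m ((transduce f q i).reverse ++ a) c o r⟩ := by
    intro i
    induction i with
    | nil => exact fun q v m a =>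
        ⟨{ v with i := none }, .head (by simp [readFrag, transduce]) (.refl _)⟩
    | cons x i ih =>
      intro q v m a
      obtain ⟨v', h⟩ := ih (f q x).1 { v with i := some x } m ((f q x).2.toList ++ a)
      refine ⟨v', .head (c' := ⟨some (some (.inl (f q x).1)), { v with i := some x },
        store i m ((f q x).2.toList ++ a) c o r⟩) ?_ ?_⟩
      · cases hx : (f q x).2 <;> simp [readFrag, hx]
      · rw [transduce, List.reverse_append, List.append_assoc]
        cases hx : (f q x).2 <;> (rw [hx] at h; exact h)
  have h₂ : ∀ a v m, ∃ v', ReachIn (readFrag (D := D) fin init f z).code (a.length + 1)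
      ⟨some (some (.inr ())), v, store [] m a c o r⟩
      ⟨none, v', store [] (a.reverse ++ m) [] c o r⟩ := by
    intro a
    induction a with
    | nil => exact fun v m => ⟨_, .head (by simp [readFrag]; rfl) (.refl _)⟩
    | cons x a ih =>
      intro v m
      obtain ⟨v', h⟩ := ih { v with c := some x } (x :: m)
      refine ⟨v', .head (c' := ⟨some (some (.inr ())), { v with c := some x },
        store [] (x :: m) a c o r⟩) ?_ ?_⟩
      · simp [readFrag]
      · rw [List.reverse_cons, List.append_assoc]
        exact h
  intro v
  obtain ⟨v', h⟩ := h₁ i init v [z] []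
  obtain ⟨v'', h'⟩ := h₂ ((transduce f init i).reverse ++ []) v' [z]
  simp only [List.append_nil, List.reverse_reverse, List.length_reverse] at h h'
  have := length_transduce f init i
  refine ⟨v'', _, ?_, .head (c' := ⟨some (some (.inl init)), v, store i [z] [] c o r⟩) ?_
    (h.trans h')⟩
  · omega
  · show some (TM2.stepAux _ _ _) = _
    simp [readFrag]

/-- Clear the main stack, reverse the output, and reset the internal state. -/
def writeFrag : Frag (StkSym C D) (Reg C D) where
  Lab := Bool
  fin := inferInstance
  entry := false
  code
    | false => .pop .main (fun v x => { v with c := x }) <| .branch (fun v => v.c.isSome)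
        (.goto fun _ => false) (.goto fun _ => true)
    | true => .pop .out (fun v x => { v with d := x }) <| .branch (fun v => v.d.isSome)
        (.push .res (fun v => v.d.getD default) (.goto fun _ => true))
        (.load (fun _ => ⟨none, none, none, none⟩) .halt)

/-- The prescribed halting configuration has the initial internal state and only the output stack
filled, hence the clearing and the reset. Sweeps leave the output with its last symbol on top;
popping it onto `res` puts it in order. -/
theorem writeFrag_reach (v) : ∃ n, n ≤ m.length + o.length + 2 ∧
    ReachIn (writeFrag (C := C) (D := D)).code n
      ⟨some (writeFrag (C := C) (D := D)).entry, v, store i m [] c o []⟩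
      ⟨none, ⟨none, none, none, none⟩, store i [] [] c [] o.reverse⟩ := by
  have h₁ : ∀ m v, ∃ v', ReachIn (writeFrag (C := C) (D := D)).code (m.length + 1)
      ⟨some false, v, store i m [] c o []⟩ ⟨some true, v', store i [] [] c o []⟩ := by
    intro m
    induction m with
    | nil => exact fun v => ⟨_, .head (by simp [writeFrag]; rfl) (.refl _)⟩
    | cons x m ih =>
      intro v
      obtain ⟨v', h⟩ := ih { v with c := some x }
      exact ⟨v', .head (by simp [writeFrag]) h⟩
  have h₂ : ∀ o v r, ReachIn (writeFrag (C := C) (D := D)).code (o.length + 1)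
      ⟨some true, v, store i [] [] c o r⟩
      ⟨none, ⟨none, none, none, none⟩, store i [] [] c [] (o.reverse ++ r)⟩ := by
    intro o
    induction o with
    | nil => exact fun v r => .head (by simp [writeFrag]) (.refl _)
    | cons x o ih =>
      intro v r
      refine .head (c' := ⟨some true, { v with d := some x }, store i [] [] c o (x :: r)⟩) ?_ ?_
      · simp [writeFrag]
      · rw [List.reverse_cons, List.append_assoc]
        exact ih { v with d := some x } (x :: r)
  obtain ⟨v', h⟩ := h₁ m v
  refine ⟨_, ?_, h.trans (by simpa using h₂ o v' [])⟩
  omega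

end Machine

/-! ### A command language on annotated instances

An instance is a list of tokens (occurrences of literals and atoms, ends of clauses, and a last
token); each token carries finitely many marks. -/

/-- The types of tokens: an occurrence of a literal, the end of a clause, an atom to be forgotten,
and the end of the instance. -/
inductive Typ
  | lit | ket | vat | fin
  deriving DecidableEq

instance : Fintype Typ := ⟨{.lit, .ket, .vat, .fin}, fun x => by cases x <;> decide⟩

/-- The finite part of a token: its type, its sign, and the section of the instance. -/
structure Kind where
  typ : Typ
  sgn : Bool
  sec : Fin 3
  deriving DecidableEq

/-- The last tokens of the groups, which are the clauses and the single other tokens. -/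
def Kind.last (k : Kind) : Bool := k.typ ≠ .lit

/-- A token: its position, the number of its group, its atom, and its finite part. -/
structure Info where
  idx : ℕ
  cid : ℕ
  atom : ℕ
  kind : Kind

/-- The marks. -/
inductive Tr
  | src | alive | b0 | b1 | sel | h0 | h1
  | AT | AF | fs | un | d1 | d0 | nf | cf
  | ent | c1
  | qp | qn | ent' | acc | grp | here | vm | t1 | t0 | tt
  deriving DecidableEq

instance : Fintype Tr :=
  ⟨{.src, .alive, .b0, .b1, .sel, .h0, .h1, .AT, .AF, .fs, .un, .d1, .d0, .nf, .cf, .ent, .c1,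
    .qp, .qn, .ent', .acc, .grp, .here, .vm, .t1, .t0, .tt}, fun x => by cases x <;> decide⟩

/-- The pointers. -/
inductive Ptr
  | x | y | z | w
  deriving DecidableEq

instance : Fintype Ptr := ⟨{.x, .y, .z, .w}, fun x => by cases x <;> decide⟩

/-- What can be seen at a token. -/
structure View where
  kind : Kind
  tr : Tr → Bool
  ptr : Ptr → Bool

instance : Finite Kind :=
  .of_injective (fun k : Kind => (k.typ, k.sgn, k.sec)) (by
    rintro ⟨_, _, _⟩ ⟨_, _, _⟩ h
    simpa using h)

instance : Finite View :=
  .of_injective (fun v : View => (v.kind, v.tr, v.ptr)) (by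
    rintro ⟨_, _, _⟩ ⟨_, _, _⟩ h
    simpa using h)

/-- The cells of the main stack: tokens, and bits with a mark saying whether they are used up. -/
abbrev Sym := View ⊕ (Bool × Bool)

/-- The states: the marks, the positions of the pointers, the number of bits used up, and the
output. -/
structure St (D : Type) where
  T : Tr → Info → Bool
  ptr : Ptr → ℕ
  used : ℕ
  out : List D

variable {D : Type}

def St.view (s : St D) (t : Info) : View := ⟨t.kind, fun X => s.T X t, fun p => s.ptr p == t.idx⟩

/-- The flags form a prefix, so a bit position, which is unbounded, is stored in the cells
themselves: the current bit of a token is its first unflagged one. -/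
def bitCells (k : ℕ) (u : List Bool) : List (Bool × Bool) :=
  (u.take k).map (·, true) ++ (u.drop k).map (·, false)

theorem map_bitCells {C : Type} (f : Bool → C) (k : ℕ) (u : List Bool) :
    (bitCells k u).map (fun b => f b.1) = u.map f := by
  conv_rhs => rw [← List.take_append_drop k u]
  simp only [bitCells, List.map_append, List.map_map]
  rfl

/-- Tokens with their bits, as cells. -/
def flat (l : List (View × List (Bool × Bool))) : List Sym :=
  l.flatMap fun x => .inl x.1 :: x.2.map .inr

def St.toks (s : St D) (xs : List Info) : List (View × List (Bool × Bool)) :=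
  xs.map fun t => (s.view t, bitCells s.used (encodeNat t.atom))

def St.cells (s : St D) (xs : List Info) : List Sym := flat (s.toks xs)

def size (xs : List Info) : ℕ := (xs.map fun t => (encodeNat t.atom).length + 1).sum

/-- The length is the same in all states, so a single number bounds the cost of every sweep and
counts the rounds of every loop. -/
theorem length_cells (s : St D) (xs : List Info) : (s.cells xs).length = size xs := by
  induction xs with
  | nil => rfl
  | cons t xs ih =>
    simp only [St.cells, St.toks, flat, size, List.map_cons, List.flatMap_cons, List.length_append,
      List.sum_cons, List.length_cons, List.length_map] at ih ⊢
    rw [ih]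
    simp only [bitCells, List.length_append, List.length_map, List.length_take, List.length_drop]
    omega

theorem length_le_size (xs : List Info) : xs.length ≤ size xs := by
  induction xs with
  | nil => simp
  | cons t xs ih =>
    simp only [size, List.map_cons, List.sum_cons, List.length_cons] at ih ⊢
    omega

theorem length_lt_size {xs : List Info} {t : Info} (ht : t ∈ xs) :
    (encodeNat t.atom).length < size xs := by
  have := List.single_le_sum (l := xs.map fun t => (encodeNat t.atom).length + 1) (by simp)
    _ (List.mem_map.2 ⟨t, ht, rfl⟩)
  exact this

variable (D) in
/-- The commands. -/
inductive Cmd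
  | upd (Y : Tr) (φ : View → Bool)
  | any (Y : Tr) (φ : View → Bool)
  | grp (Y : Tr) (φ : View → Bool)
  | zero (p : Ptr)
  | inc (p : Ptr)
  | reset
  | next
  | emit (e₁ e₂ : View → Option D) (pr : View → Bool) (bit : Bool → D)
  | seq (c d : Cmd)
  | rep (c : Cmd)

infixr:60 " ;; " => Cmd.seq

def St.set (s : St D) (Y : Tr) (A : Info → Bool) : St D := { s with T := Function.update s.T Y A }

/-- Use up the first `k` bits of every token, and mark the tokens by the next bit. -/
def St.load (s : St D) (k : ℕ) : St D :=
  { (s.set .h0 fun t => (encodeNat t.atom)[k]? == some false).set .h1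
      fun t => (encodeNat t.atom)[k]? == some true with used := k }

/-- The symbols emitted at a token. -/
def emitAt (e₁ e₂ : View → Option D) (pr : View → Bool) (bit : Bool → D) (v : View)
    (u : List Bool) : List D :=
  (e₁ v).toList ++ (e₂ v).toList ++ if pr v then u.map bit else []

/-- The meaning of the commands on the instance `xs`. -/
def run (xs : List Info) : Cmd D → St D → St D
  | .upd Y φ, s => s.set Y fun t => φ (s.view t)
  | .any Y φ, s => s.set Y fun _ => xs.any fun t' => φ (s.view t')
  | .grp Y φ, s => s.set Y fun t => xs.any fun t' => φ (s.view t') && t'.cid == t.cid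
  | .zero p, s => { s with ptr := Function.update s.ptr p 0 }
  | .inc p, s => { s with ptr := Function.update s.ptr p (s.ptr p + 1) }
  | .reset, s => s.load 0
  | .next, s => s.load (s.used + 1)
  | .emit e₁ e₂ pr bit, s =>
    { s with out := s.out ++ xs.flatMap fun t =>
        emitAt e₁ e₂ pr bit (s.view t) (encodeNat t.atom) }
  | .seq c d, s => run xs d (run xs c s)
  | .rep c, s => (run xs c)^[size xs] s

/-- The tokens are numbered from `i`, and the groups from `c`; `o` tells whether the first token
belongs to the group before it. -/
def Layout : ℕ → ℕ → Bool → List Info → Prop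
  | _, _, o, [] => o = false
  | i, c, _, t :: xs =>
    t.idx = i ∧ t.cid = c ∧
      Layout (i + 1) (if t.kind.last then c + 1 else c) (!t.kind.last) xs

theorem Layout.cid_ge {i c o xs} (h : Layout i c o xs) : ∀ t ∈ xs, c ≤ t.cid := by
  induction xs generalizing i c o with
  | nil => simp
  | cons t xs ih =>
    intro t' ht'
    rcases List.mem_cons.1 ht' with rfl | ht'
    · exact h.2.1.ge
    · have := ih h.2.2 t' ht'
      split at this <;> omega

theorem Layout.idx_ge {i c o xs} (h : Layout i c o xs) : ∀ t ∈ xs, i ≤ t.idx := by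
  induction xs generalizing i c o with
  | nil => simp
  | cons t xs ih =>
    intro t' ht'
    rcases List.mem_cons.1 ht' with rfl | ht'
    · exact h.1.ge
    · have := ih h.2.2 t' ht'
      omega

/-! ### Sweeps for the commands -/

/-- A transducer on tokens, on cells. -/
def lift {Q : Type} (f : Q → View → Q × View) (q : Q) : Sym → Q × Sym
  | .inl v => ((f q v).1, .inl (f q v).2)
  | .inr b => (q, .inr b)

def onFst {Q B : Type} (f : Q → View → Q × View) (q : Q) (x : View × B) : Q × (View × B) :=
  ((f q x.1).1, ((f q x.1).2, x.2))

theorem mapF_append {Q C : Type} (f : Q → C → Q × C) (q : Q) (l l' : List C) :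
    mapF f q (l ++ l') =
      ((mapF f (mapF f q l).1 l').1, (mapF f q l).2 ++ (mapF f (mapF f q l).1 l').2) := by
  induction l generalizing q with
  | nil => rfl
  | cons x l ih => simp [mapF, ih]

theorem mapF_lift_bits {Q : Type} (f : Q → View → Q × View) (q : Q) (u : List (Bool × Bool)) :
    mapF (lift f) q (u.map .inr) = (q, u.map .inr) := by
  induction u with
  | nil => rfl
  | cons b u ih => simp [mapF, lift, ih]

theorem mapB_lift_bits {Q : Type} (f : Q → View → Q × View) (q : Q) (u : List (Bool × Bool)) :
    mapB (lift f) q (u.map .inr) = (q, u.map .inr) := by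
  induction u with
  | nil => rfl
  | cons b u ih => simp [mapB, lift, ih]

/-- Bit cells are passed over without effect, so a transducer on tokens can be analysed on the list
of tokens alone. -/
theorem mapF_lift {Q : Type} (f : Q → View → Q × View) (q : Q)
    (l : List (View × List (Bool × Bool))) :
    mapF (lift f) q (flat l) = ((mapF (onFst f) q l).1, flat (mapF (onFst f) q l).2) := by
  induction l generalizing q with
  | nil => rfl
  | cons x l ih =>
    simp only [flat, List.flatMap_cons] at ih ⊢
    simp [mapF, mapF_append, lift, mapF_lift_bits, ih, onFst]

theorem mapB_lift {Q : Type} (f : Q → View → Q × View) (q : Q)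
    (l : List (View × List (Bool × Bool))) :
    mapB (lift f) q (flat l) = ((mapB (onFst f) q l).1, flat (mapB (onFst f) q l).2) := by
  induction l generalizing q with
  | nil => rfl
  | cons x l ih =>
    simp only [flat, List.flatMap_cons] at ih ⊢
    simp [mapB, mapB_append, lift, mapB_lift_bits, ih, onFst]

def tokSweep {Qf Qb : Type} (finf : Fintype Qf) (finb : Fintype Qb) (init : Qf)
    (fwd : Qf → View → Qf × View) (turn : Qf → Qb) (bwd : Qb → View → Qb × View) :
    Sweep Sym D where
  Qf := Qf
  Qb := Qb
  finf := finf
  finb := finb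
  init := init
  fwd := lift fwd
  turn := turn
  bwd := lift bwd

theorem emF_none {C Q : Type} (f : Q → C → Q × C) (q : Q) (l : List C) :
    emF f (fun _ _ => none) (fun _ _ => none) q l = ([] : List D) := by
  induction l generalizing q with
  | nil => rfl
  | cons x l ih => simp [emF, ih]

def View.set (v : View) (Y : Tr) (b : Bool) : View := { v with tr := Function.update v.tr Y b }

def View.setPtr (v : View) (p : Ptr) (b : Bool) : View :=
  { v with ptr := Function.update v.ptr p b }

theorem View.set_kind (v : View) (Y : Tr) (b : Bool) : (v.set Y b).kind = v.kind := rfl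

theorem View.set_tr (v : View) (Y : Tr) (b : Bool) : (v.set Y b).tr Y = b := by simp [View.set]

theorem View.set_set (v : View) (Y : Tr) (b b' : Bool) : (v.set Y b).set Y b' = v.set Y b' := by
  simp [View.set]

theorem St.view_set (s : St D) (Y : Tr) (A : Info → Bool) (t : Info) :
    (s.set Y A).view t = (s.view t).set Y (A t) := by
  simp only [St.view, St.set, View.set, View.mk.injEq, true_and, and_true]
  funext X
  by_cases h : X = Y
  · subst h; simp
  · simp [h]

theorem St.view_setPtr (s : St D) (p : Ptr) (n : ℕ) (t : Info) :
    St.view { s with ptr := Function.update s.ptr p n } t = (s.view t).setPtr p (n == t.idx) := by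
  simp only [St.view, View.setPtr, View.mk.injEq, true_and]
  funext X
  by_cases h : X = p
  · subst h; simp
  · simp [h]

/-- A command is compiled by a fragment that runs in polynomial time. -/
def Compiles (c : Cmd D) : Prop :=
  ∃ (F : Frag (StkSym Sym D) (Reg Sym D)) (p : Polynomial ℕ), ∀ xs, Layout 0 0 false xs →
    ∀ s i k r, F.Runs (store i (St.cells s xs) [] k s.out.reverse r)
      (store i ((run xs c s).cells xs) [] k (run xs c s).out.reverse r) (p.eval (size xs))

variable [Inhabited D]

theorem compiles_of_sweep {c : Cmd D} (w : Sweep Sym D)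
    (hr : ∀ xs, Layout 0 0 false xs → ∀ s : St D, w.result (s.cells xs) = (run xs c s).cells xs)
    (he : ∀ xs (s : St D), (run xs c s).out = s.out ++ w.emitted (s.cells xs)) : Compiles c := by
  refine ⟨w.frag false, 2 * .X + 2, fun xs hx s i k r => ?_⟩
  have := w.runs i (s.cells xs) k s.out.reverse r false
  rw [hr xs hx, length_cells] at this
  simpa [he] using this

theorem tokSweep_result {Qf Qb : Type} (finf : Fintype Qf) (finb : Fintype Qb) (init : Qf)
    (fwd : Qf → View → Qf × View) (turn : Qf → Qb) (bwd : Qb → View → Qb × View) (s : St D)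
    (xs : List Info) :
    (tokSweep (D := D) finf finb init fwd turn bwd).result (s.cells xs) =
      flat (mapB (onFst bwd) (turn (mapF (onFst fwd) init (s.toks xs)).1)
        (mapF (onFst fwd) init (s.toks xs)).2).2 := by
  simp [Sweep.result, tokSweep, St.cells, mapF_lift, mapB_lift]

theorem mapF_pure {Q C : Type} (g : Q → C → C) (q : Q) (l : List C) :
    mapF (fun q x => (q, g q x)) q l = (q, l.map (g q)) := by
  induction l with
  | nil => rfl
  | cons x l ih => simp [mapF, ih]

theorem mapB_pure {Q C : Type} (g : Q → C → C) (q : Q) (l : List C) :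
    mapB (fun q x => (q, g q x)) q l = (q, l.map (g q)) := by
  induction l with
  | nil => rfl
  | cons x l ih => simp [mapB, ih]

theorem compiles_upd (Y : Tr) (φ : View → Bool) : Compiles (Cmd.upd Y φ : Cmd D) := by
  refine compiles_of_sweep (tokSweep (Qf := Unit) (Qb := Unit) inferInstance inferInstance ()
    (fun _ v => ((), v.set Y (φ v))) id fun _ v => ((), v)) (fun xs _ s => ?_) fun xs s => ?_
  · rw [tokSweep_result, St.cells]
    congr 1
    have h₁ := mapF_pure (fun (_ : Unit) (x : View × List (Bool × Bool)) =>
      (x.1.set Y (φ x.1), x.2)) () (s.toks xs)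
    have h₂ := mapB_pure (fun (_ : Unit) (x : View × List (Bool × Bool)) => x) ()
    change (mapB (fun _ x => ((), x)) _ (mapF (fun _ x => ((), (x.1.set Y (φ x.1), x.2))) ()
      (s.toks xs)).2).2 = _
    rw [h₁, h₂]
    simp [St.toks, run, St.view_set]
    exact fun _ _ => rfl
  · simp [Sweep.emitted, tokSweep, emF_none, run, St.set]

/-- The disjunction is accumulated on the way down, complete at the bottom, and written to all
tokens on the way up. -/
theorem compiles_any (Y : Tr) (φ : View → Bool) : Compiles (Cmd.any Y φ : Cmd D) := by
  refine compiles_of_sweep (tokSweep (Qf := Bool) (Qb := Bool) inferInstance inferInstance false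
    (fun q v => (q || φ v, v)) id fun q v => (q, v.set Y q)) (fun xs _ s => ?_) fun xs s => ?_
  · rw [tokSweep_result, St.cells]
    congr 1
    have h₁ : ∀ (l : List (View × List (Bool × Bool))) (q : Bool),
        mapF (onFst fun q v => (q || φ v, v)) q l = (q || l.any fun x => φ x.1, l) := fun l => by
      induction l with
      | nil => simp [mapF]
      | cons x l ih => simp [mapF, onFst, ih, Bool.or_assoc]
    have h₂ := mapB_pure (fun (q : Bool) (x : View × List (Bool × Bool)) => (x.1.set Y q, x.2))
    change (mapB (fun q (x : View × List (Bool × Bool)) => (q, (x.1.set Y q, x.2))) _ _).2 = _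
    rw [h₁, h₂]
    simp [St.toks, run, St.view_set]
    exact fun _ _ => ⟨rfl, rfl⟩
  · simp [Sweep.emitted, tokSweep, emF_none, run, St.set]

theorem compiles_zero (p : Ptr) : Compiles (Cmd.zero p : Cmd D) := by
  refine compiles_of_sweep (tokSweep (Qf := Bool) (Qb := Unit) inferInstance inferInstance true
    (fun q v => (false, v.setPtr p q)) (fun _ => ()) fun q v => (q, v)) (fun xs hx s => ?_)
    fun xs s => ?_
  · rw [tokSweep_result, St.cells]
    congr 1
    have h₂ := mapB_pure (fun (_ : Unit) (x : View × List (Bool × Bool)) => x)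
    change (mapB (fun q x => (q, x)) _ _).2 = _
    rw [h₂, List.map_id']
    -- The state is `true` only before the first token, that is, at position 0.
    have h₁ : ∀ (xs : List Info) (i c o), Layout i c o xs →
        (mapF (onFst fun (q : Bool) v => (false, v.setPtr p q)) (0 == i) (s.toks xs)).2 =
          St.toks { s with ptr := Function.update s.ptr p 0 } xs := fun xs => by
      induction xs with
      | nil => intros; rfl
      | cons t xs ih =>
        intro i c o h
        have := ih _ _ _ h.2.2
        simp only [St.toks] at this ⊢
        simp only [List.map_cons, mapF, onFst, St.view_setPtr, h.1] at this ⊢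
        rw [← this, show ((0 : ℕ) == i + 1) = false by simp]
    exact h₁ xs 0 0 false hx
  · simp [Sweep.emitted, tokSweep, emF_none, run]

theorem compiles_inc (p : Ptr) : Compiles (Cmd.inc p : Cmd D) := by
  refine compiles_of_sweep (tokSweep (Qf := Bool) (Qb := Unit) inferInstance inferInstance false
    (fun q v => (v.ptr p, v.setPtr p q)) (fun _ => ()) fun q v => (q, v)) (fun xs hx s => ?_)
    fun xs s => ?_
  · rw [tokSweep_result, St.cells]
    congr 1
    have h₂ := mapB_pure (fun (_ : Unit) (x : View × List (Bool × Bool)) => x)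
    change (mapB (fun q x => (q, x)) _ _).2 = _
    rw [h₂, List.map_id']
    -- The transducer delays the pointer mark by one token: its state at position `i` tells whether
    -- the token before it carried the mark. Initially it is `false`, as `s.ptr p + 1` is never 0.
    have h₁ : ∀ (xs : List Info) (i c o), Layout i c o xs →
        (mapF (onFst fun (q : Bool) v => (v.ptr p, v.setPtr p q)) (s.ptr p + 1 == i)
          (s.toks xs)).2 =
          St.toks { s with ptr := Function.update s.ptr p (s.ptr p + 1) } xs := fun xs => by
      induction xs with
      | nil => intros; rfl
      | cons t xs ih =>
        intro i c o h
        have := ih _ _ _ h.2.2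
        simp only [St.toks] at this ⊢
        simp only [List.map_cons, mapF, onFst, St.view_setPtr, h.1] at this ⊢
        rw [← this]
        simp [St.view, h.1]
    exact h₁ xs 0 0 false hx
  · simp [Sweep.emitted, tokSweep, emF_none, run]

theorem compiles_grp (Y : Tr) (φ : View → Bool) : Compiles (Cmd.grp Y φ : Cmd D) := by
  refine compiles_of_sweep (tokSweep (Qf := Bool) (Qb := Bool) inferInstance inferInstance false
    (fun q v => (!v.kind.last && (q || φ v), v.set Y (q || φ v))) id
    fun q v => if v.kind.last then (v.tr Y, v) else (q, v.set Y q))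
    (fun xs hx s => ?_) fun xs s => ?_
  · rw [tokSweep_result, St.cells]
    congr 1
    -- On the way down a token receives the disjunction over the part of its group read so far, so
    -- the last token of a group knows the whole; on the way up it hands this to the rest of the
    -- group. Here `r` is the disjunction over the part of the open group already read, and `q` is
    -- the state in which the upward pass starts.
    have key : ∀ (xs : List Info) (i c o) (r q : Bool), Layout i c o xs →
        mapB (onFst fun q v => if v.kind.last then (v.tr Y, v) else (q, v.set Y q)) q
          (mapF (onFst fun q v => (!v.kind.last && (q || φ v), v.set Y (q || φ v))) r
            (s.toks xs)).2 =
          (if xs = [] then q else r || xs.any fun t' => φ (s.view t') && t'.cid == c,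
            (s.set Y fun t => (r && t.cid == c) ||
              xs.any fun t' => φ (s.view t') && t'.cid == t.cid).toks xs) := fun xs => by
      induction xs with
      | nil => intros; rfl
      | cons t xs ih =>
        rintro i c o r q ⟨-, rfl, h⟩
        have hk : (s.view t).kind = t.kind := rfl
        by_cases hl : t.kind.last
        · simp only [hl, if_true, Bool.not_true] at h
          have hne : ∀ t' ∈ xs, t'.cid ≠ t.cid := fun t' ht' => by
            have := h.cid_ge t' ht'
            omega
          have hany : (xs.any fun t' => φ (s.view t') && t'.cid == t.cid) = false := by
            simpa using fun t' ht' _ => hne t' ht'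
          have := ih _ _ _ false q h
          simp only [St.toks, List.map_cons] at this ⊢
          simp only [mapF, mapB, onFst, hk, hl, Bool.not_true, Bool.false_and, this, View.set_kind,
            if_true, View.set_tr, List.any_cons, beq_self_eq_true, Bool.and_true, hany,
            Bool.or_false, reduceCtorEq, if_false, St.view_set]
          refine congrArg₂ Prod.mk rfl (congrArg₂ List.cons rfl
            (List.map_congr_left fun t' ht' => ?_))
          simp [beq_false_of_ne (hne t' ht'), beq_false_of_ne (hne t' ht').symm, St.set]
        · simp only [hl, Bool.not_false] at h
          have hne : xs ≠ [] := by
            rintro rfl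
            simp [Layout] at h
          have := ih _ _ _ (r || φ (s.view t)) q h
          simp only [St.toks, List.map_cons] at this ⊢
          simp only [mapF, mapB, onFst, hk, hl, Bool.not_false, Bool.true_and, this, View.set_kind,
            if_false, hne, View.set_set, List.any_cons, beq_self_eq_true, Bool.and_true,
            reduceCtorEq, St.view_set, Bool.or_assoc, Bool.false_eq_true]
          refine congrArg₂ Prod.mk rfl (congrArg₂ List.cons rfl
            (List.map_congr_left fun t' ht' => ?_))
          by_cases he : t'.cid = t.cid
          · simp [he, St.set, Bool.or_assoc]
          · simp [beq_false_of_ne he, beq_false_of_ne (Ne.symm he), St.set]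
    have := key xs 0 0 false false (id (mapF (onFst fun q v =>
      (!v.kind.last && (q || φ v), v.set Y (q || φ v))) false (s.toks xs)).1) hx
    rw [this]
    simp [run]
  · simp [Sweep.emitted, tokSweep, emF_none, run, St.set]

/-! #### Commands that look at the bits -/

/-- The state says that all bits of the current token seen so far were already flagged; the first
unflagged bit is then flagged and switches it off. -/
def nextF (q : Bool) : Sym → Bool × Sym
  | .inl v => (true, .inl v)
  | .inr (b, u) => (q && u, .inr (b, u || q))

def resetF (q : Bool) : Sym → Bool × Sym
  | .inl v => (q, .inl v)
  | .inr (b, _) => (q, .inr (b, false))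

/-- Read from the right, unflagged bits overwrite the state and flagged ones keep it. On reaching
its token the state is therefore the first unflagged bit, or `none` if the bits are exhausted. -/
def loadB (q : Option Bool) : Sym → Option Bool × Sym
  | .inl v => (none, .inl ((v.set .h0 (q == some false)).set .h1 (q == some true)))
  | .inr (b, u) => (if u then q else some b, .inr (b, u))

def loadSweep (f : Bool → Sym → Bool × Sym) : Sweep Sym D where
  Qf := Bool
  Qb := Option Bool
  finf := inferInstance
  finb := inferInstance
  init := false
  fwd := f
  turn _ := none
  bwd := loadB

theorem mapB_loadB_bits (u : List Bool) (k : ℕ) :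
    mapB loadB none ((bitCells k u).map .inr) = (u[k]?, (bitCells k u).map .inr) := by
  have h₁ : ∀ u : List Bool, mapB loadB none (u.map fun b => (.inr (b, false) : Sym)) =
      (u[0]?, u.map fun b => .inr (b, false)) := fun u => by
    cases u with
    | nil => rfl
    | cons b u =>
      have : ∀ u : List Bool, (mapB loadB none (u.map fun b => (.inr (b, false) : Sym))).2 =
          u.map fun b => .inr (b, false) := fun u => by
        induction u with
        | nil => rfl
        | cons b u ih => simp [mapB, loadB, ih]
      simp [mapB, loadB, this]
  have h₂ : ∀ (q) (u : List Bool), mapB loadB q (u.map fun b => (.inr (b, true) : Sym)) =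
      (q, u.map fun b => .inr (b, true)) := fun q u => by
    induction u with
    | nil => rfl
    | cons b u ih => simp [mapB, loadB, ih]
  simp only [bitCells, List.map_append, List.map_map, mapB_append]
  have h₁' := h₁ (u.drop k)
  have h₂' := h₂ (u.drop k)[0]? (u.take k)
  simp only [Function.comp_def] at h₁' h₂' ⊢
  rw [h₁', h₂']
  simp

theorem mapF_nextF_bits (u : List Bool) (k : ℕ) :
    ∃ q, mapF nextF true ((bitCells k u).map .inr) = (q, (bitCells (k + 1) u).map .inr) := by
  induction u generalizing k with
  | nil => exact ⟨true, by simp [bitCells, mapF]⟩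
  | cons b u ih =>
    cases k with
    | zero =>
      refine ⟨false, ?_⟩
      have : ∀ u : List Bool, mapF nextF false (u.map fun b => (.inr (b, false) : Sym)) =
          (false, u.map fun b => .inr (b, false)) := fun u => by
        induction u with
        | nil => rfl
        | cons b u ih => simp [mapF, nextF, ih]
      simp [bitCells, mapF, nextF, Function.comp_def, this]
    | succ k =>
      obtain ⟨q, h⟩ := ih k
      refine ⟨q, ?_⟩
      simp only [bitCells, List.take_succ_cons, List.drop_succ_cons, List.map_cons,
        List.cons_append, mapF] at h ⊢
      change ((mapF nextF true _).1, .inr (b, true) :: (mapF nextF true _).2) = _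
      rw [h]

theorem mapF_resetF_bits (q : Bool) (u : List Bool) (k : ℕ) :
    mapF resetF q ((bitCells k u).map .inr) = (q, (bitCells 0 u).map .inr) := by
  have : ∀ u : List (Bool × Bool), mapF resetF q (u.map .inr) =
      (q, u.map fun b => .inr (b.1, false)) := fun u => by
    induction u with
    | nil => rfl
    | cons b u ih => simp [mapF, resetF, ih]
  have h := map_bitCells (fun b => (.inr (b, false) : Sym)) k u
  rw [this, h]
  simp [bitCells]

/-- This covers `next` and `reset` at once: the downward pass `f` changes only the flags, with
effect `g` on the number of used bits, and the upward pass loads the new current bit into the marks.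
-/
theorem compiles_load {c : Cmd D} (f : Bool → Sym → Bool × Sym) (g : ℕ → ℕ)
    (hc : ∀ xs s, run xs c s = s.load (g s.used)) (hf : ∀ q v, (f q (.inl v)).2 = .inl v)
    (hb : ∀ q v k u, ∃ q', mapF f (f q (.inl v)).1 ((bitCells k u).map .inr) =
      (q', (bitCells (g k) u).map .inr)) : Compiles c := by
  refine compiles_of_sweep (loadSweep f) (fun xs hx s => ?_) fun xs s => ?_
  · have h₁ : ∀ (xs : List Info) (q : Bool), (mapF f q (s.cells xs)).2 =
        flat (xs.map fun t => (s.view t, bitCells (g s.used) (encodeNat t.atom))) := fun xs => by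
      induction xs with
      | nil => intro q; rfl
      | cons t xs ih =>
        intro q
        obtain ⟨q', h⟩ := hb q (s.view t) s.used (encodeNat t.atom)
        simp only [St.cells, St.toks, flat, List.map_cons, List.flatMap_cons, List.cons_append,
          mapF, mapF_append, h, hf] at ih ⊢
        rw [ih]
    have h₂ : ∀ (xs : List Info), mapB loadB none
        (flat (xs.map fun t => (s.view t, bitCells (g s.used) (encodeNat t.atom)))) =
          (none, St.cells (s.load (g s.used)) xs) := fun xs => by
      induction xs with
      | nil => rfl
      | cons t xs ih =>
        simp only [St.cells, St.toks, flat, List.map_cons, List.flatMap_cons, List.cons_append,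
          mapB, mapB_append] at ih ⊢
        rw [ih, mapB_loadB_bits]
        simp only [loadB, St.load, Prod.mk.injEq, true_and, List.cons.injEq]
        refine ⟨?_, trivial⟩
        rw [← St.view_set s .h0 fun t => (encodeNat t.atom)[g s.used]? == some false]
        exact congrArg Sum.inl (St.view_set (s.set .h0 _) .h1
          (fun t => (encodeNat t.atom)[g s.used]? == some true) t).symm
    simp only [Sweep.result, loadSweep, h₁, h₂, hc]
  · simp [Sweep.emitted, loadSweep, emF_none, hc, St.load, St.set]

theorem compiles_next : Compiles (Cmd.next : Cmd D) :=
  compiles_load nextF (· + 1) (fun _ _ => rfl) (fun _ _ => rfl) fun _ _ k u => mapF_nextF_bits u k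

theorem compiles_reset : Compiles (Cmd.reset : Cmd D) :=
  compiles_load resetF (fun _ => 0) (fun _ _ => rfl) (fun _ _ => rfl)
    fun q _ k u => ⟨q, mapF_resetF_bits q u k⟩

/-! #### Output -/

def emitF (pr : View → Bool) (q : Bool) (x : Sym) : Bool × Sym := (x.elim pr fun _ => q, x)

def emit₁ (e₁ : View → Option D) (bit : Bool → D) (q : Bool) (x : Sym) : Option D :=
  x.elim e₁ fun b => if q then some (bit b.1) else none

def emit₂ (e₂ : View → Option D) (_ : Bool) (x : Sym) : Option D := x.elim e₂ fun _ => none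

def emitSweep (e₁ e₂ : View → Option D) (pr : View → Bool) (bit : Bool → D) : Sweep Sym D where
  Qf := Bool
  Qb := Unit
  finf := inferInstance
  finb := inferInstance
  init := false
  fwd := emitF pr
  em₁ := emit₁ e₁ bit
  em₂ := emit₂ e₂
  turn _ := ()
  bwd _ x := ((), x)

theorem emF_append {Q C : Type} (f : Q → C → Q × C) (e₁ e₂ : Q → C → Option D) (q : Q)
    (l l' : List C) :
    emF f e₁ e₂ q (l ++ l') = emF f e₁ e₂ q l ++ emF f e₁ e₂ (mapF f q l).1 l' := by
  induction l generalizing q with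
  | nil => rfl
  | cons x l ih => simp [emF, mapF, ih]

theorem compiles_emit (e₁ e₂ : View → Option D) (pr : View → Bool) (bit : Bool → D) :
    Compiles (Cmd.emit e₁ e₂ pr bit) := by
  refine compiles_of_sweep (emitSweep e₁ e₂ pr bit) (fun xs hx s => ?_) fun xs s => ?_
  · have h₁ : ∀ (l : List Sym) (q : Bool), (mapF (emitF pr) q l).2 = l := fun l => by
      induction l with
      | nil => intro; rfl
      | cons x l ih => intro q; simp [mapF, emitF, ih]
    have h₂ := mapB_pure (fun (_ : Unit) (x : Sym) => x)
    simp only [Sweep.result, emitSweep, h₁]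
    rw [h₂]
    simp [run]
    rfl
  · have h₁ : ∀ (u : List (Bool × Bool)) (q : Bool),
        emF (emitF pr) (emit₁ e₁ bit) (emit₂ e₂) q (u.map .inr) =
          if q then u.map fun b => bit b.1 else [] := fun u q => by
      induction u with
      | nil => simp [emF]
      | cons b u ih =>
        simp only [List.map_cons, emF, emitF, emit₁, emit₂, Sum.elim_inr] at ih ⊢
        rw [ih]
        cases q <;> simp
    have h₃ : ∀ (xs : List Info) (q : Bool),
        emF (emitF pr) (emit₁ e₁ bit) (emit₂ e₂) q (s.cells xs) =
          xs.flatMap fun t => emitAt e₁ e₂ pr bit (s.view t) (encodeNat t.atom) := fun xs => by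
      induction xs with
      | nil => intro; rfl
      | cons t xs ih =>
        intro q
        simp only [St.cells, St.toks, flat, List.map_cons, List.flatMap_cons, List.cons_append,
          emF, emF_append, h₁, map_bitCells bit s.used (encodeNat t.atom)] at ih ⊢
        rw [ih]
        simp only [emitAt, emitF, emit₁, emit₂, Sum.elim_inl, List.append_assoc]
        rfl
    simp only [run, Sweep.emitted]
    rw [← h₃ xs false]
    rfl

/-! #### Composite commands -/

theorem compiles_seq {c d : Cmd D} (hc : Compiles c) (hd : Compiles d) : Compiles (c ;; d) := by
  obtain ⟨F, p, hF⟩ := hc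
  obtain ⟨G, q, hG⟩ := hd
  refine ⟨F.seq G, p + q, fun xs hx s i k r => ?_⟩
  rw [Polynomial.eval_add]
  exact (hF xs hx s i k r).seq (hG xs hx _ i k r)

/-- The number of rounds and the bound for each round depend only on `size xs`, which the body
cannot change; the bound stays polynomial at any fixed nesting depth. -/
theorem compiles_rep {c : Cmd D} (hc : Compiles c) : Compiles (.rep c) := by
  obtain ⟨F, p, hF⟩ := hc
  refine ⟨repFrag F, .X * (p + 3) + 4, fun xs hx s i k r => ?_⟩
  have := repFrag_runs i k r (F := F) (h := run xs c) (main := fun s => s.cells xs)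
    (out := fun s => s.out.reverse) (fun s => length_cells s xs)
    (fun s k => hF xs hx s i k r) s
  simp only [Polynomial.eval_add, Polynomial.eval_mul, Polynomial.eval_X, Polynomial.eval_ofNat]
  exact this

theorem compiles (c : Cmd D) : Compiles c := by
  induction c with
  | upd Y φ => exact compiles_upd Y φ
  | any Y φ => exact compiles_any Y φ
  | grp Y φ => exact compiles_grp Y φ
  | zero p => exact compiles_zero p
  | inc p => exact compiles_inc p
  | reset => exact compiles_reset
  | next => exact compiles_next
  | emit e₁ e₂ pr bit => exact compiles_emit e₁ e₂ pr bit
  | seq c d hc hd => exact compiles_seq hc hd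
  | rep c hc => exact compiles_rep hc

theorem length_emitAt_le (e₁ e₂ : View → Option D) (pr : View → Bool) (bit : Bool → D) (v : View)
    (u : List Bool) : (emitAt e₁ e₂ pr bit v u).length ≤ u.length + 2 := by
  have h : ∀ x : Option D, x.toList.length ≤ 1 := fun x => by cases x <;> simp
  have h₁ := h (e₁ v)
  have h₂ := h (e₂ v)
  unfold emitAt
  split <;> simp only [List.length_append, List.length_map, List.length_nil] <;> omega

/-- The time of the final writing phase depends on the length of the output, which therefore needs a
polynomial bound as well. -/
theorem exists_length_out_le (c : Cmd D) : ∃ p : Polynomial ℕ, ∀ xs s,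
    (run xs c s).out.length ≤ s.out.length + p.eval (size xs) := by
  induction c with
  | emit e₁ e₂ pr bit =>
    -- A token with `k` bits emits at most `k + 2 ≤ 2 * (k + 1)` symbols and has `k + 1` cells.
    refine ⟨2 * .X, fun xs s => ?_⟩
    simp only [run, List.length_append]
    gcongr
    induction xs with
    | nil => simp
    | cons t xs ih =>
      have := length_emitAt_le e₁ e₂ pr bit (s.view t) (encodeNat t.atom)
      simp only [size, List.flatMap_cons, List.length_append, List.map_cons, List.sum_cons,
        Polynomial.eval_mul, Polynomial.eval_X, Polynomial.eval_ofNat] at ih ⊢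
      omega
  | seq c d hc hd =>
    obtain ⟨p, hp⟩ := hc
    obtain ⟨q, hq⟩ := hd
    refine ⟨p + q, fun xs s => ?_⟩
    have h₁ := hp xs s
    have h₂ := hq xs (run xs c s)
    rw [Polynomial.eval_add]
    simp only [run]
    omega
  | rep c hc =>
    obtain ⟨p, hp⟩ := hc
    refine ⟨.X * p, fun xs s => ?_⟩
    simp only [run, Polynomial.eval_mul, Polynomial.eval_X]
    have : ∀ m : ℕ, ((run xs c)^[m] s).out.length ≤ s.out.length + m * p.eval (size xs) := by
      intro m
      induction m with
      | zero => simp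
      | succ m ih =>
        have := hp xs ((run xs c)^[m] s)
        rw [Function.iterate_succ_apply', Nat.succ_mul]
        omega
    exact this _
  | _ => exact ⟨0, fun xs s => by simp [run, St.set, St.load]⟩

/-! ### From commands to polynomial time -/

section PolyTime

variable {D : Type}

/-- The initial state: no marks, pointers beyond the end, no output. -/
def St.start (D : Type) (xs : List Info) : St D := ⟨fun _ _ => false, fun _ => xs.length, 0, []⟩

theorem eval_mono_nat (p : Polynomial ℕ) {m n : ℕ} (h : m ≤ n) : p.eval m ≤ p.eval n := by
  induction p using Polynomial.induction_on' with
  | add p q hp hq => simpa using Nat.add_le_add hp hq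
  | monomial k a =>
    simp only [Polynomial.eval_monomial]
    gcongr

variable [Inhabited D] [Finite D]

noncomputable def Frag.toFinTM2 (F : Frag (StkSym Sym D) (Reg Sym D)) : FinTM2 where
  K := Stk
  k₀ := .inp
  k₁ := .res
  Γ := StkSym Sym D
  Λ := F.Lab
  main := F.entry
  ΛFin := F.fin
  σ := Reg Sym D
  initialState := ⟨none, none, none, none⟩
  Γk₀Fin := inferInstanceAs (Fintype Γ')
  m := F.code

theorem polyTimeComputable_of_cmd {α β Q : Type} {ea : α → List Γ'} {eb : β → List D} {f : α → β}
    (c : Cmd D) (fin : Fintype Q) (init : Q) (rd : Q → Γ' → Q × Option Sym) (z : Sym)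
    (toks : α → List Info) (hl : ∀ a, Layout 0 0 false (toks a))
    (hrd : ∀ a, transduce rd init (ea a) ++ [z] = (St.start D (toks a)).cells (toks a))
    (hout : ∀ a, (run (toks a) c (St.start D (toks a))).out = eb (f a)) :
    PolyTimeComputable ea eb f := by
  obtain ⟨F, p, hF⟩ := compiles c
  obtain ⟨q, hq⟩ := exists_length_out_le c
  let G₁ := (readFrag (D := D) fin init rd z).seq F
  let G := G₁.seq writeFrag
  -- Reading costs `2 * X + 3`. The command costs `p` and the writing phase `X + q + 2`, both
  -- evaluated at the number of cells, which is at most one more than the input length because of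
  -- the final cell `z`.
  let time : Polynomial ℕ := 2 * .X + 3 + (p + .X + q + 2).comp (.X + 1)
  have key : ∀ a, ∃ n, n ≤ time.eval (ea a).length ∧ ReachIn G.code n
      ⟨some G.entry, ⟨none, none, none, none⟩, store (ea a) [] [] [] [] []⟩
      ⟨none, ⟨none, none, none, none⟩, store [] [] [] [] [] (eb (f a))⟩ := fun a => by
    have h₁ := readFrag_runs (D := D) (ea a) [] [] [] fin init rd z
    rw [hrd] at h₁
    have h₂ := hF (toks a) (hl a) (St.start D (toks a)) [] [] []
    obtain ⟨v, n, hn, hr⟩ := h₁.seq h₂ ⟨none, none, none, none⟩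
    obtain ⟨n', hn', hr'⟩ := writeFrag_reach ([] : List Γ')
      ((run (toks a) c (St.start D (toks a))).cells (toks a)) []
      (run (toks a) c (St.start D (toks a))).out.reverse v
    have hN : size (toks a) ≤ (ea a).length + 1 := by
      rw [← length_cells (St.start D (toks a)), ← hrd, List.length_append, List.length_singleton]
      exact Nat.add_le_add_right (length_transduce _ _ _) 1
    refine ⟨n + n', ?_, ?_⟩
    · have h₃ := hq (toks a) (St.start D (toks a))
      have h₄ := eval_mono_nat (p + .X + q + 2) hN
      simp only [Polynomial.eval_add, Polynomial.eval_mul, Polynomial.eval_X,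
        Polynomial.eval_ofNat, Polynomial.eval_comp, Polynomial.eval_one, time] at h₄ ⊢
      rw [List.length_reverse, length_cells] at hn'
      simp only [St.start, List.length_nil] at h₃ hn hn'
      omega
    · rw [List.reverse_reverse] at hr'
      rw [← hout]
      exact (hr.subst (M' := G.code) (g := .inl) fun _ => rfl).trans
        (hr'.subst (M' := G.code) (g := .inr) (e := .halt) fun _ => rfl)
  refine ⟨{ tm := G.toFinTM2, inputAlphabet := .refl _, outputAlphabet := .refl _, time := time,
            outputsFun := fun a => ?_ }⟩
  have h := key a
  refine ⟨⟨h.choose, ?_⟩, h.choose_spec.1⟩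
  have h' := h.choose_spec.2.iterate
  have e₁ : initList G.toFinTM2 (List.map (Equiv.refl Γ').invFun (ea a)) =
      ⟨some G.entry, ⟨none, none, none, none⟩, store (ea a) [] [] [] [] []⟩ := by
    unfold initList
    congr 1
    funext k
    cases k
    · exact List.map_id _
    all_goals rfl
  have e₂ : haltList G.toFinTM2 (List.map (Equiv.refl D).invFun (eb (f a))) =
      ⟨none, ⟨none, none, none, none⟩, store [] [] [] [] [] (eb (f a))⟩ := by
    unfold haltList
    congr 1
    funext k
    cases k
    case res => exact List.map_id _
    all_goals rfl
  exact (congrArg (fun x => (flip bind (TM2.step G.code))^[h.choose] (some x)) e₁).trans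
    (h'.trans (congrArg some e₂.symm))

end PolyTime

/-! ### Reading instances -/

/-- The tokens of an instance, with their positions and the numbers of their groups. -/
def number : ℕ → ℕ → List (Kind × ℕ) → List Info
  | _, _, [] => []
  | i, c, (k, a) :: l => ⟨i, c, a, k⟩ :: number (i + 1) (if k.last then c + 1 else c) l

/-- A group consists of literals and one last token. -/
def IsGroup (g : List (Kind × ℕ)) : Prop :=
  ∃ u x, g = u ++ [x] ∧ (∀ y ∈ u, y.1.last = false) ∧ x.1.last = true

theorem number_append (i c : ℕ) (l l' : List (Kind × ℕ)) :
    number i c (l ++ l') = number i c l ++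
      number (i + l.length) (c + (l.filter fun x => x.1.last).length) l' := by
  induction l generalizing i c with
  | nil => simp [number]
  | cons x l ih =>
    simp only [List.cons_append, number, ih, List.length_cons, List.filter_cons]
    cases x.1.last <;> simp [Nat.add_assoc, Nat.add_comm 1]

theorem number_group {g : List (Kind × ℕ)} (hg : IsGroup g) (i c : ℕ) (l : List (Kind × ℕ)) :
    number i c (g ++ l) = number i c g ++ number (i + g.length) (c + 1) l := by
  obtain ⟨u, x, rfl, hu, hx⟩ := hg
  rw [number_append]
  congr 2
  rw [List.filter_append, List.filter_eq_nil_iff.2 (by simpa using hu)]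
  simp [hx]

theorem cid_number_group {g : List (Kind × ℕ)} (hg : IsGroup g) (i c : ℕ) :
    ∀ t ∈ number i c g, t.cid = c := by
  obtain ⟨u, x, rfl, hu, hx⟩ := hg
  induction u generalizing i with
  | nil => simp [number]
  | cons y u ih =>
    simp only [List.cons_append, number, hu y (by simp), List.mem_cons]
    rintro t (rfl | ht)
    · rfl
    · exact ih _ (fun y hy => hu y (by simp [hy])) t ht

theorem map_number (i c : ℕ) (l : List (Kind × ℕ)) :
    (number i c l).map (fun t => (t.kind, t.atom)) = l := by
  induction l generalizing i c with
  | nil => rfl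
  | cons x l ih => simp [number, ih]

theorem le_cid_number (i c : ℕ) (l : List (Kind × ℕ)) : ∀ t ∈ number i c l, c ≤ t.cid := by
  induction l generalizing i c with
  | nil => simp [number]
  | cons x l ih =>
    simp only [number, List.mem_cons]
    rintro t (rfl | ht)
    · rfl
    · have := ih _ _ t ht
      split at this <;> omega

theorem cid_number_lt {G : List (List (Kind × ℕ))} (hG : ∀ g ∈ G, IsGroup g) (i c : ℕ) :
    ∀ t ∈ number i c G.flatten, t.cid < c + G.length := by
  induction G generalizing i c with
  | nil => simp [number]
  | cons g G ih =>
    have hg := hG g (by simp)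
    rw [List.flatten_cons, number_group hg]
    intro t ht
    rcases List.mem_append.1 ht with ht | ht
    · rw [cid_number_group hg i c t ht]
      simp
    · have := ih (fun g hg => hG g (by simp [hg])) _ _ t ht
      rw [List.length_cons]
      omega

/-- The tokens of the `j`-th group are those numbered `j`. -/
theorem filter_number {G : List (List (Kind × ℕ))} (hG : ∀ g ∈ G, IsGroup g) (i c j : ℕ)
    (hj : j < G.length) :
    ((number i c G.flatten).filter fun t => t.cid == c + j).map (fun t => (t.kind, t.atom)) =
      G[j] := by
  induction G generalizing i c j with
  | nil => simp at hj
  | cons g G ih =>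
    have hg := hG g (by simp)
    rw [List.flatten_cons, number_group hg, List.filter_append, List.map_append]
    cases j with
    | zero =>
      have h₁ : ((number i c g).filter fun t => t.cid == c + 0) = number i c g :=
        List.filter_eq_self.2 fun t ht => by simp [cid_number_group hg i c t ht]
      have h₂ : ((number (i + g.length) (c + 1) G.flatten).filter fun t => t.cid == c + 0) = [] :=
        List.filter_eq_nil_iff.2 fun t ht => by
          have := le_cid_number _ _ _ t ht
          simp only [beq_iff_eq]
          omega
      rw [h₁, h₂, map_number]
      simp
    | succ j =>
      have h₁ : ((number i c g).filter fun t => t.cid == c + (j + 1)) = [] :=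
        List.filter_eq_nil_iff.2 fun t ht => by simp [cid_number_group hg i c t ht]
      have := ih (fun g hg => hG g (by simp [hg])) (i + g.length) (c + 1) j (by simpa using hj)
      rw [h₁, show c + (j + 1) = c + 1 + j by omega, this]
      simp

theorem layout_number {G : List (List (Kind × ℕ))} (hG : ∀ g ∈ G, IsGroup g) (i c : ℕ) :
    Layout i c false (number i c G.flatten) := by
  have h₁ : ∀ (u : List (Kind × ℕ)) x l c i o, (∀ y ∈ u, y.1.last = false) → x.1.last = true →
      (∀ i, Layout i (c + 1) false (number i (c + 1) l)) →
      Layout i c o (number i c (u ++ [x] ++ l)) := by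
    intro u x l c
    induction u with
    | nil =>
      intro i o _ hx hl
      simp only [List.nil_append, List.cons_append, number, hx, Layout, if_true, Bool.not_true,
        true_and]
      exact hl _
    | cons y u ih =>
      intro i o hu hx hl
      simp only [List.cons_append, number, hu y (by simp), Layout, Bool.not_false, true_and]
      exact ih _ _ (fun y hy => hu y (by simp [hy])) hx hl
  induction G generalizing i c with
  | nil => rfl
  | cons g G ih =>
    obtain ⟨u, x, rfl, hu, hx⟩ := hG g (by simp)
    exact h₁ u x _ _ _ _ hu hx fun i => ih (fun g hg => hG g (by simp [hg])) i (c + 1)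

theorem length_number (i c : ℕ) (l : List (Kind × ℕ)) : (number i c l).length = l.length := by
  induction l generalizing i c with
  | nil => rfl
  | cons x l ih => simp [number, ih]

theorem idx_number_lt (i c : ℕ) (l : List (Kind × ℕ)) :
    ∀ t ∈ number i c l, t.idx < i + l.length := by
  induction l generalizing i c with
  | nil => simp [number]
  | cons x l ih =>
    simp only [number, List.mem_cons]
    rintro t (rfl | ht)
    · simp
    · have := ih _ _ t ht
      simp only [List.length_cons]
      omega

theorem Layout.idx_inj {i c o xs} (h : Layout i c o xs) :
    ∀ t ∈ xs, ∀ t' ∈ xs, t.idx = t'.idx → t = t' := by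
  induction xs generalizing i c o with
  | nil => simp
  | cons x xs ih =>
    have h' := h.2.2.idx_ge
    have h'' := h.1
    intro t ht t' ht' e
    rcases List.mem_cons.1 ht with h₁ | h₁ <;> rcases List.mem_cons.1 ht' with h₂ | h₂
    · rw [h₁, h₂]
    · have := h' t' h₂
      subst h₁
      omega
    · have := h' t h₁
      subst h₂
      omega
    · exact ih h.2.2 t h₁ t' h₂ e

/-! #### The reader -/

def tok (k : Kind) : Sym := .inl ⟨k, fun _ => false, fun _ => false⟩

/-- The state of the reader: the section, and whether a sign is to be read. -/
def readStep : Fin 3 × Bool → Γ' → (Fin 3 × Bool) × Option Sym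
  | (s, _), .bra => ((s, false), none)
  | (s, _), .comma => if s = 2 then ((s, false), some (tok ⟨.vat, false, 2⟩)) else ((s, true), none)
  | (s, true), .bit b => ((s, false), some (tok ⟨.lit, b, s⟩))
  | (s, false), .bit b => ((s, false), some (.inr (b, false)))
  | (s, _), .ket => ((s, false), some (tok ⟨.ket, false, s⟩))
  | (s, _), .blank => ((s + 1, false), none)

def clauseGroup (s : Fin 3) (c : List Literal) : List (Kind × ℕ) :=
  c.map (fun l => (⟨.lit, l.sign, s⟩, l.atom)) ++ [(⟨.ket, false, s⟩, 0)]

def atomGroup (p : ℕ) : List (Kind × ℕ) := [(⟨.vat, false, 2⟩, p)]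

/-- This token occurs exactly once in each instance. Answers and brackets are emitted at it, and,
not being a literal, it is a pointer position that stands for the empty clause. -/
def endGroup : List (Kind × ℕ) := [(⟨.fin, false, 0⟩, 0)]

/-- The theory is put in section 1, not 0: a word for two theories then ends in a word for one, read
with the same sections. -/
def groupsOne (x : KromTheory × List ℕ) : List (List (Kind × ℕ)) :=
  x.1.1.map (clauseGroup 1) ++ x.2.map atomGroup ++ [endGroup]

def groupsTwo (x : KromTheory × KromTheory × List ℕ) : List (List (Kind × ℕ)) :=
  x.1.1.map (clauseGroup 0) ++ groupsOne x.2

theorem isGroup_clauseGroup (s c) : IsGroup (clauseGroup s c) :=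
  ⟨_, _, rfl, by simp [Kind.last], rfl⟩

theorem isGroup_groupsOne (x) : ∀ g ∈ groupsOne x, IsGroup g := by
  intro g hg
  simp only [groupsOne, List.mem_append, List.mem_map, List.mem_singleton] at hg
  rcases hg with (⟨c, -, rfl⟩ | ⟨p, -, rfl⟩) | rfl
  · exact isGroup_clauseGroup _ _
  · exact ⟨[], _, rfl, by simp, rfl⟩
  · exact ⟨[], _, rfl, by simp, rfl⟩

theorem isGroup_groupsTwo (x) : ∀ g ∈ groupsTwo x, IsGroup g := by
  intro g hg
  rcases List.mem_append.1 hg with hg | hg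
  · obtain ⟨c, -, rfl⟩ := List.mem_map.1 hg
    exact isGroup_clauseGroup _ _
  · exact isGroup_groupsOne _ g hg

/-- The cells of unmarked tokens. -/
def rawCells (l : List (Kind × ℕ)) : List Sym :=
  l.flatMap fun x => tok x.1 :: (encodeNat x.2).map fun b => .inr (b, false)

theorem cells_start {D : Type} (l : List (Kind × ℕ)) :
    (St.start D (number 0 0 l)).cells (number 0 0 l) = rawCells l := by
  have h : ∀ (l : List (Kind × ℕ)) (i c : ℕ) (s : St D), s.used = 0 →
      (∀ t ∈ number i c l, s.view t = ⟨t.kind, fun _ => false, fun _ => false⟩) →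
      s.cells (number i c l) = rawCells l := fun l => by
    induction l with
    | nil => intros; rfl
    | cons x l ih =>
      intro i c s hs hv
      have := ih (i + 1) (if x.1.last then c + 1 else c) s hs fun t ht => hv t (by simp [number, ht])
      have hx := hv ⟨i, c, x.2, x.1⟩ (by simp [number])
      simp only [St.cells, St.toks, flat, rawCells, number, List.map_cons, List.flatMap_cons, hx,
        hs, bitCells] at this ⊢
      rw [this]
      simp [tok]
  refine h l 0 0 _ rfl fun t ht => ?_
  have := idx_number_lt 0 0 l t ht
  simp only [St.view, St.start, View.mk.injEq, true_and, length_number]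
  funext p
  exact beq_false_of_ne (by omega)

theorem transduce_bits (s : Fin 3) (u : List Bool) (r : List Γ') :
    transduce readStep (s, false) (u.map Γ'.bit ++ r) =
      u.map (fun b => .inr (b, false)) ++ transduce readStep (s, false) r := by
  induction u with
  | nil => rfl
  | cons b u ih => simp [transduce, readStep, ih]

theorem transduce_theory (s : Fin 3) (hs : s ≠ 2) (T : List (List Literal)) (r : List Γ') :
    transduce readStep (s, false) (T.flatMap encodeClause ++ r) =
      rawCells (T.map (clauseGroup s)).flatten ++ transduce readStep (s, false) r := by
  have h₁ : ∀ (c : List Literal) r, transduce readStep (s, false) (c.flatMap encodeLiteral ++ r) =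
      rawCells (c.map fun l => (⟨.lit, l.sign, s⟩, l.atom)) ++
        transduce readStep (s, false) r := fun c r => by
    induction c with
    | nil => rfl
    | cons l c ih =>
      simp [encodeLiteral, transduce, readStep, hs, transduce_bits, ih, rawCells]
  induction T with
  | nil => rfl
  | cons c T ih =>
    simp [encodeClause, transduce, readStep, h₁, ih, rawCells, clauseGroup, encodeNat, encodeNum]

theorem transduce_atoms (V : List ℕ) :
    transduce readStep (2, false) (encodeAtoms V) = rawCells (V.map atomGroup).flatten := by
  induction V with
  | nil => rfl
  | cons p V ih =>
    simp only [encodeAtoms] at ih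
    simp [encodeAtoms, encodeAtom, transduce, readStep, transduce_bits, ih, rawCells, atomGroup]

theorem transduce_one (x) : transduce readStep (1, false) (encodeOne x) ++ [tok ⟨.fin, false, 0⟩] =
    rawCells (groupsOne x).flatten := by
  rw [encodeOne, encodeTheory, transduce_theory 1 (by decide)]
  have : transduce readStep (1, false) (Γ'.blank :: encodeAtoms x.2) =
      transduce readStep (2, false) (encodeAtoms x.2) := rfl
  rw [this, transduce_atoms]
  simp [groupsOne, rawCells, endGroup, encodeNat, encodeNum]

theorem transduce_two (x) : transduce readStep (0, false) (encodeTwo x) ++ [tok ⟨.fin, false, 0⟩] =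
    rawCells (groupsTwo x).flatten := by
  rw [encodeTwo, encodeTheory, transduce_theory 0 (by decide)]
  have : transduce readStep (0, false) (Γ'.blank :: encodeOne x.2) =
      transduce readStep (1, false) (encodeOne x.2) := rfl
  rw [this, List.append_assoc, transduce_one]
  simp [groupsTwo, rawCells]

theorem polyTimeComputable_one {D β : Type} [Inhabited D] [Finite D] {eb : β → List D}
    {f : KromTheory × List ℕ → β} (c : Cmd D)
    (h : ∀ x, (run (number 0 0 (groupsOne x).flatten) c
      (St.start D (number 0 0 (groupsOne x).flatten))).out = eb (f x)) :
    PolyTimeComputable encodeOne eb f :=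
  polyTimeComputable_of_cmd c inferInstance (1, false) readStep _
    (fun x => number 0 0 (groupsOne x).flatten) (fun x => layout_number (isGroup_groupsOne x) 0 0)
    (fun x => by rw [cells_start, transduce_one]) h

theorem polyTimeComputable_two {D β : Type} [Inhabited D] [Finite D] {eb : β → List D}
    {f : KromTheory × KromTheory × List ℕ → β} (c : Cmd D)
    (h : ∀ x, (run (number 0 0 (groupsTwo x).flatten) c
      (St.start D (number 0 0 (groupsTwo x).flatten))).out = eb (f x)) :
    PolyTimeComputable encodeTwo eb f :=
  polyTimeComputable_of_cmd c inferInstance (0, false) readStep _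
    (fun x => number 0 0 (groupsTwo x).flatten) (fun x => layout_number (isGroup_groupsTwo x) 0 0)
    (fun x => by rw [cells_start, transduce_two]) h

/-! ### What a command does not change -/

section Frames

variable {D : Type}

/-- A computable, purely syntactic bound on the marks that change, so that the frame conditions
below hold by `rfl` for concrete programs. -/
def Cmd.writes : Cmd D → Tr → Bool
  | .upd Y _, X => X == Y
  | .any Y _, X => X == Y
  | .grp Y _, X => X == Y
  | .reset, X => X == .h0 || X == .h1
  | .next, X => X == .h0 || X == .h1
  | .seq c d, X => c.writes X || d.writes X
  | .rep c, X => c.writes X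
  | _, _ => false

def Cmd.moves : Cmd D → Ptr → Bool
  | .zero q, p => p == q
  | .inc q, p => p == q
  | .seq c d, p => c.moves p || d.moves p
  | .rep c, p => c.moves p
  | _, _ => false

def Cmd.emits : Cmd D → Bool
  | .emit _ _ _ _ => true
  | .seq c d => c.emits || d.emits
  | .rep c => c.emits
  | _ => false

theorem run_T {xs : List Info} {c : Cmd D} {X : Tr} (h : c.writes X = false) (s : St D) :
    (run xs c s).T X = s.T X := by
  induction c generalizing s with
  | seq c d hc hd =>
    simp only [Cmd.writes, Bool.or_eq_false_iff] at h
    rw [run, hd h.2, hc h.1]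
  | rep c hc =>
    have : ∀ m : ℕ, ((run xs c)^[m] s).T X = s.T X := fun m => by
      induction m with
      | zero => rfl
      | succ m ih => rw [Function.iterate_succ_apply', hc h, ih]
    exact this _
  | _ => simp_all [run, St.set, St.load, Cmd.writes]

theorem run_ptr {xs : List Info} {c : Cmd D} {p : Ptr} (h : c.moves p = false) (s : St D) :
    (run xs c s).ptr p = s.ptr p := by
  induction c generalizing s with
  | seq c d hc hd =>
    simp only [Cmd.moves, Bool.or_eq_false_iff] at h
    rw [run, hd h.2, hc h.1]
  | rep c hc =>
    have : ∀ m : ℕ, ((run xs c)^[m] s).ptr p = s.ptr p := fun m => by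
      induction m with
      | zero => rfl
      | succ m ih => rw [Function.iterate_succ_apply', hc h, ih]
    exact this _
  | _ => simp_all [run, St.set, St.load, Cmd.moves]

theorem run_out {xs : List Info} {c : Cmd D} (h : c.emits = false) (s : St D) :
    (run xs c s).out = s.out := by
  induction c generalizing s with
  | seq c d hc hd =>
    simp only [Cmd.emits, Bool.or_eq_false_iff] at h
    rw [run, hd h.2, hc h.1]
  | rep c hc =>
    have : ∀ m : ℕ, ((run xs c)^[m] s).out = s.out := fun m => by
      induction m with
      | zero => rfl
      | succ m ih => rw [Function.iterate_succ_apply', hc h, ih]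
    exact this _
  | _ => simp_all [run, St.set, St.load, Cmd.emits]

/-- The invariant rule for `rep`; the index counts the completed rounds. -/
theorem iterate_inv {α : Type*} {f : α → α} (P : ℕ → α → Prop) {a : α} (h₀ : P 0 a)
    (h : ∀ n a, P n a → P (n + 1) (f a)) (n : ℕ) : P n (f^[n] a) := by
  induction n with
  | zero => exact h₀
  | succ n ih =>
    rw [Function.iterate_succ_apply']
    exact h _ _ ih

theorem run_upd_T (xs : List Info) (Y : Tr) (φ : View → Bool) (s : St D) (t : Info) :
    (run xs (.upd Y φ) s).T Y t = φ (s.view t) := by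
  simp [run, St.set]

theorem run_any_T (xs : List Info) (Y : Tr) (φ : View → Bool) (s : St D) (t : Info) :
    (run xs (.any Y φ) s).T Y t = xs.any fun t' => φ (s.view t') := by
  simp [run, St.set]

theorem run_grp_T (xs : List Info) (Y : Tr) (φ : View → Bool) (s : St D) (t : Info) :
    (run xs (.grp Y φ) s).T Y t = xs.any fun t' => φ (s.view t') && t'.cid == t.cid := by
  simp [run, St.set]

theorem view_tr (s : St D) (t : Info) (X : Tr) : (s.view t).tr X = s.T X t := rfl

theorem view_ptr (s : St D) (t : Info) (p : Ptr) : (s.view t).ptr p = (s.ptr p == t.idx) := rfl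

theorem view_kind (s : St D) (t : Info) : (s.view t).kind = t.kind := rfl

end Frames

/-! ### Tokens with the same atom -/

section Same

variable {D : Type}

/-- Compare the bits of all tokens with the bits of the token at pointer `w`. -/
def compareStep : Cmd D :=
  .any .b0 (fun v => v.ptr .w && v.tr .h0) ;; .any .b1 (fun v => v.ptr .w && v.tr .h1) ;;
  .upd .alive (fun v => v.tr .alive && (v.tr .h0 == v.tr .b0) && (v.tr .h1 == v.tr .b1)) ;; .next

def compareAll : Cmd D := .upd .alive (fun _ => true) ;; .reset ;; .rep compareStep

/-- Mark by `Y` the tokens whose atom is the atom of a token that satisfies `φ`. -/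
def same (Y : Tr) (φ : View → Bool) : Cmd D :=
  .upd .src φ ;; .upd Y (fun _ => false) ;; .zero .w ;;
  .rep (.any .sel (fun v => v.ptr .w && v.tr .src) ;; compareAll ;;
    .upd Y (fun v => v.tr Y || v.tr .alive && v.tr .sel) ;; .inc .w)

theorem Layout.idx_lt {i c o xs} (h : Layout i c o xs) : ∀ t ∈ xs, t.idx < i + xs.length := by
  induction xs generalizing i c o with
  | nil => simp
  | cons x xs ih =>
    intro t ht
    rw [List.length_cons]
    rcases List.mem_cons.1 ht with rfl | ht
    · have := h.1
      omega
    · have := ih h.2.2 t ht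
      omega

/-- Positions are distinct, so a broadcast guarded by a pointer reads the value at exactly one
token. -/
theorem any_idx {xs : List Info} (hL : Layout 0 0 false xs) {t : Info} (ht : t ∈ xs)
    (φ : Info → Bool) : (xs.any fun t' => t.idx == t'.idx && φ t') = φ t := by
  rw [Bool.eq_iff_iff, List.any_eq_true]
  constructor
  · rintro ⟨t', ht', h⟩
    simp only [Bool.and_eq_true, beq_iff_eq] at h
    rw [hL.idx_inj t ht t' ht' h.1]
    exact h.2
  · exact fun h => ⟨t, ht, by simpa using h⟩

theorem compareAll_alive {xs : List Info} (hL : Layout 0 0 false xs) (s : St D) {t₀ : Info}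
    (h₀ : t₀ ∈ xs) (hp : s.ptr .w = t₀.idx) (t : Info) :
    (run xs compareAll s).T .alive t = (t₀.atom == t.atom) := by
  -- After `j` rounds the live tokens are those whose first `j` bits agree with those of `t₀`. A
  -- missing bit shows as both `h0` and `h1` unset, so the lengths of the strings are compared too.
  let P : ℕ → St D → Prop := fun j s =>
    s.ptr .w = t₀.idx ∧ s.used = j ∧
    (∀ t, s.T .h0 t = ((encodeNat t.atom)[j]? == some false)) ∧
    (∀ t, s.T .h1 t = ((encodeNat t.atom)[j]? == some true)) ∧
    ∀ t, s.T .alive t = true ↔ ∀ i < j, (encodeNat t.atom)[i]? = (encodeNat t₀.atom)[i]?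
  have step : ∀ j s, P j s → P (j + 1) (run xs compareStep s) := by
    rintro j s ⟨hw, hu, h0, h1, ha⟩
    have hb0 : (xs.any fun t' => t₀.idx == t'.idx && s.T .h0 t') = s.T .h0 t₀ := any_idx hL h₀ _
    have hb1 : (xs.any fun t' => t₀.idx == t'.idx && s.T .h1 t') = s.T .h1 t₀ := any_idx hL h₀ _
    refine ⟨by rw [run_ptr rfl, hw], by simp [compareStep, run, St.load, St.set, hu], ?_, ?_, ?_⟩
    · intro t
      simp [compareStep, run, St.load, St.set, hu]
    · intro t
      simp [compareStep, run, St.load, St.set, hu]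
    · intro t
      simp only [compareStep, run, St.load, St.set, Function.update_apply, view_ptr, view_tr, hw,
        reduceCtorEq, if_false, if_true, hb0, hb1, Bool.and_eq_true, beq_iff_eq]
      rw [ha, h0, h0, h1, h1]
      constructor
      · rintro ⟨⟨h, h'⟩, h''⟩ i hi
        rcases Nat.lt_succ_iff_lt_or_eq.1 hi with hi | rfl
        · exact h i hi
        · revert h' h''
          rcases (encodeNat t.atom)[i]? with _ | _ | _ <;>
            rcases (encodeNat t₀.atom)[i]? with _ | _ | _ <;> simp
      · exact fun h => ⟨⟨fun i hi => h i (by omega), by rw [h j (by omega)]⟩,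
          by rw [h j (by omega)]⟩
  have h := iterate_inv (f := run xs compareStep) P
    (a := run xs .reset (run xs (.upd .alive fun _ => true) s))
    ⟨hp, rfl, fun t => by simp [run, St.load, St.set],
      fun t => by simp [run, St.load, St.set],
      fun t => by simp [run, St.load, St.set]⟩ step (size xs)
  have hl := length_lt_size h₀
  rw [Bool.eq_iff_iff, beq_iff_eq]
  refine (h.2.2.2.2 t).trans ⟨fun h => encodeNat_inj ?_, fun h i _ => by rw [h]⟩
  symm
  refine List.ext_getElem? fun i => ?_
  rcases Nat.lt_or_ge i (size xs) with hi | hi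
  · exact h i hi
  -- There are more rounds than `t₀` has bits, so the round at the end of its string rules out
  -- longer strings; beyond that position both strings have ended.
  · have h₁ := h _ hl
    rw [List.getElem?_eq_none (le_refl _), List.getElem?_eq_none_iff] at h₁
    rw [List.getElem?_eq_none (by omega), List.getElem?_eq_none (by omega)]

/-- The marks that `same` uses. -/
def scratch : Tr → Bool
  | .src | .alive | .b0 | .b1 | .sel | .h0 | .h1 => true
  | _ => false

/-- A pointer runs through the sources and each atom is compared with all others. The value of `φ`
is first saved in `src`, since the loop alters marks that `φ` may depend on; `Y` must not be one of
the marks used for the comparison. -/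
theorem same_T {xs : List Info} (hL : Layout 0 0 false xs) (s : St D) {Y : Tr}
    (hY : scratch Y = false) (φ : View → Bool) (t : Info) :
    (run xs (same Y φ) s).T Y t = xs.any fun t' => φ (s.view t') && t'.atom == t.atom := by
  have hcY : (compareAll : Cmd D).writes Y = false := by cases Y <;> first | rfl | simp [scratch] at hY
  have hYs : Y ≠ .src := by rintro rfl; simp [scratch] at hY
  have hYe : Y ≠ .sel := by rintro rfl; simp [scratch] at hY
  have hYa : Y ≠ .alive := by rintro rfl; simp [scratch] at hY
  let P : ℕ → St D → Prop := fun j s' => s'.ptr .w = j ∧ (∀ t, s'.T .src t = φ (s.view t)) ∧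
    ∀ t, s'.T Y t = xs.any fun t' => decide (t'.idx < j) && (φ (s.view t') && t'.atom == t.atom)
  have step : ∀ j s', P j s' → P (j + 1) (run xs (.any .sel (fun v => v.ptr .w && v.tr .src) ;;
      compareAll ;; .upd Y (fun v => v.tr Y || v.tr .alive && v.tr .sel) ;; .inc .w) s') := by
    rintro j s' ⟨hw, hsrc, hYj⟩
    let s₁ := run xs (.any .sel fun v => v.ptr .w && v.tr .src) s'
    let s₂ := run xs compareAll s₁
    let s₃ := run xs (.upd Y fun v => v.tr Y || v.tr .alive && v.tr .sel) s₂
    change P (j + 1) (run xs (.inc .w) s₃)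
    have hw₁ : s₁.ptr .w = j := by rw [← hw]; exact run_ptr rfl _
    have hsrc₂ : s₂.T .src = s'.T .src := (run_T rfl _).trans (run_T rfl _)
    have hsel : ∀ t, s₂.T .sel t = xs.any fun t' => j == t'.idx && φ (s.view t') := fun t => by
      have : s₂.T .sel = s₁.T .sel := run_T rfl _
      rw [this, run_any_T]
      simp only [view_ptr, view_tr, hw, hsrc]
    have hY₂ : s₂.T Y = s'.T Y := (run_T hcY _).trans (run_T (by simp [Cmd.writes, hYe]) _)
    have hY₃ : ∀ t, s₃.T Y t = (s'.T Y t || s₂.T .alive t && s₂.T .sel t) := fun t => by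
      rw [run_upd_T, view_tr, view_tr, view_tr, hY₂]
    refine ⟨?_, fun t => ?_, fun t => ?_⟩
    · have : s₃.ptr .w = j := (run_ptr rfl _).trans ((run_ptr rfl _).trans hw₁)
      simp [run, this]
    · rw [run_T rfl, run_T (by simp [Cmd.writes, hYs.symm]), hsrc₂, hsrc]
    · rw [run_T rfl, hY₃, hYj, hsel]
      by_cases h₀ : ∃ t₀ ∈ xs, t₀.idx = j
      · obtain ⟨t₀, h₀, rfl⟩ := h₀
        rw [compareAll_alive hL s₁ h₀ hw₁, any_idx hL h₀, Bool.eq_iff_iff]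
        simp only [Bool.or_eq_true, List.any_eq_true, Bool.and_eq_true, decide_eq_true_eq]
        constructor
        · rintro (⟨t', ht', hlt, h⟩ | h)
          · exact ⟨t', ht', by omega, h⟩
          · exact ⟨t₀, h₀, by omega, h.2, h.1⟩
        · rintro ⟨t', ht', hlt, h⟩
          rcases Nat.lt_succ_iff_lt_or_eq.1 hlt with hlt | he
          · exact .inl ⟨t', ht', hlt, h⟩
          · rw [hL.idx_inj t' ht' t₀ h₀ he] at h
            exact .inr ⟨h.2, h.1⟩
      -- No token is at position `j`, for instance when the pointer has run past the end: nothing is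
      -- selected and the round has no effect.
      · push Not at h₀
        have : (xs.any fun t' => j == t'.idx && φ (s.view t')) = false := by
          rw [List.any_eq_false]
          intro t' ht'
          simp [(h₀ t' ht').symm]
        rw [this, Bool.and_false, Bool.or_false, Bool.eq_iff_iff]
        simp only [List.any_eq_true, Bool.and_eq_true, decide_eq_true_eq]
        refine exists_congr fun t' => and_congr_right fun ht' => and_congr_left fun _ => ?_
        have := h₀ t' ht'
        omega
  have h := iterate_inv (f := run xs _) P
    (a := run xs (.zero .w) (run xs (.upd Y fun _ => false) (run xs (.upd .src φ) s)))
    ⟨by simp [run], fun t => by rw [run_T rfl, run_T (by simp [Cmd.writes, hYs.symm]), run_upd_T],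
      fun t => by rw [run_T rfl, run_upd_T]; simp⟩ step (size xs)
  refine (h.2.2 t).trans ?_
  rw [Bool.eq_iff_iff]
  simp only [List.any_eq_true, Bool.and_eq_true, decide_eq_true_eq]
  refine exists_congr fun t' => and_congr_right fun ht' => and_iff_right ?_
  exact (hL.idx_lt t' ht').trans_le (by simpa using length_le_size xs)

end Same

/-! ### Unit propagation -/

def Kind.isLit (k : Kind) : Bool := k.typ == .lit

def Kind.isKet (k : Kind) : Bool := k.typ == .ket

/-- Two sets of tokens: those with a true atom and those with a false atom. -/
abbrev Marks := (Info → Bool) × (Info → Bool)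

def Marks.falsifies (A : Marks) (t : Info) : Bool := if t.kind.sgn then A.2 t else A.1 t

/-- The literal `t` belongs to a clause selected by `g`, is not false, and another literal of the
clause is false. -/
def isUnit (xs : List Info) (g : Kind → Bool) (A : Marks) (t : Info) : Bool :=
  t.kind.isLit && g t.kind &&
    (xs.any fun t' => t'.kind.isLit && g t'.kind && A.falsifies t' && t'.cid == t.cid) &&
    !A.falsifies t

/-- One round of unit propagation. -/
def unitStep (xs : List Info) (g : Kind → Bool) (A : Marks) : Marks :=
  (fun t => A.1 t || xs.any fun t' => isUnit xs g A t' && t'.kind.sgn && t'.atom == t.atom,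
   fun t => A.2 t || xs.any fun t' => isUnit xs g A t' && !t'.kind.sgn && t'.atom == t.atom)

/-- Some clause is false, or some atom is both true and false. -/
def conflict (xs : List Info) (g : Kind → Bool) (A : Marks) : Bool :=
  xs.any fun k => k.kind.isKet && g k.kind &&
      (!xs.any fun t => t.kind.isLit && g t.kind && !A.falsifies t && t.cid == k.cid) ||
    A.1 k && A.2 k

/-- The tokens with the atom of a token that satisfies `φ`. -/
def spread (xs : List Info) (φ : Info → Bool) (t : Info) : Bool :=
  xs.any fun t' => φ t' && t'.atom == t.atom

/-- The interpretation `I` satisfies the literal at `t`. -/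
def SatAt (I : Set ℕ) (t : Info) : Prop := if t.kind.sgn then t.atom ∈ I else t.atom ∉ I

/-- The interpretation `I` satisfies the clauses selected by `g`. -/
def Models (xs : List Info) (g : Kind → Bool) (I : Set ℕ) : Prop :=
  ∀ k ∈ xs, k.kind.isKet → g k.kind →
    ∃ t ∈ xs, t.kind.isLit ∧ g t.kind ∧ t.cid = k.cid ∧ SatAt I t

/-- The clauses selected by `g` have at most two literals. -/
structure Binary (xs : List Info) (g : Kind → Bool) : Prop where
  exists_ket : ∀ t ∈ xs, t.kind.isLit → g t.kind →
    ∃ k ∈ xs, k.kind.isKet ∧ g k.kind ∧ k.cid = t.cid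
  le_two : ∀ t₁ ∈ xs, ∀ t₂ ∈ xs, ∀ t₃ ∈ xs, t₁.kind.isLit → t₂.kind.isLit → t₃.kind.isLit →
    t₁.cid = t₂.cid → t₁.cid = t₃.cid → t₁ = t₂ ∨ t₁ = t₃ ∨ t₂ = t₃

/-! ### Soundness and completeness of unit propagation for clauses of at most two literals. -/

section Propagation

variable {xs : List Info} {g : Kind → Bool}

/-- `I` agrees with the marks. -/
def Agrees (xs : List Info) (A : Marks) (I : Set ℕ) : Prop :=
  (∀ t ∈ xs, A.1 t → t.atom ∈ I) ∧ ∀ t ∈ xs, A.2 t → t.atom ∉ I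

theorem Agrees.not_satAt {A : Marks} {I : Set ℕ} (h : Agrees xs A I) {t : Info} (ht : t ∈ xs)
    (hf : A.falsifies t = true) : ¬ SatAt I t := by
  unfold Marks.falsifies at hf
  unfold SatAt
  split at hf
  · simpa [*] using h.2 t ht hf
  · simpa [*] using h.1 t ht hf

/-- The clause has at most two literals and one of them is false, so the model must satisfy the
other. -/
theorem satAt_of_isUnit (hb : Binary xs g) {A : Marks} {I : Set ℕ} (hI : Models xs g I)
    (h : Agrees xs A I) {t : Info} (ht : t ∈ xs) (hu : isUnit xs g A t = true) : SatAt I t := by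
  simp only [isUnit, Bool.and_eq_true, List.any_eq_true, beq_iff_eq, Bool.not_eq_true'] at hu
  obtain ⟨⟨⟨hl, hg⟩, t', ht', ⟨⟨hl', -⟩, hf'⟩, hc⟩, hf⟩ := hu
  obtain ⟨k, hk, hkk, hgk, hkc⟩ := hb.exists_ket t ht hl hg
  obtain ⟨t'', ht'', hl'', -, hc'', hs⟩ := hI k hk hkk hgk
  rcases hb.le_two t ht t' ht' t'' ht'' hl hl' hl'' hc.symm (by omega) with rfl | rfl | rfl
  · simp [hf] at hf'
  · exact hs
  · exact absurd hs (h.not_satAt ht' hf')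

theorem Agrees.unitStep (hb : Binary xs g) {A : Marks} {I : Set ℕ} (hI : Models xs g I)
    (h : Agrees xs A I) : Agrees xs (unitStep xs g A) I := by
  constructor
  · intro t ht h'
    simp only [KromForget.unitStep, Bool.or_eq_true, List.any_eq_true, Bool.and_eq_true,
      beq_iff_eq] at h'
    rcases h' with h' | ⟨t', ht', ⟨hu, hs⟩, ha⟩
    · exact h.1 t ht h'
    · have := satAt_of_isUnit hb hI h ht' hu
      rw [SatAt, if_pos hs] at this
      rwa [← ha]
  · intro t ht h'
    simp only [KromForget.unitStep, Bool.or_eq_true, List.any_eq_true, Bool.and_eq_true,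
      beq_iff_eq, Bool.not_eq_true'] at h'
    rcases h' with h' | ⟨t', ht', ⟨hu, hs⟩, ha⟩
    · exact h.2 t ht h'
    · have := satAt_of_isUnit hb hI h ht' hu
      rw [SatAt, if_neg (by simp [hs])] at this
      rwa [← ha]

theorem Agrees.conflict_eq_false {A : Marks} {I : Set ℕ} (hI : Models xs g I)
    (h : Agrees xs A I) : conflict xs g A = false := by
  rw [conflict, List.any_eq_false]
  intro k hk hc
  simp only [Bool.or_eq_true, Bool.and_eq_true, Bool.not_eq_true', List.any_eq_false,
    beq_iff_eq, not_and] at hc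
  rcases hc with ⟨⟨hkk, hgk⟩, hc⟩ | ⟨h₁, h₂⟩
  · obtain ⟨t, ht, hl, hg, hc', hs⟩ := hI k hk hkk hgk
    by_cases hf : A.falsifies t = true
    · exact h.not_satAt ht hf hs
    · exact hc t ht ⟨⟨hl, hg⟩, by simpa using hf⟩ hc'
  · exact h.2 k hk h₂ (h.1 k hk h₁)

/-- The marks depend on the atom only. -/
def Marks.Uniform (xs : List Info) (A : Marks) : Prop :=
  ∀ t ∈ xs, ∀ t' ∈ xs, t.atom = t'.atom → A.1 t = A.1 t' ∧ A.2 t = A.2 t'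

theorem Marks.Uniform.unitStep {A : Marks} (h : A.Uniform xs) :
    (KromForget.unitStep xs g A).Uniform xs := by
  intro t ht t' ht' e
  simp only [KromForget.unitStep, h t ht t' ht' e, e, and_self]

def Marks.verifies (A : Marks) (t : Info) : Bool := if t.kind.sgn then A.1 t else A.2 t

/-- Every clause with a false literal has a true one. -/
structure Good (xs : List Info) (g : Kind → Bool) (A : Marks) : Prop where
  uniform : A.Uniform xs
  consistent : ∀ t ∈ xs, A.1 t = true → A.2 t = false
  verifies : ∀ t ∈ xs, t.kind.isLit → g t.kind → A.falsifies t = true →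
    ∃ t' ∈ xs, t'.kind.isLit ∧ g t'.kind ∧ t'.cid = t.cid ∧ A.verifies t' = true

/-- Without conflict, a clause with a false literal has one that is not false. That literal is a
unit, and closure means that its atom is already marked accordingly. -/
theorem good_of_closed (hb : Binary xs g) {A : Marks} (hu : A.Uniform xs)
    (hc : conflict xs g A = false)
    (hclosed : ∀ t ∈ xs, (unitStep xs g A).1 t = A.1 t ∧ (unitStep xs g A).2 t = A.2 t) :
    Good xs g A := by
  rw [conflict, List.any_eq_false] at hc
  refine ⟨hu, fun t ht h => ?_, fun t ht hl hg hf => ?_⟩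
  · have := hc t ht
    simp only [h, Bool.true_and, Bool.or_eq_true, not_or, Bool.not_eq_true] at this
    exact this.2
  · obtain ⟨k, hk, hkk, hgk, hkc⟩ := hb.exists_ket t ht hl hg
    have := hc k hk
    simp only [hkk, hgk, Bool.true_and, Bool.or_eq_true, Bool.not_eq_true', not_or,
      Bool.not_eq_false, List.any_eq_true, Bool.and_eq_true, beq_iff_eq] at this
    obtain ⟨⟨t', ht', ⟨⟨hl', hg'⟩, hf'⟩, hc'⟩, -⟩ := this
    have hunit : isUnit xs g A t' = true := by
      simp only [isUnit, Bool.and_eq_true, List.any_eq_true, beq_iff_eq, Bool.not_eq_true']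
      exact ⟨⟨⟨hl', hg'⟩, t, ht, ⟨⟨hl, hg⟩, hf⟩, by omega⟩, hf'⟩
    refine ⟨t', ht', hl', hg', by omega, ?_⟩
    have h₁ := hclosed t' ht'
    unfold Marks.verifies
    split
    · rw [← h₁.1]
      simp only [unitStep, Bool.or_eq_true, List.any_eq_true, Bool.and_eq_true, beq_iff_eq]
      exact .inr ⟨t', ht', ⟨hunit, by assumption⟩, rfl⟩
    · rw [← h₁.2]
      simp only [unitStep, Bool.or_eq_true, List.any_eq_true, Bool.and_eq_true, beq_iff_eq]
      exact .inr ⟨t', ht', ⟨hunit, by simp_all⟩, rfl⟩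

/-- The marks `A`, and the marks `B` for the atoms that `A` leaves open. -/
def Marks.merge (A B : Marks) : Marks :=
  (fun t => A.1 t || !A.2 t && B.1 t, fun t => A.2 t || !A.1 t && B.2 t)

/-- A clause in which `A` makes a literal false is made true by `A`. In any other clause, a literal
made false by the merge is made false by `B`, so `B` makes some literal true, and `A` does not stand
against it. -/
theorem Good.merge {A B : Marks} (hA : Good xs g A) (hB : Good xs g B) :
    Good xs g (A.merge B) := by
  refine ⟨fun t ht t' ht' e => ?_, fun t ht h => ?_, fun t ht hl hg hf => ?_⟩
  · have h₁ := hA.uniform t ht t' ht' e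
    have h₂ := hB.uniform t ht t' ht' e
    simp only [Marks.merge, h₁.1, h₁.2, h₂.1, h₂.2, and_self]
  · have h₁ := hA.consistent t ht
    have h₂ := hB.consistent t ht
    revert h h₁ h₂
    simp only [Marks.merge]
    cases A.1 t <;> cases A.2 t <;> cases B.1 t <;> cases B.2 t <;> simp
  · have key : ∀ u ∈ xs, u.kind.isLit → g u.kind → u.cid = t.cid → A.falsifies u = true →
        ∃ t' ∈ xs, t'.kind.isLit ∧ g t'.kind ∧ t'.cid = t.cid ∧
          (A.merge B).verifies t' = true := by
      intro u hu hlu hgu hcu hfu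
      obtain ⟨t', ht', hl', hg', hc', hv⟩ := hA.verifies u hu hlu hgu hfu
      refine ⟨t', ht', hl', hg', by omega, ?_⟩
      unfold Marks.verifies at *
      split at hv <;> simp_all [Marks.merge]
    by_cases hfA : A.falsifies t = true
    · exact key t ht hl hg rfl hfA
    · have hfB : B.falsifies t = true := by
        unfold Marks.falsifies at *
        split at hf <;> simp_all [Marks.merge]
      obtain ⟨t', ht', hl', hg', hc', hv⟩ := hB.verifies t ht hl hg hfB
      by_cases hfA' : A.falsifies t' = true
      · exact key t' ht' hl' hg' hc' hfA'
      · refine ⟨t', ht', hl', hg', hc', ?_⟩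
        unfold Marks.verifies Marks.falsifies at *
        split at hv <;> simp_all [Marks.merge]

/-- The assignments `B` may be found separately for each token and without regard to `A`: merging
them one by one, always with lower precedence, never revises a value. No backtracking is needed. -/
theorem Good.exists_total {A : Marks} (hA : Good xs g A) (l : List Info) (hl : l ⊆ xs)
    (h : ∀ t ∈ l, ∃ B, Good xs g B ∧ (B.1 t = true ∨ B.2 t = true)) :
    ∃ C, Good xs g C ∧ (∀ t, (A.1 t → C.1 t) ∧ (A.2 t → C.2 t)) ∧
      ∀ t ∈ l, C.1 t = true ∨ C.2 t = true := by
  induction l with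
  | nil => exact ⟨A, hA, fun t => ⟨id, id⟩, by simp⟩
  | cons t l ih =>
    obtain ⟨C, hC, hAC, hCl⟩ := ih (fun x hx => hl (List.mem_cons_of_mem _ hx))
      fun x hx => h x (List.mem_cons_of_mem _ hx)
    obtain ⟨B, hB, hBt⟩ := h t (by simp)
    refine ⟨C.merge B, hC.merge hB, fun u => ⟨fun hu => ?_, fun hu => ?_⟩, fun u hu => ?_⟩
    · simp [Marks.merge, (hAC u).1 hu]
    · simp [Marks.merge, (hAC u).2 hu]
    · rcases List.mem_cons.1 hu with rfl | hu
      · revert hBt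
        simp only [Marks.merge]
        cases C.1 u <;> cases C.2 u <;> cases B.1 u <;> cases B.2 u <;> simp
      · rcases hCl u hu with h' | h' <;> simp [Marks.merge, h']

/-- The interpretation given by the marks. -/
def Marks.interp (xs : List Info) (A : Marks) : Set ℕ := {p | ∃ t ∈ xs, t.atom = p ∧ A.1 t = true}

theorem Good.agrees {A : Marks} (hA : Good xs g A) : Agrees xs A (A.interp xs) := by
  refine ⟨fun t ht h => ⟨t, ht, rfl, h⟩, fun t ht h => ?_⟩
  rintro ⟨t', ht', e, h'⟩
  rw [(hA.uniform t' ht' t ht e).1] at h'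
  simp [hA.consistent t ht h'] at h

/-- The condition `hne` excludes the empty clause, about which `Good` says nothing. Otherwise take
any literal of the clause: it is true, or it is false and another one is true. -/
theorem Good.models {A : Marks} (hA : Good xs g A) (ht : ∀ t ∈ xs, A.1 t = true ∨ A.2 t = true)
    (hne : ∀ k ∈ xs, k.kind.isKet → g k.kind →
      ∃ t ∈ xs, t.kind.isLit ∧ g t.kind ∧ t.cid = k.cid) : Models xs g (A.interp xs) := by
  intro k hk hkk hgk
  obtain ⟨t, h₁, hl, hg, hc⟩ := hne k hk hkk hgk
  have hsat : ∀ u ∈ xs, A.verifies u = true → SatAt (A.interp xs) u := fun u hu hv => by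
    unfold SatAt
    unfold Marks.verifies at hv
    split at hv
    · rw [if_pos ‹_›]
      exact hA.agrees.1 u hu hv
    · rw [if_neg ‹_›]
      exact hA.agrees.2 u hu hv
  by_cases hf : A.falsifies t = true
  · obtain ⟨t', ht', hl', hg', hc', hv⟩ := hA.verifies t h₁ hl hg hf
    exact ⟨t', ht', hl', hg', by omega, hsat t' ht' hv⟩
  · refine ⟨t, h₁, hl, hg, hc, hsat t h₁ ?_⟩
    have := ht t h₁
    unfold Marks.verifies Marks.falsifies at *
    split <;> simp_all

/-- The number of marked tokens. -/
def Marks.count (xs : List Info) (A : Marks) : ℕ := xs.countP A.1 + xs.countP A.2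

theorem countP_lt {α : Type*} {p q : α → Bool} {l : List α} (h : ∀ x ∈ l, p x → q x) {x : α}
    (hx : x ∈ l) (hp : p x = false) (hq : q x = true) : l.countP p < l.countP q := by
  induction l with
  | nil => simp at hx
  | cons y l ih =>
    have hle : l.countP p ≤ l.countP q :=
      List.countP_mono_left fun x hx => h x (List.mem_cons_of_mem _ hx)
    rw [List.countP_cons, List.countP_cons]
    rcases List.mem_cons.1 hx with rfl | hx
    · simp only [hp, hq, if_true, Bool.false_eq_true, if_false]
      omega
    · have := ih (fun x hx => h x (List.mem_cons_of_mem _ hx)) hx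
      have h' := h y (by simp)
      by_cases hy : p y = true
      · rw [if_pos hy, if_pos (h' hy)]
        omega
      · rw [if_neg hy]
        omega

/-- Until the marks are closed, each round increases the number of marks, and this is at most twice
the number of tokens. -/
theorem closed_iterate_unitStep (A : Marks) : ∀ t ∈ xs,
    (unitStep xs g ((unitStep xs g)^[2 * size xs] A)).1 t = ((unitStep xs g)^[2 * size xs] A).1 t ∧
    (unitStep xs g ((unitStep xs g)^[2 * size xs] A)).2 t =
      ((unitStep xs g)^[2 * size xs] A).2 t := by
  have hmono : ∀ A : Marks, (∀ t ∈ xs, A.1 t → (unitStep xs g A).1 t) ∧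
      ∀ t ∈ xs, A.2 t → (unitStep xs g A).2 t := fun A =>
    ⟨fun t _ h => by simp [unitStep, h], fun t _ h => by simp [unitStep, h]⟩
  let closed : Marks → Prop := fun A =>
    ∀ t ∈ xs, (unitStep xs g A).1 t = A.1 t ∧ (unitStep xs g A).2 t = A.2 t
  have hstep : ∀ A, closed A ∨ A.count xs < (unitStep xs g A).count xs := fun A => by
    by_cases h : closed A
    · exact .inl h
    · right
      have h₁ := List.countP_mono_left (hmono A).1
      have h₂ := List.countP_mono_left (hmono A).2
      simp only [closed] at h
      push Not at h
      obtain ⟨t, ht, h⟩ := h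
      unfold Marks.count
      by_cases e : (unitStep xs g A).1 t = A.1 t
      · have := h e
        have hf : A.2 t = false := by
          by_contra hA
          exact this (by rw [(hmono A).2 t ht (by simpa using hA)]; simpa using hA)
        have := countP_lt (hmono A).2 ht hf (by rw [hf] at this; simpa using this)
        omega
      · have hf : A.1 t = false := by
          by_contra hA
          exact e (by rw [(hmono A).1 t ht (by simpa using hA)]; simpa using hA)
        have := countP_lt (hmono A).1 ht hf (by rw [hf] at e; simpa using e)
        omega
  -- Being closed concerns the tokens of `xs` only, while marks are functions on all tokens; so
  -- `unitStep xs g A` need not equal `A`, and persistence has to be shown.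
  have hclosed : ∀ A, closed A → closed (unitStep xs g A) := fun A h => by
    have hf : ∀ t ∈ xs, (unitStep xs g A).falsifies t = A.falsifies t := fun t ht => by
      simp only [Marks.falsifies, (h t ht).1, (h t ht).2]
    have hu : ∀ t ∈ xs, isUnit xs g (unitStep xs g A) t = isUnit xs g A t := fun t ht => by
      simp only [isUnit, hf t ht]
      congr 2
      rw [Bool.eq_iff_iff]
      simp only [List.any_eq_true]
      exact exists_congr fun t' => and_congr_right fun ht' => by rw [hf t' ht']
    intro t ht
    constructor
    · rw [Bool.eq_iff_iff]
      conv_lhs => rw [unitStep]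
      simp only [Bool.or_eq_true, List.any_eq_true, or_iff_left_iff_imp]
      rintro ⟨t', ht', h'⟩
      rw [hu t' ht'] at h'
      simp only [unitStep, Bool.or_eq_true, List.any_eq_true]
      exact .inr ⟨t', ht', h'⟩
    · rw [Bool.eq_iff_iff]
      conv_lhs => rw [unitStep]
      simp only [Bool.or_eq_true, List.any_eq_true, or_iff_left_iff_imp]
      rintro ⟨t', ht', h'⟩
      rw [hu t' ht'] at h'
      simp only [unitStep, Bool.or_eq_true, List.any_eq_true]
      exact .inr ⟨t', ht', h'⟩
  have key : ∀ n, closed ((unitStep xs g)^[n] A) ∨ n ≤ ((unitStep xs g)^[n] A).count xs := fun n => by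
    induction n with
    | zero => simp
    | succ n ih =>
      rw [Function.iterate_succ_apply']
      rcases ih with ih | ih
      · exact .inl (hclosed _ ih)
      · rcases hstep ((unitStep xs g)^[n] A) with h | h
        · exact .inl (hclosed _ h)
        · exact .inr (by omega)
  have hle : ∀ A : Marks, A.count xs ≤ 2 * size xs := fun A => by
    have h₁ := List.countP_le_length (p := A.1) (l := xs)
    have h₂ := List.countP_le_length (p := A.2) (l := xs)
    have := length_le_size xs
    unfold Marks.count
    omega
  rcases hstep ((unitStep xs g)^[2 * size xs] A) with h | h
  · exact h
  · rcases key (2 * size xs) with h' | h'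
    · exact h'
    · have := hle (unitStep xs g ((unitStep xs g)^[2 * size xs] A))
      omega

/-- The result of unit propagation from the given marks. -/
def propConflict (xs : List Info) (g : Kind → Bool) (A : Marks) : Bool :=
  conflict xs g ((unitStep xs g)^[2 * size xs] A)

theorem propConflict_sound (hb : Binary xs g) {A : Marks} (h : propConflict xs g A = true)
    {I : Set ℕ} (hI : Models xs g I) : ¬ Agrees xs A I := fun hA => by
  have := iterate_inv (f := unitStep xs g) (fun _ A => Agrees xs A I) hA
    (fun _ _ h => h.unitStep hb hI) (2 * size xs)
  rw [propConflict, this.conflict_eq_false hI] at h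
  simp at h

/-- The absence of a conflict does not yet give a model, only an extension to a partial assignment
that leaves no clause half-falsified. -/
theorem propConflict_complete (hb : Binary xs g) {A : Marks} (hA : A.Uniform xs)
    (h : propConflict xs g A = false) :
    ∃ B, Good xs g B ∧ ∀ t, (A.1 t → B.1 t) ∧ (A.2 t → B.2 t) := by
  have hu := iterate_inv (f := unitStep xs g) (fun _ A => A.Uniform xs) hA
    (fun _ _ h => h.unitStep) (2 * size xs)
  exact ⟨_, good_of_closed hb hu h (closed_iterate_unitStep A),
    iterate_inv (f := unitStep xs g)
      (fun _ B => ∀ t, (A.1 t → B.1 t) ∧ (A.2 t → B.2 t)) (a := A) (fun t => ⟨id, id⟩)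
      (fun _ B h t => ⟨fun h' => by simp [unitStep, (h t).1 h'],
        fun h' => by simp [unitStep, (h t).2 h']⟩) (2 * size xs)⟩

theorem exists_lit_of_propConflict {A : Marks} (h : propConflict xs g A = false) :
    ∀ k ∈ xs, k.kind.isKet → g k.kind → ∃ t ∈ xs, t.kind.isLit ∧ g t.kind ∧ t.cid = k.cid := by
  intro k hk hkk hgk
  rw [propConflict, conflict, List.any_eq_false] at h
  have := h k hk
  simp only [hkk, hgk, Bool.true_and, Bool.or_eq_true, Bool.not_eq_true', not_or,
    Bool.not_eq_false, List.any_eq_true, Bool.and_eq_true, beq_iff_eq] at this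
  obtain ⟨⟨t', ht', ⟨⟨hl', hg'⟩, -⟩, hc'⟩, -⟩ := this
  exact ⟨t', ht', hl', hg', hc'⟩

/-- A clause, given by the tokens with the atoms of its literals, for each sign. -/
abbrev Query := Bool → Info → Bool

def Holds (xs : List Info) (Q : Query) (I : Set ℕ) : Prop :=
  ∃ t ∈ xs, Q true t = true ∧ t.atom ∈ I ∨ Q false t = true ∧ t.atom ∉ I

/-- The clauses selected by `g` imply the clause `Q`. -/
def Implied (xs : List Info) (g : Kind → Bool) (Q : Query) : Prop :=
  ∀ I, Models xs g I → Holds xs Q I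

/-- The marks that make the literals of `Q` false. -/
def refute (xs : List Info) (Q : Query) : Marks := (spread xs (Q false), spread xs (Q true))

theorem uniform_spread (φ ψ : Info → Bool) : Marks.Uniform xs (spread xs φ, spread xs ψ) := by
  intro t _ t' _ e
  simp only [spread, e, and_self]

theorem agrees_spread {φ ψ : Info → Bool} {I : Set ℕ} :
    Agrees xs (spread xs φ, spread xs ψ) I ↔
      (∀ t ∈ xs, φ t → t.atom ∈ I) ∧ ∀ t ∈ xs, ψ t → t.atom ∉ I := by
  simp only [Agrees, spread, List.any_eq_true, Bool.and_eq_true, beq_iff_eq]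
  constructor
  · exact fun h => ⟨fun t ht h' => h.1 t ht ⟨t, ht, h', rfl⟩, fun t ht h' => h.2 t ht ⟨t, ht, h', rfl⟩⟩
  · refine fun h => ⟨?_, ?_⟩
    · rintro t - ⟨t', ht', h', e⟩
      exact e ▸ h.1 t' ht' h'
    · rintro t - ⟨t', ht', h', e⟩
      exact e ▸ h.2 t' ht' h'

theorem agrees_refute {Q : Query} {I : Set ℕ} : Agrees xs (refute xs Q) I ↔ ¬ Holds xs Q I := by
  rw [refute, agrees_spread, Holds]
  push Not
  exact ⟨fun h t ht => ⟨h.2 t ht, h.1 t ht⟩, fun h => ⟨fun t ht => (h t ht).2, fun t ht => (h t ht).1⟩⟩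

/-- The decision procedure for implication. -/
theorem implied_iff (hL : Layout 0 0 false xs) (hb : Binary xs g) (Q : Query) :
    Implied xs g Q ↔ propConflict xs g (refute xs Q) = true ∨ ∃ n < size xs,
      propConflict xs g (spread xs fun t => n == t.idx, spread xs fun _ => false) = true ∧
      propConflict xs g (spread xs fun _ => false, spread xs fun t => n == t.idx) = true := by
  constructor
  · intro h
    by_contra hn
    simp only [not_or, not_exists, not_and, Bool.not_eq_true] at hn
    obtain ⟨hn, hn'⟩ := hn
    obtain ⟨A, hA, hAr⟩ := propConflict_complete hb (uniform_spread _ _) hn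
    -- Each atom has a value that propagates without conflict. Merged below the propagated negation
    -- of `Q`, these values give a model in which `Q` fails.
    obtain ⟨C, hC, hAC, ht⟩ := hA.exists_total xs (List.Subset.refl _) fun t ht => by
      have hlt : t.idx < size xs := (hL.idx_lt t ht).trans_le (by simpa using length_le_size xs)
      have hs : spread xs (fun t' => t.idx == t'.idx) t = true :=
        List.any_eq_true.2 ⟨t, ht, by simp⟩
      rcases h₁ : propConflict xs g (spread xs fun t' => t.idx == t'.idx, spread xs fun _ => false)
      · obtain ⟨B, hB, h⟩ := propConflict_complete hb (uniform_spread _ _) h₁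
        exact ⟨B, hB, .inl ((h t).1 hs)⟩
      · obtain ⟨B, hB, h⟩ := propConflict_complete hb (uniform_spread _ _) (hn' _ hlt h₁)
        exact ⟨B, hB, .inr ((h t).2 hs)⟩
    refine agrees_refute.1 ⟨fun t h₁ h₂ => hC.agrees.1 t h₁ ?_, fun t h₁ h₂ => hC.agrees.2 t h₁ ?_⟩
      (h _ (hC.models ht (exists_lit_of_propConflict hn)))
    · exact (hAC t).1 ((hAr t).1 h₂)
    · exact (hAC t).2 ((hAr t).2 h₂)
  · rintro (h | ⟨n, -, h₁, h₂⟩) I hI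
    · by_contra hc
      exact propConflict_sound hb h hI (agrees_refute.2 hc)
    -- Both values of some atom are impossible, so there is no model at all.
    · exfalso
      have h₁ := propConflict_sound hb h₁ hI
      have h₂ := propConflict_sound hb h₂ hI
      simp only [agrees_spread, Bool.false_eq_true, false_imp_iff, implies_true, and_true,
        true_and, beq_iff_eq] at h₁ h₂
      push Not at h₁ h₂
      obtain ⟨t, ht, rfl, h⟩ := h₁
      obtain ⟨t', ht', e, h'⟩ := h₂
      rw [hL.idx_inj t ht t' ht' e] at h
      exact h h'

end Propagation

/-! ### Programs -/

section Programs

variable {D : Type}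

def View.falsified (v : View) : Bool := if v.kind.sgn then v.tr .AF else v.tr .AT

/-- The clauses selected by `g`, as a condition on literals. -/
def View.litOf (g : Kind → Bool) (v : View) : Bool := v.kind.isLit && g v.kind

/-- One round of unit propagation. -/
def round (g : Kind → Bool) : Cmd D :=
  .grp .fs (fun v => v.litOf g && v.falsified) ;;
  .upd .un (fun v => v.litOf g && v.tr .fs && !v.falsified) ;;
  same .d1 (fun v => v.tr .un && v.kind.sgn) ;; same .d0 (fun v => v.tr .un && !v.kind.sgn) ;;
  .upd .AT (fun v => v.tr .AT || v.tr .d1) ;; .upd .AF (fun v => v.tr .AF || v.tr .d0)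

/-- Unit propagation from the marks given by `φ` and `ψ`. -/
def propagate (g : Kind → Bool) (φ ψ : View → Bool) : Cmd D :=
  same .AT φ ;; same .AF ψ ;; .rep (round g ;; round g) ;;
  .grp .nf (fun v => v.litOf g && !v.falsified) ;;
  .any .cf (fun v => v.kind.isKet && g v.kind && !v.tr .nf || v.tr .AT && v.tr .AF)

/-- Both values of the atom at pointer `z` lead to a conflict. -/
def probe (g : Kind → Bool) : Cmd D :=
  propagate g (fun v => v.ptr .z) (fun _ => false) ;; .upd .c1 (fun v => v.tr .cf) ;;
  propagate g (fun _ => false) (fun v => v.ptr .z) ;;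
  .upd .ent (fun v => v.tr .ent || v.tr .c1 && v.tr .cf)

/-- The clause given by the marks `qp` and `qn`. -/
def St.query (s : St D) : Query := fun a => if a then s.T .qp else s.T .qn

/-- Mark by `ent` whether the clauses selected by `g` imply the clause given by the marks. -/
def ent (g : Kind → Bool) : Cmd D :=
  propagate g (fun v => v.tr .qn) (fun v => v.tr .qp) ;;
  .upd .ent (fun v => v.tr .cf) ;; .zero .z ;; .rep (probe g ;; .inc .z)

variable {xs : List Info} {g : Kind → Bool}

theorem run_seq (c d : Cmd D) (s : St D) : run xs (c ;; d) s = run xs d (run xs c s) := rfl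

theorem round_T (hL : Layout 0 0 false xs) (s : St D) :
    ((run xs (round g) s).T .AT, (run xs (round g) s).T .AF) =
      unitStep xs g (s.T .AT, s.T .AF) := by
  let s₁ := run xs (.grp .fs (fun v => v.litOf g && v.falsified)) s
  let s₂ := run xs (.upd .un (fun v => v.litOf g && v.tr .fs && !v.falsified)) s₁
  let s₃ := run xs (same .d1 (fun v => v.tr .un && v.kind.sgn)) s₂
  let s₄ := run xs (same .d0 (fun v => v.tr .un && !v.kind.sgn)) s₃
  let s₅ := run xs (.upd .AT (fun v => v.tr .AT || v.tr .d1)) s₄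
  let s₆ := run xs (.upd .AF (fun v => v.tr .AF || v.tr .d0)) s₅
  change (s₆.T .AT, s₆.T .AF) = _
  have hT₁ : s₁.T .AT = s.T .AT := run_T rfl _
  have hF₁ : s₁.T .AF = s.T .AF := run_T rfl _
  have hT₄ : s₄.T .AT = s.T .AT := (run_T rfl _).trans ((run_T rfl _).trans ((run_T rfl _).trans hT₁))
  have hF₄ : s₄.T .AF = s.T .AF := (run_T rfl _).trans ((run_T rfl _).trans ((run_T rfl _).trans hF₁))
  have hf : ∀ t, (s.view t).falsified = Marks.falsifies (s.T .AT, s.T .AF) t := fun _ => rfl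
  have hf₁ : ∀ t, (s₁.view t).falsified = Marks.falsifies (s.T .AT, s.T .AF) t := fun t => by
    rw [← hT₁, ← hF₁]; rfl
  have hun : ∀ t, s₂.T .un t = isUnit xs g (s.T .AT, s.T .AF) t := fun t => by
    rw [run_upd_T, view_tr, run_grp_T, hf₁]
    rfl
  have hun₃ : s₃.T .un = s₂.T .un := run_T rfl _
  have hd1 : ∀ t, s₄.T .d1 t = xs.any fun t' =>
      isUnit xs g (s.T .AT, s.T .AF) t' && t'.kind.sgn && t'.atom == t.atom := fun t => by
    have h : s₄.T .d1 = s₃.T .d1 := run_T rfl _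
    rw [h, same_T hL _ rfl]
    simp only [view_tr, hun, view_kind]
  have hd0 : ∀ t, s₄.T .d0 t = xs.any fun t' =>
      isUnit xs g (s.T .AT, s.T .AF) t' && !t'.kind.sgn && t'.atom == t.atom := fun t => by
    rw [same_T hL _ rfl]
    simp only [view_tr, hun₃, hun, view_kind]
  refine Prod.ext (funext fun t => ?_) (funext fun t => ?_)
  · have h : s₆.T .AT = s₅.T .AT := run_T rfl _
    change s₆.T .AT t = _
    rw [h, run_upd_T, view_tr, view_tr, hT₄, hd1]
    rfl
  · have h₁ : s₅.T .AF = s₄.T .AF := run_T rfl _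
    have h₂ : s₅.T .d0 = s₄.T .d0 := run_T rfl _
    change s₆.T .AF t = _
    rw [run_upd_T, view_tr, view_tr, h₁, h₂, hF₄, hd0]
    rfl

/-- The command evaluates `ψ` only after `AT` has been computed, so `hψ` asks that this has not
changed its value. The loop body consists of two rounds, which gives the `2 * size xs` rounds that
suffice for closure. -/
theorem propagate_T (hL : Layout 0 0 false xs) (s : St D) (φ ψ : View → Bool)
    (hψ : ∀ t, ψ ((run xs (same .AT φ) s).view t) = ψ (s.view t)) (t : Info) :
    (run xs (propagate g φ ψ) s).T .cf t =
      propConflict xs g (spread xs fun t => φ (s.view t), spread xs fun t => ψ (s.view t)) := by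
  let s₁ := run xs (same .AT φ) s
  let s₂ := run xs (same .AF ψ) s₁
  let s₃ := run xs (.rep (round g ;; round g)) s₂
  let s₄ := run xs (.grp .nf (fun v => v.litOf g && !v.falsified)) s₃
  change (run xs (.any .cf fun v => v.kind.isKet && g v.kind && !v.tr .nf || v.tr .AT && v.tr .AF)
    s₄).T .cf t = _
  have h₂ : (s₂.T .AT, s₂.T .AF) =
      (spread xs fun t => φ (s.view t), spread xs fun t => ψ (s.view t)) := by
    refine Prod.ext (funext fun t => ?_) (funext fun t => ?_)
    · have h : s₂.T .AT = s₁.T .AT := run_T rfl _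
      change s₂.T .AT t = _
      rw [h, same_T hL _ rfl]
      rfl
    · change s₂.T .AF t = _
      rw [same_T hL _ rfl]
      simp only [s₁, hψ]
      rfl
  have h₃ : (s₃.T .AT, s₃.T .AF) = (unitStep xs g)^[2 * size xs] (s₂.T .AT, s₂.T .AF) := by
    rw [Function.iterate_mul]
    exact iterate_inv (f := run xs (round g ;; round g)) (a := s₂)
      (fun n s => (s.T .AT, s.T .AF) = ((unitStep xs g)^[2])^[n] (s₂.T .AT, s₂.T .AF)) rfl
      (fun n s h => by
        rw [Function.iterate_succ_apply', ← h, run_seq, round_T hL, round_T hL]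
        rfl) (size xs)
  have hT₄ : s₄.T .AT = s₃.T .AT := run_T rfl _
  have hF₄ : s₄.T .AF = s₃.T .AF := run_T rfl _
  rw [propConflict, ← h₂, ← h₃, run_any_T, conflict]
  congr 1

theorem probe_T (hL : Layout 0 0 false xs) (s : St D) (t : Info) :
    (run xs (probe g) s).T .ent t = (s.T .ent t ||
      propConflict xs g (spread xs fun t => s.ptr .z == t.idx, spread xs fun _ => false) &&
      propConflict xs g (spread xs fun _ => false, spread xs fun t => s.ptr .z == t.idx)) := by
  let s₁ := run xs (propagate g (fun v => v.ptr .z) fun _ => false) s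
  let s₂ := run xs (.upd .c1 fun v => v.tr .cf) s₁
  let s₃ := run xs (propagate g (fun _ => false) fun v => v.ptr .z) s₂
  change (run xs (.upd .ent fun v => v.tr .ent || v.tr .c1 && v.tr .cf) s₃).T .ent t = _
  have hent : s₃.T .ent = s.T .ent := (run_T rfl _).trans ((run_T rfl _).trans (run_T rfl _))
  have hz : s₂.ptr .z = s.ptr .z := (run_ptr rfl _).trans (run_ptr rfl _)
  have hc1 : s₃.T .c1 = s₂.T .c1 := run_T rfl _
  rw [run_upd_T, view_tr, view_tr, view_tr, hent, hc1, run_upd_T, view_tr,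
    propagate_T hL _ _ _ fun _ => rfl, propagate_T hL _ _ _ fun t => by
      rw [view_ptr, view_ptr, run_ptr rfl]]
  simp only [view_ptr, hz]

/-- The program follows `implied_iff`: after `n` rounds of the loop, `ent` records a conflict from
the negated clause or from both values at some position below `n`. -/
theorem ent_T (hL : Layout 0 0 false xs) (hb : Binary xs g) (s : St D) (t : Info) :
    (run xs (ent g) s).T .ent t = true ↔ Implied xs g s.query := by
  let s₁ := run xs (propagate g (fun v => v.tr .qn) fun v => v.tr .qp) s
  let s₂ := run xs (.zero .z) (run xs (.upd .ent fun v => v.tr .cf) s₁)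
  change ((run xs (probe g ;; .inc .z))^[size xs] s₂).T .ent t = true ↔ _
  rw [implied_iff hL hb]
  have h₂ : ∀ t, s₂.T .ent t = propConflict xs g (refute xs s.query) := fun t => by
    have h : s₂.T .ent = (run xs (.upd .ent fun v => v.tr .cf) s₁).T .ent := run_T rfl _
    rw [h, run_upd_T, view_tr, propagate_T hL _ _ _ fun t => by
      rw [view_tr, view_tr, run_T rfl]]
    rfl
  refine (iterate_inv (f := run xs (probe g ;; .inc .z)) (a := s₂)
    (fun n s' => s'.ptr .z = n ∧ ∀ t, s'.T .ent t = true ↔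
      propConflict xs g (refute xs s.query) = true ∨ ∃ m < n,
        propConflict xs g (spread xs fun t => m == t.idx, spread xs fun _ => false) = true ∧
        propConflict xs g (spread xs fun _ => false, spread xs fun t => m == t.idx) = true)
    ⟨by simp [s₂, run], fun t => by simp [h₂]⟩ (fun n s' h => ⟨?_, fun t => ?_⟩) (size xs)).2 t
  · have : (run xs (probe g) s').ptr .z = n := by rw [run_ptr rfl, h.1]
    simp [run, this]
  · rw [run_seq, run_T rfl, probe_T hL, Bool.or_eq_true, h.2, h.1, Bool.and_eq_true, or_assoc]
    refine or_congr_right ⟨?_, ?_⟩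
    · rintro (⟨m, hm, h'⟩ | h')
      · exact ⟨m, by omega, h'⟩
      · exact ⟨n, by omega, h'⟩
    · rintro ⟨m, hm, h'⟩
      rcases Nat.lt_succ_iff_lt_or_eq.1 hm with hm | rfl
      · exact .inl ⟨m, hm, h'⟩
      · exact .inr h'

/-! ### Comparing the implied clauses -/

/-- The tokens whose atom is to be forgotten. -/
def forgotten (xs : List Info) : Info → Bool := spread xs fun t => t.kind.typ == .vat

/-- The clause of the atom at position `i` with sign `a` and the atom at position `j` with
sign `b`, as far as these atoms occur in the clauses selected by `g` and are not forgotten. -/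
def pairLits (xs : List Info) (g : Kind → Bool) (i j : ℕ) (a b : Bool) : Query := fun c t =>
  (i == t.idx && a == c || j == t.idx && b == c) && (t.kind.isLit && g t.kind) && !forgotten xs t

/-- Position `i` is the end of a clause selected by `g`. -/
def ketAt (xs : List Info) (g : Kind → Bool) (i : ℕ) : Bool :=
  xs.any fun t => i == t.idx && t.kind.isKet && g t.kind

/-- The literals of the clause that ends at `i` that remain after forgetting. -/
def clauseLits (xs : List Info) (g : Kind → Bool) (i : ℕ) : Query := fun c t =>
  (xs.any fun t' => i == t'.idx && t'.kind.isKet && g t'.kind && t'.cid == t.cid) &&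
    (t.kind.isLit && g t.kind) && !forgotten xs t && t.kind.sgn == c

def markForgotten : Cmd D := same .vm fun v => v.kind.typ == .vat

def pairQuery (g : Kind → Bool) (a b : Bool) : Cmd D :=
  .upd .qp (fun v => (v.ptr .x && a == true || v.ptr .y && b == true) && v.litOf g && !v.tr .vm) ;;
  .upd .qn (fun v => (v.ptr .x && a == false || v.ptr .y && b == false) && v.litOf g && !v.tr .vm)

/-- Run a command for all pairs of signs. -/
def allSigns (c : Bool → Bool → Cmd D) : Cmd D :=
  c true true ;; c true false ;; c false true ;; c false false

/-- The first answer is saved in `ent'`, as the second call of `ent` overwrites `ent`. The clause is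
always formed from tokens of `gS`, also when it is tested against `gP`. -/
def checkPair (gP gS : Kind → Bool) (a b : Bool) : Cmd D :=
  pairQuery gS a b ;; ent gS ;; .upd .ent' (fun v => v.tr .ent) ;; ent gP ;;
  .upd .acc fun v => v.tr .acc && (!v.tr .ent' || v.tr .ent)

/-- Check that the clauses with at most two literals that are implied by `gS` are implied
by `gP`. -/
def checkPairs (gP gS : Kind → Bool) : Cmd D :=
  .zero .x ;; .rep ((.zero .y ;; .rep (allSigns (checkPair gP gS) ;; .inc .y)) ;; .inc .x)

/-- Where the pointer is not at the end of a clause, the query marks describe the empty clause;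
`here` keeps it from being tested. -/
def checkClause (gP gS : Kind → Bool) : Cmd D :=
  .grp .grp (fun v => v.ptr .x && v.kind.isKet && gS v.kind) ;;
  .any .here (fun v => v.ptr .x && v.kind.isKet && gS v.kind) ;;
  .upd .qp (fun v => v.tr .grp && v.litOf gS && !v.tr .vm && v.kind.sgn == true) ;;
  .upd .qn (fun v => v.tr .grp && v.litOf gS && !v.tr .vm && v.kind.sgn == false) ;; ent gP ;;
  .upd .acc fun v => v.tr .acc && (!v.tr .here || v.tr .ent)

/-- Check that the rests of the clauses of `gS` are implied by `gP`. -/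
def checkClauses (gP gS : Kind → Bool) : Cmd D :=
  .zero .x ;; .rep (checkClause gP gS ;; .inc .x)

variable {gP gS : Kind → Bool}

theorem query_congr {s s' : St D} (hp : s'.T .qp = s.T .qp) (hn : s'.T .qn = s.T .qn) :
    s'.query = s.query := by
  funext a
  simp only [St.query, hp, hn]

theorem pairQuery_query (s : St D) (hvm : s.T .vm = forgotten xs) (a b : Bool) :
    (run xs (pairQuery g a b) s).query = pairLits xs g (s.ptr .x) (s.ptr .y) a b := by
  funext c t
  cases c
  · change (run xs (pairQuery g a b) s).T .qn t = _
    rw [pairQuery, run_seq, run_upd_T, view_tr, view_ptr, view_ptr, run_T rfl, run_ptr rfl,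
      run_ptr rfl, hvm]
    rfl
  · change (run xs (pairQuery g a b) s).T .qp t = _
    rw [pairQuery, run_seq, run_T rfl, run_upd_T, view_tr, view_ptr, view_ptr, hvm]
    rfl

theorem checkPair_T (hL : Layout 0 0 false xs) (hP : Binary xs gP) (hS : Binary xs gS) (s : St D)
    (hvm : s.T .vm = forgotten xs) (a b : Bool) (t : Info) :
    (run xs (checkPair gP gS a b) s).T .acc t = true ↔ s.T .acc t = true ∧
      (Implied xs gS (pairLits xs gS (s.ptr .x) (s.ptr .y) a b) →
        Implied xs gP (pairLits xs gS (s.ptr .x) (s.ptr .y) a b)) := by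
  let s₁ := run xs (pairQuery gS a b) s
  let s₂ := run xs (ent gS) s₁
  let s₃ := run xs (.upd .ent' fun v => v.tr .ent) s₂
  let s₄ := run xs (ent gP) s₃
  change (run xs (.upd .acc fun v => v.tr .acc && (!v.tr .ent' || v.tr .ent)) s₄).T .acc t = true ↔ _
  have hq : s₁.query = pairLits xs gS (s.ptr .x) (s.ptr .y) a b := pairQuery_query s hvm a b
  have hq₃ : s₃.query = s₁.query :=
    query_congr ((run_T rfl _).trans (run_T rfl _)) ((run_T rfl _).trans (run_T rfl _))
  have hacc : s₄.T .acc = s.T .acc :=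
    (run_T rfl _).trans ((run_T rfl _).trans ((run_T rfl _).trans (run_T rfl _)))
  have he : s₄.T .ent' = s₃.T .ent' := run_T rfl _
  rw [run_upd_T, view_tr, view_tr, view_tr, hacc, he, run_upd_T, view_tr, Bool.and_eq_true,
    Bool.or_eq_true, Bool.not_eq_true', ← Bool.not_eq_true, ent_T hL hS, ent_T hL hP, hq₃, hq,
    ← imp_iff_not_or]

theorem allSigns_checkPair_T (hL : Layout 0 0 false xs) (hP : Binary xs gP) (hS : Binary xs gS)
    (s : St D) (hvm : s.T .vm = forgotten xs) (t : Info) :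
    (run xs (allSigns (checkPair gP gS)) s).T .acc t = true ↔ s.T .acc t = true ∧
      ∀ a b, Implied xs gS (pairLits xs gS (s.ptr .x) (s.ptr .y) a b) →
        Implied xs gP (pairLits xs gS (s.ptr .x) (s.ptr .y) a b) := by
  let s₁ := run xs (checkPair gP gS true true) s
  let s₂ := run xs (checkPair gP gS true false) s₁
  let s₃ := run xs (checkPair gP gS false true) s₂
  have hx : s₁.ptr .x = s.ptr .x ∧ s₂.ptr .x = s.ptr .x ∧ s₃.ptr .x = s.ptr .x :=
    ⟨run_ptr rfl _, (run_ptr rfl _).trans (run_ptr rfl _),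
      (run_ptr rfl _).trans ((run_ptr rfl _).trans (run_ptr rfl _))⟩
  have hy : s₁.ptr .y = s.ptr .y ∧ s₂.ptr .y = s.ptr .y ∧ s₃.ptr .y = s.ptr .y :=
    ⟨run_ptr rfl _, (run_ptr rfl _).trans (run_ptr rfl _),
      (run_ptr rfl _).trans ((run_ptr rfl _).trans (run_ptr rfl _))⟩
  have hvm₁ : s₁.T .vm = forgotten xs := (run_T rfl _).trans hvm
  have hvm₂ : s₂.T .vm = forgotten xs := (run_T rfl _).trans hvm₁
  have hvm₃ : s₃.T .vm = forgotten xs := (run_T rfl _).trans hvm₂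
  change (run xs (checkPair gP gS false false) s₃).T .acc t = true ↔ _
  rw [checkPair_T hL hP hS _ hvm₃, checkPair_T hL hP hS _ hvm₂, checkPair_T hL hP hS _ hvm₁,
    checkPair_T hL hP hS _ hvm, hx.1, hx.2.1, hx.2.2, hy.1, hy.2.1, hy.2.2]
  simp only [Bool.forall_bool]
  tauto

theorem checkPairs_T (hL : Layout 0 0 false xs) (hP : Binary xs gP) (hS : Binary xs gS) (s : St D)
    (hvm : s.T .vm = forgotten xs) (t : Info) :
    (run xs (checkPairs gP gS) s).T .acc t = true ↔ s.T .acc t = true ∧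
      ∀ i < size xs, ∀ j < size xs, ∀ a b,
        Implied xs gS (pairLits xs gS i j a b) → Implied xs gP (pairLits xs gS i j a b) := by
  have inner : ∀ (s : St D), s.T .vm = forgotten xs → ∀ t,
      (run xs (.zero .y ;; .rep (allSigns (checkPair gP gS) ;; .inc .y)) s).T .acc t = true ↔
        s.T .acc t = true ∧ ∀ j < size xs, ∀ a b, Implied xs gS (pairLits xs gS (s.ptr .x) j a b) →
          Implied xs gP (pairLits xs gS (s.ptr .x) j a b) := by
    intro s hvm t
    refine (iterate_inv (f := run xs (allSigns (checkPair gP gS) ;; .inc .y)) (a := run xs (.zero .y) s)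
      (fun n s' => s'.ptr .y = n ∧ s'.ptr .x = s.ptr .x ∧ s'.T .vm = forgotten xs ∧
        ∀ t, s'.T .acc t = true ↔ s.T .acc t = true ∧ ∀ j < n, ∀ a b,
          Implied xs gS (pairLits xs gS (s.ptr .x) j a b) →
          Implied xs gP (pairLits xs gS (s.ptr .x) j a b))
      ⟨by simp [run], by simp [run], hvm, fun t => by simp [run]⟩
      (fun n s' h => ⟨?_, ?_, ?_, fun t => ?_⟩) (size xs)).2.2.2 t
    · have : (run xs (allSigns (checkPair gP gS)) s').ptr .y = n := by rw [run_ptr rfl, h.1]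
      simp [run, this]
    · rw [run_seq, run_ptr rfl, run_ptr rfl, h.2.1]
    · rw [run_seq, run_T rfl, run_T rfl, h.2.2.1]
    · rw [run_seq, run_T rfl, allSigns_checkPair_T hL hP hS _ h.2.2.1, h.2.2.2, h.2.1, h.1, and_assoc]
      refine and_congr_right fun _ => ⟨fun h' j hj => ?_, fun h' => ?_⟩
      · rcases Nat.lt_succ_iff_lt_or_eq.1 hj with hj | rfl
        · exact h'.1 j hj
        · exact h'.2
      · exact ⟨fun j hj => h' j (by omega), h' n (by omega)⟩
  refine (iterate_inv
    (f := run xs ((.zero .y ;; .rep (allSigns (checkPair gP gS) ;; .inc .y)) ;; .inc .x))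
    (a := run xs (.zero .x) s)
    (fun n s' => s'.ptr .x = n ∧ s'.T .vm = forgotten xs ∧
      ∀ t, s'.T .acc t = true ↔ s.T .acc t = true ∧ ∀ i < n, ∀ j < size xs, ∀ a b,
        Implied xs gS (pairLits xs gS i j a b) → Implied xs gP (pairLits xs gS i j a b))
    ⟨by simp [run], hvm, fun t => by simp [run]⟩
    (fun n s' h => ⟨?_, ?_, fun t => ?_⟩) (size xs)).2.2 t
  · have : (run xs (.zero .y ;; .rep (allSigns (checkPair gP gS) ;; .inc .y)) s').ptr .x = n := by
      rw [run_ptr rfl, h.1]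
    rw [run_seq]
    simp [run] at this ⊢
    exact this
  · rw [run_seq, run_T rfl, run_T rfl, h.2.1]
  · rw [run_seq, run_T rfl, inner _ h.2.1, h.2.2, h.1, and_assoc]
    refine and_congr_right fun _ => ⟨fun h' i hi => ?_, fun h' => ?_⟩
    · rcases Nat.lt_succ_iff_lt_or_eq.1 hi with hi | rfl
      · exact h'.1 i hi
      · exact h'.2
    · exact ⟨fun i hi => h' i (by omega), h' n (by omega)⟩

theorem checkClause_T (hL : Layout 0 0 false xs) (hP : Binary xs gP) (s : St D)
    (hvm : s.T .vm = forgotten xs) (t : Info) :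
    (run xs (checkClause gP gS) s).T .acc t = true ↔ s.T .acc t = true ∧
      (ketAt xs gS (s.ptr .x) = true → Implied xs gP (clauseLits xs gS (s.ptr .x))) := by
  let s₁ := run xs (.grp .grp fun v => v.ptr .x && v.kind.isKet && gS v.kind) s
  let s₂ := run xs (.any .here fun v => v.ptr .x && v.kind.isKet && gS v.kind) s₁
  let s₃' := run xs (.upd .qp fun v =>
    v.tr .grp && v.litOf gS && !v.tr .vm && v.kind.sgn == true) s₂
  let s₃ := run xs (.upd .qn fun v =>
    v.tr .grp && v.litOf gS && !v.tr .vm && v.kind.sgn == false) s₃'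
  let s₄ := run xs (ent gP) s₃
  change (run xs (.upd .acc fun v => v.tr .acc && (!v.tr .here || v.tr .ent)) s₄).T .acc t = true ↔ _
  have hacc : s₄.T .acc = s.T .acc :=
    (run_T rfl _).trans ((run_T rfl _).trans ((run_T rfl _).trans
      ((run_T rfl _).trans (run_T rfl _))))
  have hh : s₄.T .here = s₂.T .here :=
    (run_T rfl _).trans ((run_T rfl _).trans (run_T rfl _))
  have hx : s₁.ptr .x = s.ptr .x := run_ptr rfl _
  have hvm₂ : s₂.T .vm = forgotten xs := ((run_T rfl _).trans (run_T rfl _)).trans hvm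
  have hg : s₂.T .grp = s₁.T .grp := run_T rfl _
  have hg' : s₃'.T .grp = s₁.T .grp := (run_T rfl _).trans hg
  have hvm₃ : s₃'.T .vm = forgotten xs := (run_T rfl _).trans hvm₂
  have hq : s₃.query = clauseLits xs gS (s.ptr .x) := by
    funext c t
    cases c
    · change s₃.T .qn t = _
      rw [run_upd_T, view_tr, view_tr, hg', hvm₃, run_grp_T]
      rfl
    · have h : s₃.T .qp = s₃'.T .qp := run_T rfl _
      change s₃.T .qp t = _
      rw [h, run_upd_T, view_tr, view_tr, hg, hvm₂, run_grp_T]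
      rfl
  have hk : s₂.T .here t = ketAt xs gS (s.ptr .x) := by
    rw [run_any_T, ketAt, ← hx]
    rfl
  rw [run_upd_T, view_tr, view_tr, view_tr, hacc, hh, hk, Bool.and_eq_true,
    Bool.or_eq_true, Bool.not_eq_true', ← Bool.not_eq_true, ent_T hL hP, hq, ← imp_iff_not_or]

theorem checkClauses_T (hL : Layout 0 0 false xs) (hP : Binary xs gP) (s : St D)
    (hvm : s.T .vm = forgotten xs) (t : Info) :
    (run xs (checkClauses gP gS) s).T .acc t = true ↔ s.T .acc t = true ∧
      ∀ i < size xs, ketAt xs gS i = true → Implied xs gP (clauseLits xs gS i) := by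
  refine (iterate_inv (f := run xs (checkClause gP gS ;; .inc .x)) (a := run xs (.zero .x) s)
    (fun n s' => s'.ptr .x = n ∧ s'.T .vm = forgotten xs ∧
      ∀ t, s'.T .acc t = true ↔ s.T .acc t = true ∧ ∀ i < n,
        ketAt xs gS i = true → Implied xs gP (clauseLits xs gS i))
    ⟨by simp [run], hvm, fun t => by simp [run]⟩
    (fun n s' h => ⟨?_, ?_, fun t => ?_⟩) (size xs)).2.2 t
  · have : (run xs (checkClause gP gS) s').ptr .x = n := by rw [run_ptr rfl, h.1]
    simp [run, this]
  · rw [run_seq, run_T rfl, run_T rfl, h.2.1]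
  · rw [run_seq, run_T rfl, checkClause_T hL hP _ h.2.1, h.2.2, h.1, and_assoc]
    refine and_congr_right fun _ => ⟨fun h' i hi => ?_, fun h' => ?_⟩
    · rcases Nat.lt_succ_iff_lt_or_eq.1 hi with hi | rfl
      · exact h'.1 i hi
      · exact h'.2
    · exact ⟨fun i hi => h' i (by omega), h' n (by omega)⟩

theorem markForgotten_T (hL : Layout 0 0 false xs) (s : St D) :
    (run xs markForgotten s).T .vm = forgotten xs := by
  funext t
  rw [markForgotten, same_T hL _ rfl]
  rfl

/-- Run the check `c` and write the answer. -/
def decision (c : Cmd Bool) : Cmd Bool :=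
  markForgotten ;; .upd .acc (fun _ => true) ;; c ;;
  .emit (fun v => if v.kind.typ == .fin then some (v.tr .acc) else none) (fun _ => none)
    (fun _ => false) id

/-- The condition `hfin` says that there is exactly one end token, so the answer is emitted exactly
once. -/
theorem decision_out (hL : Layout 0 0 false xs)
    (hfin : ∀ b : Bool, (xs.flatMap fun t => if t.kind.typ == .fin then [b] else []) = [b])
    {c : Cmd Bool} (hc : c.emits = false) {p : Prop}
    (h : ∀ (s : St Bool), s.T .vm = forgotten xs → (∀ t, s.T .acc t = true) →
      ∀ t, (run xs c s).T .acc t = true ↔ p) (b : Bool) (hb : b = true ↔ p) :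
    (run xs (decision c) (St.start Bool xs)).out = encodeBool b := by
  let s₁ := run xs (.upd .acc fun _ => true) (run xs markForgotten (St.start Bool xs))
  let s₂ := run xs c s₁
  have hs := h s₁ ((run_T rfl _).trans (markForgotten_T hL _)) fun t => run_upd_T _ _ _ _ _
  have hacc : ∀ t, s₂.T .acc t = b := fun t => by rw [Bool.eq_iff_iff, hs, hb]
  have ho : s₂.out = [] := by rw [run_out hc, run_out rfl, run_out rfl]; rfl
  change (run xs (.emit (fun v => if v.kind.typ == .fin then some (v.tr .acc) else none)
    (fun _ => none) (fun _ => false) id) s₂).out = [b]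
  generalize s₂ = s at hacc ho
  rw [run, ho, List.nil_append, ← hfin b]
  refine congrArg (fun f => xs.flatMap f) (funext fun t => ?_)
  simp only [emitAt, view_tr, view_kind, hacc]
  split <;> rfl

/-! ### Writing the implied clauses -/

def View.isFin (v : View) : Bool := v.kind.typ == .fin

/-- Write the clause given by the marks, if `ent` holds. -/
def writeClause : Cmd Γ' :=
  .emit (fun v => if v.isFin && v.tr .ent then some .bra else none) (fun _ => none)
    (fun _ => false) .bit ;;
  .emit (fun v => if (v.tr .qp || v.tr .qn) && v.tr .ent then some .comma else none)
    (fun v => if (v.tr .qp || v.tr .qn) && v.tr .ent then some (.bit (v.tr .qp)) else none)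
    (fun v => (v.tr .qp || v.tr .qn) && v.tr .ent) .bit ;;
  .emit (fun v => if v.isFin && v.tr .ent then some .ket else none) (fun _ => none)
    (fun _ => false) .bit

/-- Write the clause of the atoms at pointers `x` and `y`, if it is implied by `g` and has no
complementary literals. -/
def writePair (g : Kind → Bool) (a b : Bool) : Cmd Γ' :=
  pairQuery g a b ;; ent g ;; same .t1 (fun v => v.tr .qp) ;; same .t0 (fun v => v.tr .qn) ;;
  .any .tt (fun v => v.tr .t1 && v.tr .t0) ;; .upd .ent (fun v => v.tr .ent && !v.tr .tt) ;;
  writeClause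

/-- Write the implied clauses with at most two literals. -/
def writePairs (g : Kind → Bool) : Cmd Γ' :=
  markForgotten ;; .zero .x ;;
  .rep ((.zero .y ;; .rep (allSigns (writePair g) ;; .inc .y)) ;; .inc .x)

/-- The clause `Q` has a complementary pair. -/
def tautological (xs : List Info) (Q : Query) : Bool :=
  xs.any fun t => spread xs (Q true) t && spread xs (Q false) t

/-- A token selected with both signs would be listed once only, as positive; this does no harm,
since tautological clauses are not written. -/
def literals (xs : List Info) (Q : Query) : List Literal :=
  (xs.filter fun t => Q true t || Q false t).map fun t => ⟨Q true t, t.atom⟩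

open Classical in
/-- The clauses written for positions `i` and `j`, and signs `a` and `b`. -/
noncomputable def pairClauses (xs : List Info) (g : Kind → Bool) (i j : ℕ) (a b : Bool) :
    List (List Literal) :=
  if Implied xs g (pairLits xs g i j a b) ∧ tautological xs (pairLits xs g i j a b) = false then
    [literals xs (pairLits xs g i j a b)]
  else []

/-- All clauses written. -/
noncomputable def impliedClauses (xs : List Info) (g : Kind → Bool) : List (List Literal) :=
  (List.range (size xs)).flatMap fun i => (List.range (size xs)).flatMap fun j =>
    [true, false].flatMap fun a => [true, false].flatMap fun b => pairClauses xs g i j a b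

/-- A sweep emits in the order of the tokens, so the brackets come from separate sweeps before and
after the literals, each at the unique end token. -/
theorem writeClause_out
    (hfin : ∀ b : Γ', (xs.flatMap fun t => if t.kind.typ == .fin then [b] else []) = [b])
    (s : St Γ') (b : Bool) (hb : ∀ t, s.T .ent t = b) :
    (run xs writeClause s).out =
      s.out ++ if b then encodeClause (literals xs s.query) else [] := by
  have hview : ∀ (o : List Γ') t, St.view { s with out := o } t = s.view t := fun _ _ => rfl
  simp only [writeClause, run, hview, emitAt, View.isFin, view_tr, view_kind, hb]
  cases b
  · simp
  · have h₁ : ∀ a : Γ', (xs.flatMap fun t => (if (t.kind.typ == .fin && true) = true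
        then some a else none).toList ++ (none : Option Γ').toList ++
        if false = true then (encodeNat t.atom).map Γ'.bit else []) = [a] := fun a => by
      conv_rhs => rw [← hfin a]
      congr 1
      funext t
      cases t.kind.typ == Typ.fin <;> rfl
    have h₂ : ∀ p n : Info → Bool,
        (xs.flatMap fun t => (if ((p t || n t) && true) = true then some Γ'.comma else none).toList ++
        (if ((p t || n t) && true) = true then some (Γ'.bit (p t)) else none).toList ++
        if ((p t || n t) && true) = true then (encodeNat t.atom).map Γ'.bit else []) =
        (((xs.filter fun t => p t || n t).map fun t => ⟨p t, t.atom⟩ : List Literal)).flatMap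
          encodeLiteral := fun p n => by
      rw [List.flatMap_map]
      clear h₁ hfin
      induction xs with
      | nil => rfl
      | cons t l ih =>
        rw [List.flatMap_cons, ih, List.filter_cons]
        cases hp : p t <;> cases hn : n t <;> simp [encodeLiteral, hp]
    rw [h₁, h₁, h₂]
    simp only [encodeClause, literals, St.query]
    simp

theorem writePair_out (hL : Layout 0 0 false xs) (hb : Binary xs g)
    (hfin : ∀ b : Γ', (xs.flatMap fun t => if t.kind.typ == .fin then [b] else []) = [b])
    (s : St Γ') (hvm : s.T .vm = forgotten xs) (a b : Bool) :
    (run xs (writePair g a b) s).out =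
      s.out ++ (pairClauses xs g (s.ptr .x) (s.ptr .y) a b).flatMap encodeClause := by
  classical
  let s₁ := run xs (pairQuery g a b) s
  let s₂ := run xs (ent g) s₁
  let s₃ := run xs (same .t1 fun v => v.tr .qp) s₂
  let s₄ := run xs (same .t0 fun v => v.tr .qn) s₃
  let s₅ := run xs (.any .tt fun v => v.tr .t1 && v.tr .t0) s₄
  let s₆ := run xs (.upd .ent fun v => v.tr .ent && !v.tr .tt) s₅
  let Q := pairLits xs g (s.ptr .x) (s.ptr .y) a b
  have hq₁ : s₁.query = Q := pairQuery_query s hvm a b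
  have hq₂ : s₂.query = Q := (query_congr (run_T rfl _) (run_T rfl _)).trans hq₁
  have hq₃ : s₃.query = Q := (query_congr (run_T rfl _) (run_T rfl _)).trans hq₂
  have hq₄ : s₄.query = Q := (query_congr (run_T rfl _) (run_T rfl _)).trans hq₃
  have hq₆ : s₆.query = Q := (query_congr ((run_T rfl _).trans (run_T rfl _))
    ((run_T rfl _).trans (run_T rfl _))).trans hq₄
  have hp : s₂.T .qp = Q true := congrFun hq₂ true
  have hn : s₃.T .qn = Q false := congrFun hq₃ false
  have ht : ∀ t, s₅.T .tt t = tautological xs Q := fun t => by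
    have h1 : s₄.T .t1 = s₃.T .t1 := run_T rfl _
    rw [run_any_T, tautological]
    congr 1
    funext t'
    rw [view_tr, view_tr, h1, same_T hL _ rfl, same_T hL _ rfl]
    simp only [view_tr, hp, hn]
    rfl
  have he₅ : s₅.T .ent = s₂.T .ent := (run_T rfl _).trans ((run_T rfl _).trans (run_T rfl _))
  let e : Bool := decide (Implied xs g Q ∧ tautological xs Q = false)
  have he : ∀ t, s₆.T .ent t = e := fun t => by
    rw [run_upd_T, view_tr, view_tr, he₅, ht, Bool.eq_iff_iff, Bool.and_eq_true, ent_T hL hb, hq₁,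
      Bool.not_eq_true', decide_eq_true_eq]
  have ho : s₆.out = s.out := by
    rw [run_out rfl, run_out rfl, run_out rfl, run_out rfl, run_out rfl, run_out rfl]
  have := writeClause_out hfin s₆ e he
  rw [hq₆, ho] at this
  refine this.trans ?_
  rw [pairClauses]
  by_cases h : Implied xs g Q ∧ tautological xs Q = false
  · rw [if_pos h, if_pos (decide_eq_true h), List.flatMap_singleton]
  · rw [if_neg h, if_neg (by simpa [e] using h), List.flatMap_nil]

theorem allSigns_writePair_out (hL : Layout 0 0 false xs) (hb : Binary xs g)
    (hfin : ∀ b : Γ', (xs.flatMap fun t => if t.kind.typ == .fin then [b] else []) = [b])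
    (s : St Γ') (hvm : s.T .vm = forgotten xs) :
    (run xs (allSigns (writePair g)) s).out =
      s.out ++ ([true, false].flatMap fun a => [true, false].flatMap fun b =>
        pairClauses xs g (s.ptr .x) (s.ptr .y) a b).flatMap encodeClause := by
  let s₁ := run xs (writePair g true true) s
  let s₂ := run xs (writePair g true false) s₁
  let s₃ := run xs (writePair g false true) s₂
  have hx : s₁.ptr .x = s.ptr .x ∧ s₂.ptr .x = s.ptr .x ∧ s₃.ptr .x = s.ptr .x :=
    ⟨run_ptr rfl _, (run_ptr rfl _).trans (run_ptr rfl _),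
      (run_ptr rfl _).trans ((run_ptr rfl _).trans (run_ptr rfl _))⟩
  have hy : s₁.ptr .y = s.ptr .y ∧ s₂.ptr .y = s.ptr .y ∧ s₃.ptr .y = s.ptr .y :=
    ⟨run_ptr rfl _, (run_ptr rfl _).trans (run_ptr rfl _),
      (run_ptr rfl _).trans ((run_ptr rfl _).trans (run_ptr rfl _))⟩
  have hvm₁ : s₁.T .vm = forgotten xs := (run_T rfl _).trans hvm
  have hvm₂ : s₂.T .vm = forgotten xs := (run_T rfl _).trans hvm₁
  have hvm₃ : s₃.T .vm = forgotten xs := (run_T rfl _).trans hvm₂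
  change (run xs (writePair g false false) s₃).out = _
  rw [writePair_out hL hb hfin _ hvm₃, writePair_out hL hb hfin _ hvm₂,
    writePair_out hL hb hfin _ hvm₁, writePair_out hL hb hfin _ hvm, hx.1, hx.2.1, hx.2.2, hy.1,
    hy.2.1, hy.2.2]
  simp only [List.flatMap_cons, List.flatMap_nil, List.flatMap_append, List.append_nil,
    List.append_assoc]

theorem writePairs_out (hL : Layout 0 0 false xs) (hb : Binary xs g)
    (hfin : ∀ b : Γ', (xs.flatMap fun t => if t.kind.typ == .fin then [b] else []) = [b]) :
    (run xs (writePairs g) (St.start Γ' xs)).out =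
      (impliedClauses xs g).flatMap encodeClause := by
  have inner : ∀ (s : St Γ'), s.T .vm = forgotten xs →
      (run xs (.zero .y ;; .rep (allSigns (writePair g) ;; .inc .y)) s).out = s.out ++
        ((List.range (size xs)).flatMap fun j => [true, false].flatMap fun a =>
          [true, false].flatMap fun b => pairClauses xs g (s.ptr .x) j a b).flatMap
          encodeClause := by
    intro s hvm
    refine (iterate_inv (f := run xs (allSigns (writePair g) ;; .inc .y)) (a := run xs (.zero .y) s)
      (fun n s' => s'.ptr .y = n ∧ s'.ptr .x = s.ptr .x ∧ s'.T .vm = forgotten xs ∧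
        s'.out = s.out ++ ((List.range n).flatMap fun j =>
          [true, false].flatMap fun a =>
          [true, false].flatMap fun b => pairClauses xs g (s.ptr .x) j a b).flatMap encodeClause)
      ⟨by simp [run], by simp [run], hvm, by simp [run]⟩
      (fun n s' h => ⟨?_, ?_, ?_, ?_⟩) (size xs)).2.2.2
    · have : (run xs (allSigns (writePair g)) s').ptr .y = n := by rw [run_ptr rfl, h.1]
      simp [run, this]
    · rw [run_seq, run_ptr rfl, run_ptr rfl, h.2.1]
    · rw [run_seq, run_T rfl, run_T rfl, h.2.2.1]
    · rw [run_seq, run_out rfl, allSigns_writePair_out hL hb hfin _ h.2.2.1, h.2.2.2, h.2.1, h.1,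
        List.range_succ, List.flatMap_append, List.flatMap_append, List.flatMap_singleton,
        List.append_assoc]
  refine (iterate_inv (f := run xs ((.zero .y ;; .rep (allSigns (writePair g) ;; .inc .y)) ;; .inc .x))
    (a := run xs (.zero .x) (run xs markForgotten (St.start Γ' xs)))
    (fun n s' => s'.ptr .x = n ∧ s'.T .vm = forgotten xs ∧
      s'.out = ((List.range n).flatMap fun i => (List.range (size xs)).flatMap fun j =>
        [true, false].flatMap fun a =>
          [true, false].flatMap fun b => pairClauses xs g i j a b).flatMap encodeClause)
    ⟨by simp [run], (run_T rfl _).trans (markForgotten_T hL _), ?_⟩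
    (fun n s' h => ⟨?_, ?_, ?_⟩) (size xs)).2.2
  · rw [run_out rfl, run_out rfl]
    rfl
  · have : (run xs (.zero .y ;; .rep (allSigns (writePair g) ;; .inc .y)) s').ptr .x = n := by
      rw [run_ptr rfl, h.1]
    rw [run_seq]
    simp [run] at this ⊢
    exact this
  · rw [run_seq, run_T rfl, run_T rfl, h.2.1]
  · rw [run_seq, run_out rfl, inner _ h.2.1, h.2.2, h.1,
      List.range_succ, List.flatMap_append, List.flatMap_append, List.flatMap_singleton]

end Programs

/-! ### Semantics of forgetting -/

namespace Formula

theorem sat_subst_top (p : ℕ) (φ : Formula) (I : Set ℕ) :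
    Sat I (subst p top φ) ↔ Sat (insert p I) φ := by
  induction φ with
  | atom q =>
    by_cases h : q = p <;> simp [subst, Sat, h]
  | _ => simp_all [subst, Sat]

theorem sat_subst_bot (p : ℕ) (φ : Formula) (I : Set ℕ) :
    Sat I (subst p bot φ) ↔ Sat (I \ {p}) φ := by
  induction φ with
  | atom q =>
    by_cases h : q = p <;> simp [subst, Sat, h]
  | _ => simp_all [subst, Sat]

/-- Substituting a constant for `p` amounts to evaluating with `p` set to that value, so each step
quantifies existentially over the value of one atom. -/
theorem sat_forget (φ : Formula) (V : List ℕ) (I : Set ℕ) :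
    Sat I (forget φ V) ↔ ∃ J, Sat J φ ∧ ∀ q ∉ V, q ∈ J ↔ q ∈ I := by
  induction V generalizing φ with
  | nil =>
    refine ⟨fun h => ⟨I, h, fun _ _ => Iff.rfl⟩, ?_⟩
    rintro ⟨J, hJ, h⟩
    rwa [forget, ← Set.ext fun q => h q (by simp)]
  | cons p V ih =>
    rw [forget, ih]
    constructor
    · rintro ⟨J, hJ, h⟩
      rcases hJ with hJ | hJ
      · refine ⟨_, (sat_subst_top p φ J).1 hJ, fun q hq => ?_⟩
        simp only [List.mem_cons, not_or] at hq
        rw [← h q hq.2]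
        simp [hq.1]
      · refine ⟨_, (sat_subst_bot p φ J).1 hJ, fun q hq => ?_⟩
        simp only [List.mem_cons, not_or] at hq
        rw [← h q hq.2]
        simp [hq.1]
    · rintro ⟨J, hJ, h⟩
      by_cases hp : p ∈ J
      -- The induction hypothesis needs agreement with `I` also at `p`, if `p ∉ V`; so the value at
      -- `p` is reset to that of `I`, and the value in `J` is supplied by the choice of the
      -- disjunct.
      · refine ⟨{q | if q = p then q ∈ I else q ∈ J}, .inl ?_, fun q hq => ?_⟩
        · rw [sat_subst_top]
          convert hJ using 1
          ext q
          by_cases e : q = p <;> simp [e, hp]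
        · by_cases e : q = p
          · simp [e]
          · simpa [e] using h q (by simp [e, hq])
      · refine ⟨{q | if q = p then q ∈ I else q ∈ J}, .inr ?_, fun q hq => ?_⟩
        · rw [sat_subst_bot]
          convert hJ using 1
          ext q
          by_cases e : q = p <;> simp [e, hp]
        · by_cases e : q = p
          · simp [e]
          · simpa [e] using h q (by simp [e, hq])

end Formula

open Formula

/-- The interpretation `I` satisfies the literal `l`. -/
def Literal.Sat (I : Set ℕ) (l : Literal) : Prop := if l.sign then l.atom ∈ I else l.atom ∉ I

theorem sat_toFormula (I : Set ℕ) (l : Literal) : Formula.Sat I l.toFormula ↔ l.Sat I := by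
  unfold Literal.toFormula Literal.Sat
  split <;> rfl

theorem sat_disj (I : Set ℕ) (c : List Literal) :
    Formula.Sat I (disj c) ↔ ∃ l ∈ c, l.Sat I := by
  induction c with
  | nil => simp [disj, Formula.Sat]
  | cons l c ih => simp [disj, Formula.Sat, ih, sat_toFormula]

theorem sat_conj (I : Set ℕ) (T : List (List Literal)) :
    Formula.Sat I (conj T) ↔ ∀ c ∈ T, ∃ l ∈ c, l.Sat I := by
  induction T with
  | nil => simp [conj, Formula.Sat]
  | cons c T ih => simp [conj, Formula.Sat, ih, sat_disj]

theorem mem_vars_disj (p : ℕ) (c : List Literal) : p ∈ vars (disj c) ↔ ∃ l ∈ c, l.atom = p := by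
  induction c with
  | nil => simp [disj, vars]
  | cons l c ih =>
    have : vars l.toFormula = {l.atom} := by
      unfold Literal.toFormula
      split <;> rfl
    simp [disj, vars, ih, this, eq_comm]

theorem mem_vars_conj (p : ℕ) (T : List (List Literal)) :
    p ∈ vars (conj T) ↔ ∃ c ∈ T, ∃ l ∈ c, l.atom = p := by
  induction T with
  | nil => simp [conj, vars]
  | cons c T ih => simp [conj, vars, ih, mem_vars_disj]

/-! ### The majority of three models -/

/-- A property of interpretations that is closed under majority is determined by pairs of atoms. -/
theorem exists_agree {M : Set ℕ → Prop}
    (hM : ∀ J₁ J₂ J₃, M J₁ → M J₂ → M J₃ →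
      M {p | p ∈ J₁ ∧ p ∈ J₂ ∨ p ∈ J₁ ∧ p ∈ J₃ ∨ p ∈ J₂ ∧ p ∈ J₃})
    {I : Set ℕ} {W : Set ℕ} (h₀ : ∃ J, M J)
    (h₂ : ∀ p ∈ W, ∀ q ∈ W, ∃ J, M J ∧ (p ∈ J ↔ p ∈ I) ∧ (q ∈ J ↔ q ∈ I)) (A : Finset ℕ)
    (hA : ↑A ⊆ W) : ∃ J, M J ∧ ∀ p ∈ A, p ∈ J ↔ p ∈ I := by
  induction A using Finset.strongInduction with
  | H A ih =>
    by_cases hcard : A.card ≤ 2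
    · have : A.card = 0 ∨ A.card = 1 ∨ A.card = 2 := by omega
      rcases this with h | h | h
      · obtain ⟨J, hJ⟩ := h₀
        exact ⟨J, hJ, by simp [Finset.card_eq_zero.1 h]⟩
      · obtain ⟨p, rfl⟩ := Finset.card_eq_one.1 h
        obtain ⟨J, hJ, h, -⟩ := h₂ p (hA (by simp)) p (hA (by simp))
        exact ⟨J, hJ, by simpa using h⟩
      · obtain ⟨p, q, -, rfl⟩ := Finset.card_eq_two.1 h
        obtain ⟨J, hJ, h, h'⟩ := h₂ p (hA (by simp)) q (hA (by simp))
        exact ⟨J, hJ, by simpa using ⟨h, h'⟩⟩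
    -- Three models agree with `I` on `A` except possibly at `a`, at `b` and at `c` respectively. At
    -- every atom of `A` at least two of them agree with `I`, hence so does their majority.
    · obtain ⟨a, b, c, ha, hb, hc, hab, hac, hbc⟩ := Finset.two_lt_card_iff.1 (not_le.1 hcard)
      have key : ∀ x ∈ A, ∃ J, M J ∧ ∀ p ∈ A, p ≠ x → (p ∈ J ↔ p ∈ I) := fun x hx => by
        obtain ⟨J, hJ, h⟩ := ih (A.erase x) (Finset.erase_ssubset hx)
          ((Finset.coe_subset.2 (A.erase_subset x)).trans hA)
        exact ⟨J, hJ, fun p hp hpx => h p (Finset.mem_erase.2 ⟨hpx, hp⟩)⟩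
      obtain ⟨J₁, hJ₁, h₁⟩ := key a ha
      obtain ⟨J₂, hJ₂, h₂⟩ := key b hb
      obtain ⟨J₃, hJ₃, h₃⟩ := key c hc
      refine ⟨_, hM J₁ J₂ J₃ hJ₁ hJ₂ hJ₃, fun p hp => ?_⟩
      have h₁ := h₁ p hp
      have h₂ := h₂ p hp
      have h₃ := h₃ p hp
      by_cases e₁ : p = a
      · subst e₁
        simp only [Set.mem_ofPred_eq, h₂ hab, h₃ hac]
        tauto
      · by_cases e₂ : p = b
        · subst e₂
          simp only [Set.mem_ofPred_eq, h₁ e₁, h₃ hbc]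
          tauto
        · simp only [Set.mem_ofPred_eq, h₁ e₁, h₂ e₂]
          tauto

/-- Each of the three models satisfies a literal of the clause. There are only two literals, so some
literal holds in two of the models and therefore in the majority. -/
theorem Binary.majority {xs : List Info} {g : Kind → Bool} (hb : Binary xs g) (J₁ J₂ J₃ : Set ℕ)
    (h₁ : Models xs g J₁) (h₂ : Models xs g J₂) (h₃ : Models xs g J₃) :
    Models xs g {p | p ∈ J₁ ∧ p ∈ J₂ ∨ p ∈ J₁ ∧ p ∈ J₃ ∨ p ∈ J₂ ∧ p ∈ J₃} := by
  intro k hk hkk hgk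
  obtain ⟨t₁, m₁, l₁, g₁, c₁, s₁⟩ := h₁ k hk hkk hgk
  obtain ⟨t₂, m₂, l₂, g₂, c₂, s₂⟩ := h₂ k hk hkk hgk
  obtain ⟨t₃, m₃, l₃, g₃, c₃, s₃⟩ := h₃ k hk hkk hgk
  rcases hb.le_two t₁ m₁ t₂ m₂ t₃ m₃ l₁ l₂ l₃ (by omega) (by omega) with rfl | rfl | rfl
  · refine ⟨t₁, m₁, l₁, g₁, c₁, ?_⟩
    unfold SatAt at *
    split at s₁ <;> simp_all
  · refine ⟨t₁, m₁, l₁, g₁, c₁, ?_⟩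
    unfold SatAt at *
    split at s₁ <;> simp_all
  · refine ⟨t₂, m₂, l₂, g₂, c₂, ?_⟩
    unfold SatAt at *
    split at s₂ <;> simp_all

/-! ### Theories as parts of an annotated instance -/

/-- The clause `c` is the one that ends at `k`. -/
def ClauseAt (xs : List Info) (g : Kind → Bool) (k : Info) (c : List Literal) : Prop :=
  k ∈ xs ∧ k.kind.isKet = true ∧ g k.kind = true ∧ ∀ l, l ∈ c ↔
    ∃ t ∈ xs, t.kind.isLit = true ∧ g t.kind = true ∧ t.cid = k.cid ∧ t.kind.sgn = l.sign ∧
      t.atom = l.atom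

/-- The clauses selected by `g` are those of the Krom theory `T`, and the atoms to be forgotten are
those of `V`. -/
structure Represents (xs : List Info) (g : Kind → Bool) (T : KromTheory) (V : List ℕ) : Prop where
  layout : Layout 0 0 false xs
  binary : Binary xs g
  exists_nonlit : ∃ e ∈ xs, e.kind.isLit = false
  exists_clause : ∀ k ∈ xs, k.kind.isKet = true → g k.kind = true → ∃ c ∈ T.1, ClauseAt xs g k c
  exists_ket : ∀ c ∈ T.1, ∃ k, ClauseAt xs g k c
  forgotten_iff : ∀ t, forgotten xs t = true ↔ t.atom ∈ V

theorem satAt_iff {I : Set ℕ} {t : Info} {l : Literal} (hs : t.kind.sgn = l.sign)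
    (ha : t.atom = l.atom) : SatAt I t ↔ l.Sat I := by
  rw [SatAt, Literal.Sat, hs, ha]

theorem ClauseAt.exists_satAt_iff {xs : List Info} {g : Kind → Bool} {k : Info} {c : List Literal}
    (h : ClauseAt xs g k c) (I : Set ℕ) :
    (∃ t ∈ xs, t.kind.isLit = true ∧ g t.kind = true ∧ t.cid = k.cid ∧ SatAt I t) ↔
      ∃ l ∈ c, l.Sat I := by
  constructor
  · rintro ⟨t, ht, hl, hg, hc, hs⟩
    exact ⟨⟨t.kind.sgn, t.atom⟩, (h.2.2.2 _).2 ⟨t, ht, hl, hg, hc, rfl, rfl⟩, hs⟩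
  · rintro ⟨l, hl, hs⟩
    obtain ⟨t, ht, hl, hg, hc, hsg, ha⟩ := (h.2.2.2 _).1 hl
    exact ⟨t, ht, hl, hg, hc, (satAt_iff hsg ha).2 hs⟩

/-- The literals of a clause. -/
def Query.lits (xs : List Info) (Q : Query) : Set Literal :=
  {l | ∃ t ∈ xs, Q l.sign t = true ∧ t.atom = l.atom}

theorem holds_iff {xs : List Info} {Q : Query} {I : Set ℕ} :
    Holds xs Q I ↔ ∃ l ∈ Q.lits xs, l.Sat I := by
  constructor
  · rintro ⟨t, ht, ⟨h, hI⟩ | ⟨h, hI⟩⟩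
    · exact ⟨⟨true, t.atom⟩, ⟨t, ht, h, rfl⟩, hI⟩
    · exact ⟨⟨false, t.atom⟩, ⟨t, ht, h, rfl⟩, hI⟩
  · rintro ⟨⟨_ | _, p⟩, ⟨t, ht, h, rfl⟩, hI⟩
    · exact ⟨t, ht, .inr ⟨h, hI⟩⟩
    · exact ⟨t, ht, .inl ⟨h, hI⟩⟩

/-! ### Forgetting and implied clauses of a represented theory. -/

section Represents

variable {xs : List Info} {g gP gS : Kind → Bool} {T P S : KromTheory} {V : List ℕ}

theorem Represents.models_iff (h : Represents xs g T V) (I : Set ℕ) :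
    Models xs g I ↔ Formula.Sat I T.toFormula := by
  rw [KromTheory.toFormula, sat_conj]
  constructor
  · intro hI c hc
    obtain ⟨k, hk⟩ := h.exists_ket c hc
    exact (hk.exists_satAt_iff I).1 (hI k hk.1 hk.2.1 hk.2.2.1)
  · intro hI k hk hkk hgk
    obtain ⟨c, hc, hkc⟩ := h.exists_clause k hk hkk hgk
    exact (hkc.exists_satAt_iff I).2 (hI c hc)

theorem Represents.mem_vars (h : Represents xs g T V) (p : ℕ) : p ∈ vars T.toFormula ↔
    ∃ t ∈ xs, t.kind.isLit = true ∧ g t.kind = true ∧ t.atom = p := by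
  rw [KromTheory.toFormula, mem_vars_conj]
  constructor
  · rintro ⟨c, hc, l, hl, rfl⟩
    obtain ⟨k, hk⟩ := h.exists_ket c hc
    obtain ⟨t, ht, hl, hg, -, -, ha⟩ := (hk.2.2.2 l).1 hl
    exact ⟨t, ht, hl, hg, ha⟩
  · rintro ⟨t, ht, hl, hg, rfl⟩
    obtain ⟨k, hk, hkk, hgk, hc⟩ := h.binary.exists_ket t ht hl hg
    obtain ⟨c, hcT, hkc⟩ := h.exists_clause k hk hkk hgk
    exact ⟨c, hcT, ⟨t.kind.sgn, t.atom⟩, (hkc.2.2.2 _).2 ⟨t, ht, hl, hg, hc.symm, rfl, rfl⟩, rfl⟩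

theorem Represents.idx_lt (h : Represents xs g T V) {t : Info} (ht : t ∈ xs) : t.idx < size xs :=
  (h.layout.idx_lt t ht).trans_le (by simpa using length_le_size xs)

theorem Represents.pairLits_iff (h : Represents xs g T V) {i j : ℕ} {a b c : Bool} {t : Info} :
    pairLits xs g i j a b c t = true ↔
      (i = t.idx ∧ a = c ∨ j = t.idx ∧ b = c) ∧ t.kind.isLit = true ∧ g t.kind = true ∧
        t.atom ∉ V := by
  rw [← h.forgotten_iff]
  simp [pairLits, and_assoc]

theorem Represents.mem_lits_pairLits (h : Represents xs g T V) {i j : ℕ} {a b : Bool} {l : Literal}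
    (hl : l ∈ Query.lits xs (pairLits xs g i j a b)) :
    l.atom ∈ vars T.toFormula ∧ l.atom ∉ V := by
  obtain ⟨t, ht, hQ, ha⟩ := hl
  obtain ⟨-, hl, hg, hV⟩ := h.pairLits_iff.1 hQ
  exact ⟨(h.mem_vars _).2 ⟨t, ht, hl, hg, ha⟩, ha ▸ hV⟩

/-- Every clause with at most two literals over the remaining atoms is considered. -/
theorem Represents.exists_pairLits (h : Represents xs g T V) {c : List Literal} (hc : c.length ≤ 2)
    (hv : ∀ l ∈ c, l.atom ∈ vars T.toFormula ∧ l.atom ∉ V) :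
    ∃ i < size xs, ∃ j < size xs, ∃ a b, ∀ l,
      l ∈ Query.lits xs (pairLits xs g i j a b) ↔ l ∈ c := by
  match c, hc with
  | [], _ =>
    -- Both pointers at a token that is not a literal give the empty clause.
    obtain ⟨e, he, hel⟩ := h.exists_nonlit
    refine ⟨e.idx, h.idx_lt he, e.idx, h.idx_lt he, true, true, fun l => ?_⟩
    simp only [List.not_mem_nil, iff_false]
    rintro ⟨t, ht, hQ, -⟩
    obtain ⟨hi, hl, -⟩ := h.pairLits_iff.1 hQ
    have : e.idx = t.idx := by tauto
    rw [h.layout.idx_inj e he t ht this, hl] at hel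
    simp at hel
  | [l₁], _ =>
    obtain ⟨hv, hV⟩ := hv l₁ (by simp)
    obtain ⟨t, ht, hl, hg, ha⟩ := (h.mem_vars _).1 hv
    refine ⟨t.idx, h.idx_lt ht, t.idx, h.idx_lt ht, l₁.sign, l₁.sign, fun l => ?_⟩
    simp only [List.mem_singleton, Query.lits, Set.mem_ofPred_eq, h.pairLits_iff]
    constructor
    · rintro ⟨t', ht', ⟨hi, -⟩, ha'⟩
      have hi : t.idx = t'.idx ∧ l₁.sign = l.sign := by tauto
      rw [← h.layout.idx_inj t ht t' ht' hi.1, ha] at ha'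
      cases l; cases l₁; simp_all
    · rintro rfl
      exact ⟨t, ht, ⟨.inl ⟨rfl, rfl⟩, hl, hg, ha ▸ hV⟩, ha⟩
  | [l₁, l₂], _ =>
    obtain ⟨hv₁, hV₁⟩ := hv l₁ (by simp)
    obtain ⟨hv₂, hV₂⟩ := hv l₂ (by simp)
    obtain ⟨t₁, ht₁, hl₁, hg₁, ha₁⟩ := (h.mem_vars _).1 hv₁
    obtain ⟨t₂, ht₂, hl₂, hg₂, ha₂⟩ := (h.mem_vars _).1 hv₂
    refine ⟨t₁.idx, h.idx_lt ht₁, t₂.idx, h.idx_lt ht₂, l₁.sign, l₂.sign, fun l => ?_⟩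
    simp only [List.mem_cons, List.not_mem_nil, or_false, Query.lits, Set.mem_ofPred_eq,
      h.pairLits_iff]
    constructor
    · rintro ⟨t', ht', ⟨⟨hi, hs⟩ | ⟨hi, hs⟩, -⟩, ha'⟩
      · rw [← h.layout.idx_inj t₁ ht₁ t' ht' hi, ha₁] at ha'
        left
        cases l; cases l₁; simp_all
      · rw [← h.layout.idx_inj t₂ ht₂ t' ht' hi, ha₂] at ha'
        right
        cases l; cases l₂; simp_all
    · rintro (rfl | rfl)
      · exact ⟨t₁, ht₁, ⟨.inl ⟨rfl, rfl⟩, hl₁, hg₁, ha₁ ▸ hV₁⟩, ha₁⟩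
      · exact ⟨t₂, ht₂, ⟨.inr ⟨rfl, rfl⟩, hl₂, hg₂, ha₂ ▸ hV₂⟩, ha₂⟩

theorem Literal.sat_congr {l : Literal} {I J : Set ℕ} (h : l.atom ∈ J ↔ l.atom ∈ I) :
    l.Sat J ↔ l.Sat I := by
  rw [Literal.Sat, Literal.Sat, h]

/-- The result of forgetting is given by the implied clauses with at most two literals over the
remaining atoms. -/
theorem Represents.sat_forget_iff (h : Represents xs g T V) (I : Set ℕ) :
    Formula.Sat I (forget T.toFormula V) ↔ ∀ i < size xs, ∀ j < size xs, ∀ a b,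
      Implied xs g (pairLits xs g i j a b) → Holds xs (pairLits xs g i j a b) I := by
  rw [sat_forget]
  constructor
  · rintro ⟨J, hJ, hag⟩ i - j - a b hQ
    obtain ⟨l, hl, hs⟩ := holds_iff.1 (hQ J ((h.models_iff J).2 hJ))
    exact holds_iff.2 ⟨l, hl, (Literal.sat_congr (hag _ (h.mem_lits_pairLits hl).2)).1 hs⟩
  · intro hQ
    -- The contrapositive of the assumption: at most two literals over the remaining atoms that are
    -- false in `I` are simultaneously false in some model.
    have hc : ∀ c : List Literal, c.length ≤ 2 →
        (∀ l ∈ c, l.atom ∈ vars T.toFormula ∧ l.atom ∉ V) → (∀ l ∈ c, ¬ l.Sat I) →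
        ∃ J, Models xs g J ∧ ∀ l ∈ c, ¬ l.Sat J := by
      intro c hlen hv hI
      obtain ⟨i, hi, j, hj, a, b, hQc⟩ := h.exists_pairLits hlen hv
      by_contra hn
      push Not at hn
      obtain ⟨l, hl, hs⟩ := holds_iff.1 (hQ i hi j hj a b fun J hJ => by
        obtain ⟨l, hl, hs⟩ := hn J hJ
        exact holds_iff.2 ⟨l, (hQc l).2 hl, hs⟩)
      exact hI l ((hQc l).1 hl) hs
    classical
    -- The literal over `p` that is false in `I`: it is false in `J` iff `J` agrees with `I` at `p`.
    let lit : ℕ → Literal := fun p => ⟨decide (p ∉ I), p⟩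
    have hlit : ∀ p J, ¬ (lit p).Sat J ↔ (p ∈ J ↔ p ∈ I) := fun p J => by
      by_cases hp : p ∈ I <;> simp [lit, Literal.Sat, hp]
    let W : Finset ℕ := ((xs.filter fun t => t.kind.isLit && g t.kind).map (·.atom)).toFinset.filter
      (· ∉ V)
    have hW : ∀ p, p ∈ W ↔ p ∈ vars T.toFormula ∧ p ∉ V := fun p => by
      rw [h.mem_vars]
      simp [W, and_assoc]
    obtain ⟨J, hJ, hJI⟩ := exists_agree (M := Models xs g) h.binary.majority (I := I) (W := ↑W)
      (by
        obtain ⟨J, hJ, -⟩ := hc [] (by simp) (by simp) (by simp)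
        exact ⟨J, hJ⟩)
      (fun p hp q hq => by
        obtain ⟨J, hJ, h'⟩ := hc [lit p, lit q] (by simp)
          (by simpa [lit] using ⟨(hW p).1 hp, (hW q).1 hq⟩) (by simp [hlit])
        exact ⟨J, hJ, (hlit p J).1 (h' _ (by simp)), (hlit q J).1 (h' _ (by simp))⟩) W subset_rfl
    -- The model `J` agrees with `I` only on `Var(T) \ V`. Atoms outside the theory do not affect
    -- the clauses, so they take their values from `I`.
    refine ⟨{p | if p ∈ vars T.toFormula then p ∈ J else p ∈ I}, ?_, fun q hq => ?_⟩
    · rw [← h.models_iff]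
      intro k hk hkk hgk
      obtain ⟨t, ht, hl, hg, hc, hs⟩ := hJ k hk hkk hgk
      refine ⟨t, ht, hl, hg, hc, ?_⟩
      have hv : t.atom ∈ vars T.toFormula := (h.mem_vars _).2 ⟨t, ht, hl, hg, rfl⟩
      simpa [SatAt, hv] using hs
    · by_cases hv : q ∈ vars T.toFormula
      · simpa [hv] using hJI q ((hW q).2 ⟨hv, hq⟩)
      · simp [hv]

theorem Represents.entails_forget_iff (hP : Represents xs gP P V) (hS : Represents xs gS S V) :
    Entails P.toFormula (forget S.toFormula V) ↔ ∀ i < size xs, ∀ j < size xs, ∀ a b,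
      Implied xs gS (pairLits xs gS i j a b) → Implied xs gP (pairLits xs gS i j a b) := by
  simp only [Entails, hS.sat_forget_iff, ← hP.models_iff]
  exact ⟨fun h i hi j hj a b hQ I hI => h I hI i hi j hj a b hQ,
    fun h I hI i hi j hj a b hQ => h i hi j hj a b hQ I hI⟩

theorem Represents.clauseLits_iff (h : Represents xs g T V) {k : Info} {c : List Literal}
    (hk : ClauseAt xs g k c) {l : Literal} :
    l ∈ Query.lits xs (clauseLits xs g k.idx) ↔ l ∈ c ∧ l.atom ∉ V := by
  rw [hk.2.2.2]
  simp only [Query.lits, Set.mem_ofPred_eq, clauseLits, Bool.and_eq_true, List.any_eq_true,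
    beq_iff_eq, Bool.not_eq_true']
  constructor
  · rintro ⟨t, ht, ⟨⟨⟨⟨k', hk', ⟨⟨hi, -⟩, -⟩, hc⟩, hl, hg⟩, hf⟩, hs⟩, ha⟩
    rw [← h.layout.idx_inj k hk.1 k' hk' hi] at hc
    refine ⟨⟨t, ht, hl, hg, hc.symm, hs, ha⟩, fun hV => ?_⟩
    rw [(h.forgotten_iff t).2 (ha ▸ hV)] at hf
    simp at hf
  · rintro ⟨⟨t, ht, hl, hg, hc, hs, ha⟩, hV⟩
    refine ⟨t, ht, ⟨⟨⟨⟨k, hk.1, ⟨⟨rfl, hk.2.1⟩, hk.2.2.1⟩, hc.symm⟩, hl, hg⟩, ?_⟩, hs⟩, ha⟩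
    rw [← Bool.not_eq_true, h.forgotten_iff, ha]
    exact hV

/-- The atoms of `V` are unconstrained after forgetting, so they can be set to falsify the literals
over `V` of a given clause; the remaining literals must then be implied by `P` alone. -/
theorem Represents.forget_entails_iff (hP : Represents xs gP P V) (hS : Represents xs gS S V) :
    Entails (forget P.toFormula V) S.toFormula ↔
      ∀ i < size xs, ketAt xs gS i = true → Implied xs gP (clauseLits xs gS i) := by
  simp only [Entails, sat_forget]
  constructor
  · intro h i _ hi I hI
    simp only [ketAt, List.any_eq_true, Bool.and_eq_true, beq_iff_eq] at hi
    obtain ⟨k, hk, ⟨rfl, hkk⟩, hgk⟩ := hi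
    obtain ⟨c, hc, hkc⟩ := hS.exists_clause k hk hkk hgk
    -- An atom of `V` is true exactly if it occurs negatively in `c`. As `c` has no complementary
    -- literals, this falsifies all its literals over `V`.
    have := h {p | p ∉ V ∧ p ∈ I ∨ p ∈ V ∧ ⟨false, p⟩ ∈ c} ⟨I, (hP.models_iff I).1 hI, fun q hq => by
      simp [hq]⟩
    rw [KromTheory.toFormula, sat_conj] at this
    obtain ⟨l, hl, hs⟩ := this c hc
    by_cases hV : l.atom ∈ V
    · exfalso
      obtain ⟨_ | _, p⟩ := l
      · simp [Literal.Sat] at hs hV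
        exact hs.2 hV hl
      · simp [Literal.Sat] at hs hV
        exact (S.2 c hc).2 _ hl (show ⟨false, p⟩ ∈ c by simpa [hV] using hs)
    · refine holds_iff.2 ⟨l, (hS.clauseLits_iff hkc).2 ⟨hl, hV⟩, (Literal.sat_congr ?_).1 hs⟩
      simp [hV]
  · rintro h I ⟨J, hJ, hag⟩
    rw [KromTheory.toFormula, sat_conj]
    intro c hc
    obtain ⟨k, hk⟩ := hS.exists_ket c hc
    obtain ⟨l, hl, hs⟩ := holds_iff.1 (h k.idx (hS.idx_lt hk.1) (by
      simp only [ketAt, List.any_eq_true, Bool.and_eq_true, beq_iff_eq]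
      exact ⟨k, hk.1, ⟨rfl, hk.2.1⟩, hk.2.2.1⟩) J ((hP.models_iff J).2 hJ))
    obtain ⟨hl, hV⟩ := (hS.clauseLits_iff hk).1 hl
    exact ⟨l, hl, (Literal.sat_congr (hag _ hV)).1 hs⟩

/-- A model of `Forget(φ, V)` agrees outside `V` with a model of `φ`, and membership in the models
of `Forget(ψ, V)` depends only on the atoms outside `V`. -/
theorem forget_entails_forget_iff (φ ψ : Formula) (V : List ℕ) :
    Entails (forget φ V) (forget ψ V) ↔ Entails φ (forget ψ V) := by
  simp only [Entails, sat_forget]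
  constructor
  · exact fun h I hI => h I ⟨I, hI, fun _ _ => Iff.rfl⟩
  · rintro h I ⟨J, hJ, hag⟩
    obtain ⟨K, hK, hag'⟩ := h J hJ
    exact ⟨K, hK, fun q hq => (hag' q hq).trans (hag q hq)⟩

theorem entails_forget (φ : Formula) (V : List ℕ) : Entails φ (forget φ V) := fun I hI =>
  (sat_forget φ V I).2 ⟨I, hI, fun _ _ => Iff.rfl⟩

/-! ### The theory of the implied clauses -/

theorem not_tautological {Q : Query} (h : tautological xs Q = false) {t₁ t₂ : Info} (h₁ : t₁ ∈ xs)
    (h₂ : t₂ ∈ xs) (hQ₁ : Q true t₁ = true) (hQ₂ : Q false t₂ = true) : t₁.atom ≠ t₂.atom := by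
  intro e
  rw [tautological, List.any_eq_false] at h
  refine h t₁ h₁ ?_
  simp only [spread, Bool.and_eq_true, List.any_eq_true, beq_iff_eq]
  exact ⟨⟨t₁, h₁, hQ₁, rfl⟩, t₂, h₂, hQ₂, e.symm⟩

theorem mem_lits_iff {Q : Query} (h : tautological xs Q = false) (l : Literal) :
    l ∈ literals xs Q ↔ l ∈ Q.lits xs := by
  simp only [literals, List.mem_map, List.mem_filter, Bool.or_eq_true, Query.lits,
    Set.mem_ofPred_eq]
  constructor
  · rintro ⟨t, ⟨ht, hQ⟩, rfl⟩
    refine ⟨t, ht, ?_, rfl⟩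
    rcases hp : Q true t
    · simpa [hp] using hQ
    · exact hp
  · obtain ⟨_ | _, p⟩ := l
    · rintro ⟨t, ht, hQ, rfl⟩
      refine ⟨t, ⟨ht, .inr hQ⟩, ?_⟩
      have : Q true t = false := by
        by_contra hp
        exact not_tautological h ht ht (by simpa using hp) hQ rfl
      rw [this]
    · rintro ⟨t, ht, hQ, rfl⟩
      exact ⟨t, ⟨ht, .inl hQ⟩, by rw [show Q true t = true from hQ]⟩

theorem holds_of_tautological {Q : Query} (h : tautological xs Q = true) (I : Set ℕ) :
    Holds xs Q I := by
  simp only [tautological, spread, List.any_eq_true, Bool.and_eq_true, beq_iff_eq] at h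
  obtain ⟨t, -, ⟨t₁, h₁, hQ₁, ha₁⟩, t₂, h₂, hQ₂, ha₂⟩ := h
  by_cases hI : t.atom ∈ I
  · exact ⟨t₁, h₁, .inl ⟨hQ₁, ha₁ ▸ hI⟩⟩
  · exact ⟨t₂, h₂, .inr ⟨hQ₂, ha₂ ▸ hI⟩⟩

theorem mem_impliedClauses {d : List Literal} : d ∈ impliedClauses xs g ↔
    ∃ i < size xs, ∃ j < size xs, ∃ a b, Implied xs g (pairLits xs g i j a b) ∧
      tautological xs (pairLits xs g i j a b) = false ∧
      d = literals xs (pairLits xs g i j a b) := by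
  have hmem : ∀ i j a b, d ∈ pairClauses xs g i j a b ↔ Implied xs g (pairLits xs g i j a b) ∧
      tautological xs (pairLits xs g i j a b) = false ∧
      d = literals xs (pairLits xs g i j a b) := fun i j a b => by
    unfold pairClauses
    split <;> simp_all
  simp only [impliedClauses, List.mem_flatMap, List.mem_range, hmem]
  simp

theorem Layout.nodup_idx {i c o} (h : Layout i c o xs) : (xs.map (·.idx)).Nodup := by
  induction xs generalizing i c o with
  | nil => simp
  | cons t xs ih =>
    rw [List.map_cons, List.nodup_cons]
    refine ⟨fun hm => ?_, ih h.2.2⟩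
    obtain ⟨t', ht', e⟩ := List.mem_map.1 hm
    have := h.2.2.idx_ge t' ht'
    have := h.1
    omega

/-- The selected tokens have distinct positions, each equal to `i` or `j`. -/
theorem length_literals_pairLits (hL : Layout 0 0 false xs) (i j : ℕ) (a b : Bool) :
    (literals xs (pairLits xs g i j a b)).length ≤ 2 := by
  have hn := (hL.nodup_idx).sublist
    ((List.filter_sublist (p := fun t => pairLits xs g i j a b true t ||
      pairLits xs g i j a b false t) (l := xs)).map (·.idx))
  have hs : (List.map (·.idx) (xs.filter fun t => pairLits xs g i j a b true t ||
      pairLits xs g i j a b false t)) ⊆ [i, j] := by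
    intro n hn
    obtain ⟨t, ht, rfl⟩ := List.mem_map.1 hn
    simp only [List.mem_filter, pairLits, Bool.or_eq_true, Bool.and_eq_true, beq_iff_eq] at ht
    simp only [List.mem_cons, List.not_mem_nil, or_false]
    omega
  have := (hn.subperm hs).length_le
  simpa [literals] using this

theorem isKromClause_of_mem (hL : Layout 0 0 false xs) {d : List Literal}
    (hd : d ∈ impliedClauses xs g) : IsKromClause d := by
  obtain ⟨i, -, j, -, a, b, -, ht, rfl⟩ := mem_impliedClauses.1 hd
  refine ⟨length_literals_pairLits hL i j a b, fun l hl hc => ?_⟩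
  rw [mem_lits_iff ht] at hl hc
  obtain ⟨t₁, h₁, hQ₁, ha₁⟩ := hl
  obtain ⟨t₂, h₂, hQ₂, ha₂⟩ := hc
  obtain ⟨_ | _, p⟩ := l
  · exact not_tautological ht h₂ h₁ hQ₂ hQ₁ (ha₂.trans ha₁.symm)
  · exact not_tautological ht h₁ h₂ hQ₁ hQ₂ (ha₁.trans ha₂.symm)

theorem Represents.equivalent_impliedClauses (h : Represents xs g T V) :
    Equivalent (conj (impliedClauses xs g)) (forget T.toFormula V) := by
  have key : ∀ I, Formula.Sat I (conj (impliedClauses xs g)) ↔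
      Formula.Sat I (forget T.toFormula V) := fun I => by
    rw [sat_conj, h.sat_forget_iff]
    constructor
    · intro hF i hi j hj a b hQ
      cases ht : tautological xs (pairLits xs g i j a b)
      · obtain ⟨l, hl, hs⟩ := hF _ (mem_impliedClauses.2 ⟨i, hi, j, hj, a, b, hQ, ht, rfl⟩)
        exact holds_iff.2 ⟨l, (mem_lits_iff ht l).1 hl, hs⟩
      · exact holds_of_tautological ht I
    · intro hF d hd
      obtain ⟨i, hi, j, hj, a, b, hQ, ht, rfl⟩ := mem_impliedClauses.1 hd
      obtain ⟨l, hl, hs⟩ := holds_iff.1 (hF i hi j hj a b hQ)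
      exact ⟨l, (mem_lits_iff ht l).2 hl, hs⟩
  exact ⟨fun I => (key I).1, fun I => (key I).2⟩

theorem Represents.exists_mem_impliedClauses_iff (h : Represents xs g T V) {c : List Literal}
    (hc : IsKromClause c) : (∃ d ∈ impliedClauses xs g, ∀ l, l ∈ d ↔ l ∈ c) ↔
      (∀ l ∈ c, l.atom ∈ vars T.toFormula ∧ l.atom ∉ V) ∧ Entails T.toFormula (disj c) := by
  have hent : ∀ Q : Query, (∀ l, l ∈ Q.lits xs ↔ l ∈ c) →
      (Implied xs g Q ↔ Entails T.toFormula (disj c)) := fun Q hQ => by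
    simp only [Implied, Entails, h.models_iff, sat_disj, holds_iff, hQ]
  constructor
  · rintro ⟨d, hd, hdc⟩
    obtain ⟨i, hi, j, hj, a, b, hQ, ht, rfl⟩ := mem_impliedClauses.1 hd
    have hl : ∀ l, l ∈ Query.lits xs (pairLits xs g i j a b) ↔ l ∈ c := fun l =>
      (mem_lits_iff ht l).symm.trans (hdc l)
    exact ⟨fun l hlc => h.mem_lits_pairLits ((hl l).2 hlc), (hent _ hl).1 hQ⟩
  · rintro ⟨hv, he⟩
    obtain ⟨i, hi, j, hj, a, b, hl⟩ := h.exists_pairLits hc.1 hv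
    -- A Krom clause has no complementary pair, so its output is not suppressed.
    have ht : tautological xs (pairLits xs g i j a b) = false := by
      by_contra ht
      simp only [tautological, spread, Bool.not_eq_false, List.any_eq_true, Bool.and_eq_true,
        beq_iff_eq] at ht
      obtain ⟨t, -, ⟨t₁, h₁, hQ₁, ha₁⟩, t₂, h₂, hQ₂, ha₂⟩ := ht
      exact hc.2 _ ((hl ⟨true, t.atom⟩).1 ⟨t₁, h₁, hQ₁, ha₁⟩)
        ((hl ⟨false, t.atom⟩).1 ⟨t₂, h₂, hQ₂, ha₂⟩)
    exact ⟨_, mem_impliedClauses.2 ⟨i, hi, j, hj, a, b, (hent _ hl).2 he, ht, rfl⟩,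
      fun l => (mem_lits_iff ht l).trans (hl l)⟩

end Represents

/-! ### The instances represent their theories -/

def inSection (s : Fin 3) (k : Kind) : Bool := k.sec == s

theorem eq_of_length_le_two {α : Type*} {l : List α} (h : l.length ≤ 2) {a b c : α} (ha : a ∈ l)
    (hb : b ∈ l) (hc : c ∈ l) : a = b ∨ a = c ∨ b = c := by
  match l, h with
  | [], _ => simp at ha
  | [x], _ => simp_all
  | [x, y], _ =>
    simp only [List.mem_cons, List.not_mem_nil, or_false] at ha hb hc
    rcases ha with rfl | rfl <;> rcases hb with rfl | rfl <;> rcases hc with rfl | rfl <;> simp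

section Groups

variable {G : List (List (Kind × ℕ))}

theorem exists_group (hG : ∀ γ ∈ G, IsGroup γ) {t : Info} (ht : t ∈ number 0 0 G.flatten) :
    ∃ h : t.cid < G.length, (t.kind, t.atom) ∈ G[t.cid] := by
  have h : t.cid < G.length := by simpa using cid_number_lt hG 0 0 t ht
  refine ⟨h, ?_⟩
  rw [← filter_number hG 0 0 t.cid h]
  exact List.mem_map.2 ⟨t, List.mem_filter.2 ⟨ht, by simp⟩, rfl⟩

theorem exists_token (hG : ∀ γ ∈ G, IsGroup γ) {j : ℕ} (hj : j < G.length) {y : Kind × ℕ}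
    (hy : y ∈ G[j]) :
    ∃ t ∈ number 0 0 G.flatten, t.cid = j ∧ t.kind = y.1 ∧ t.atom = y.2 := by
  rw [← filter_number hG 0 0 j hj] at hy
  obtain ⟨t, ht, rfl⟩ := List.mem_map.1 hy
  obtain ⟨ht, hc⟩ := List.mem_filter.1 ht
  exact ⟨t, ht, by simpa using hc, rfl, rfl⟩

theorem mem_clauseGroup {s : Fin 3} {c : List Literal} {k : Kind} {a : ℕ} :
    (k, a) ∈ clauseGroup s c ↔
      (∃ l ∈ c, k = ⟨.lit, l.sign, s⟩ ∧ a = l.atom) ∨ k = ⟨.ket, false, s⟩ ∧ a = 0 := by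
  simp [clauseGroup, eq_comm]

theorem clauseAt_of_group (hG : ∀ γ ∈ G, IsGroup γ) {s : Fin 3} {c : List Literal} {k : Info}
    (hk : k ∈ number 0 0 G.flatten) (hj : k.cid < G.length) (hc : G[k.cid] = clauseGroup s c)
    (hkk : k.kind.isKet = true) (hgk : inSection s k.kind = true) :
    ClauseAt (number 0 0 G.flatten) (inSection s) k c := by
  refine ⟨hk, hkk, hgk, fun l => ⟨fun hl => ?_, ?_⟩⟩
  · obtain ⟨t, ht, htc, htk, hta⟩ := exists_token hG hj (y := (⟨.lit, l.sign, s⟩, l.atom))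
      (by rw [hc, mem_clauseGroup]; exact .inl ⟨l, hl, rfl, rfl⟩)
    exact ⟨t, ht, by simp [htk, Kind.isLit], by simp [htk, inSection], htc, by rw [htk], hta⟩
  · rintro ⟨t, ht, htl, -, htc, hs, ha⟩
    obtain ⟨h, hm⟩ := exists_group hG ht
    simp only [htc, hc, mem_clauseGroup] at hm
    rcases hm with ⟨l', hl', hk', ha'⟩ | ⟨hk', -⟩
    · have : l = l' := by
        cases l; cases l'
        simp_all
      rwa [this]
    · simp [hk', Kind.isLit] at htl

/-- The condition `hcl` asks for Krom clauses in the other sections too, because `Binary.le_two` is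
not restricted to the selected clauses. -/
theorem represents (hG : ∀ γ ∈ G, IsGroup γ) {s : Fin 3} {T : KromTheory} {V : List ℕ}
    (hT : ∀ c ∈ T.1, clauseGroup s c ∈ G) (hV : ∀ p ∈ V, atomGroup p ∈ G) (hE : endGroup ∈ G)
    (hcl : ∀ γ ∈ G, (∃ s' c, γ = clauseGroup s' c ∧ IsKromClause c ∧ (s' = s → c ∈ T.1)) ∨
      (∃ p ∈ V, γ = atomGroup p) ∨ γ = endGroup) :
    Represents (number 0 0 G.flatten) (inSection s) T V := by
  have hlit : ∀ t ∈ number 0 0 G.flatten, t.kind.isLit = true ∨ t.kind.isKet = true →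
      ∃ h : t.cid < G.length, ∃ c, G[t.cid] = clauseGroup t.kind.sec c ∧ IsKromClause c ∧
        (t.kind.sec = s → c ∈ T.1) := by
    intro t ht hl
    obtain ⟨h, hm⟩ := exists_group hG ht
    rcases hcl _ (List.getElem_mem h) with ⟨s', c, e, hc, hs⟩ | ⟨p, -, e⟩ | e
    · have : t.kind.sec = s' := by
        rw [e, mem_clauseGroup] at hm
        rcases hm with ⟨l, -, hk, -⟩ | ⟨hk, -⟩ <;> rw [hk]
      exact ⟨h, c, this ▸ e, hc, this ▸ hs⟩
    · rw [e] at hm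
      simp only [atomGroup, List.mem_singleton, Prod.mk.injEq] at hm
      simp [hm.1, Kind.isLit, Kind.isKet] at hl
    · rw [e] at hm
      simp only [endGroup, List.mem_singleton, Prod.mk.injEq] at hm
      simp [hm.1, Kind.isLit, Kind.isKet] at hl
  refine ⟨layout_number hG 0 0, ⟨?_, ?_⟩, ?_, ?_, ?_, ?_⟩
  · intro t ht hl hg
    obtain ⟨h, c, e, -, -⟩ := hlit t ht (.inl hl)
    obtain ⟨k, hk, hkc, hkk, -⟩ := exists_token hG h (y := (⟨.ket, false, t.kind.sec⟩, 0))
      (by rw [e, mem_clauseGroup]; exact .inr ⟨rfl, rfl⟩)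
    exact ⟨k, hk, by simp [hkk, Kind.isKet], by rw [hkk]; exact hg, hkc⟩
  · intro t₁ h₁ t₂ h₂ t₃ h₃ l₁ l₂ l₃ e₂ e₃
    obtain ⟨h, c, e, hc, -⟩ := hlit t₁ h₁ (.inl l₁)
    have hf := congrArg (fun l => (l.filter fun y => y.1.isLit).length)
      (filter_number hG 0 0 t₁.cid h)
    simp only [e, clauseGroup, List.filter_map, List.filter_append, List.length_append,
      List.length_map, Function.comp_def] at hf
    have hle : ((((number 0 0 G.flatten).filter fun t => t.cid == 0 + t₁.cid)).filter
        fun t => t.kind.isLit).length ≤ 2 := by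
      rw [hf]
      simpa [Kind.isLit] using hc.1
    refine eq_of_length_le_two hle ?_ ?_ ?_ <;>
      simp only [List.mem_filter, Nat.zero_add, beq_iff_eq]
    · exact ⟨⟨h₁, trivial⟩, l₁⟩
    · exact ⟨⟨h₂, e₂.symm⟩, l₂⟩
    · exact ⟨⟨h₃, e₃.symm⟩, l₃⟩
  · obtain ⟨j, hj, e⟩ := List.mem_iff_getElem.1 hE
    obtain ⟨t, ht, -, hk, -⟩ := exists_token hG hj (y := (⟨.fin, false, 0⟩, 0))
      (by rw [e]; simp [endGroup])
    exact ⟨t, ht, by simp [hk, Kind.isLit]⟩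
  · intro k hk hkk hgk
    obtain ⟨h, c, e, -, hc⟩ := hlit k hk (.inr hkk)
    have hs : k.kind.sec = s := by simpa [inSection] using hgk
    exact ⟨c, hc hs, clauseAt_of_group hG hk h (hs ▸ e) hkk hgk⟩
  · intro c hc
    obtain ⟨j, hj, e⟩ := List.mem_iff_getElem.1 (hT c hc)
    obtain ⟨k, hk, hkc, hkk, -⟩ := exists_token hG hj (y := (⟨.ket, false, s⟩, 0))
      (by rw [e, mem_clauseGroup]; exact .inr ⟨rfl, rfl⟩)
    subst hkc
    exact ⟨k, clauseAt_of_group hG hk hj e (by simp [hkk, Kind.isKet]) (by simp [hkk, inSection])⟩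
  · intro t
    simp only [forgotten, spread, List.any_eq_true, Bool.and_eq_true, beq_iff_eq]
    constructor
    · rintro ⟨t', ht', hv, ha⟩
      obtain ⟨h, hm⟩ := exists_group hG ht'
      rcases hcl _ (List.getElem_mem h) with ⟨s', c, e, -, -⟩ | ⟨p, hp, e⟩ | e
      · rw [e, mem_clauseGroup] at hm
        rcases hm with ⟨l, -, hk, -⟩ | ⟨hk, -⟩ <;> simp [hk] at hv
      · rw [e] at hm
        simp only [atomGroup, List.mem_singleton, Prod.mk.injEq] at hm
        rwa [← ha, hm.2]
      · rw [e] at hm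
        simp only [endGroup, List.mem_singleton, Prod.mk.injEq] at hm
        simp [hm.1] at hv
    · intro hp
      obtain ⟨j, hj, e⟩ := List.mem_iff_getElem.1 (hV _ hp)
      obtain ⟨t', ht', -, hk, ha⟩ := exists_token hG hj (y := (⟨.vat, false, 2⟩, t.atom))
        (by rw [e]; simp [atomGroup])
      exact ⟨t', ht', by rw [hk], ha⟩

end Groups

def tokensOne (x : KromTheory × List ℕ) : List Info := number 0 0 (groupsOne x).flatten

def tokensTwo (x : KromTheory × KromTheory × List ℕ) : List Info :=
  number 0 0 (groupsTwo x).flatten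

theorem mem_groupsOne {x : KromTheory × List ℕ} {γ : List (Kind × ℕ)} : γ ∈ groupsOne x ↔
    (∃ c ∈ x.1.1, clauseGroup 1 c = γ) ∨ (∃ p ∈ x.2, atomGroup p = γ) ∨ γ = endGroup := by
  simp [groupsOne]

theorem mem_groupsTwo {x : KromTheory × KromTheory × List ℕ} {γ : List (Kind × ℕ)} :
    γ ∈ groupsTwo x ↔ (∃ c ∈ x.1.1, clauseGroup 0 c = γ) ∨ γ ∈ groupsOne x.2 := by
  simp [groupsTwo]

theorem represents_one (x : KromTheory × List ℕ) :
    Represents (tokensOne x) (inSection 1) x.1 x.2 := by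
  refine represents (isGroup_groupsOne x) (fun c hc => mem_groupsOne.2 (.inl ⟨c, hc, rfl⟩))
    (fun p hp => mem_groupsOne.2 (.inr (.inl ⟨p, hp, rfl⟩))) (mem_groupsOne.2 (.inr (.inr rfl)))
    fun γ hγ => ?_
  rcases mem_groupsOne.1 hγ with ⟨c, hc, rfl⟩ | ⟨p, hp, rfl⟩ | rfl
  · exact .inl ⟨1, c, rfl, x.1.2 c hc, fun _ => hc⟩
  · exact .inr (.inl ⟨p, hp, rfl⟩)
  · exact .inr (.inr rfl)

theorem represents_two_left (x : KromTheory × KromTheory × List ℕ) :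
    Represents (tokensTwo x) (inSection 0) x.1 x.2.2 := by
  refine represents (isGroup_groupsTwo x) (fun c hc => mem_groupsTwo.2 (.inl ⟨c, hc, rfl⟩))
    (fun p hp => mem_groupsTwo.2 (.inr (mem_groupsOne.2 (.inr (.inl ⟨p, hp, rfl⟩)))))
    (mem_groupsTwo.2 (.inr (mem_groupsOne.2 (.inr (.inr rfl))))) fun γ hγ => ?_
  rcases mem_groupsTwo.1 hγ with ⟨c, hc, rfl⟩ | hγ
  · exact .inl ⟨0, c, rfl, x.1.2 c hc, fun _ => hc⟩
  · rcases mem_groupsOne.1 hγ with ⟨c, hc, rfl⟩ | ⟨p, hp, rfl⟩ | rfl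
    · exact .inl ⟨1, c, rfl, x.2.1.2 c hc, fun h => absurd h (by decide)⟩
    · exact .inr (.inl ⟨p, hp, rfl⟩)
    · exact .inr (.inr rfl)

theorem represents_two_right (x : KromTheory × KromTheory × List ℕ) :
    Represents (tokensTwo x) (inSection 1) x.2.1 x.2.2 := by
  refine represents (isGroup_groupsTwo x)
    (fun c hc => mem_groupsTwo.2 (.inr (mem_groupsOne.2 (.inl ⟨c, hc, rfl⟩))))
    (fun p hp => mem_groupsTwo.2 (.inr (mem_groupsOne.2 (.inr (.inl ⟨p, hp, rfl⟩)))))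
    (mem_groupsTwo.2 (.inr (mem_groupsOne.2 (.inr (.inr rfl))))) fun γ hγ => ?_
  rcases mem_groupsTwo.1 hγ with ⟨c, hc, rfl⟩ | hγ
  · exact .inl ⟨0, c, rfl, x.1.2 c hc, fun h => absurd h (by decide)⟩
  · rcases mem_groupsOne.1 hγ with ⟨c, hc, rfl⟩ | ⟨p, hp, rfl⟩ | rfl
    · exact .inl ⟨1, c, rfl, x.2.1.2 c hc, fun _ => hc⟩
    · exact .inr (.inl ⟨p, hp, rfl⟩)
    · exact .inr (.inr rfl)

theorem flatMap_number_fin {C : Type} (b : C) (l : List (Kind × ℕ)) (i c : ℕ) :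
    ((number i c l).flatMap fun t => if t.kind.typ == .fin then [b] else []) =
      l.flatMap fun y => if y.1.typ == .fin then [b] else [] := by
  conv_rhs => rw [← map_number i c l, List.flatMap_map]

theorem flatMap_clauseGroup {C : Type} (b : C) (s : Fin 3) (c : List Literal) :
    ((clauseGroup s c).flatMap fun y => if y.1.typ == .fin then [b] else []) = [] := by
  rw [List.flatMap_eq_nil_iff]
  rintro ⟨k, a⟩ hy
  rcases mem_clauseGroup.1 hy with ⟨l, -, rfl, -⟩ | ⟨rfl, -⟩ <;> rfl

theorem flatMap_groupsOne {C : Type} (x : KromTheory × List ℕ) (b : C) :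
    ((groupsOne x).flatten.flatMap fun y => if y.1.typ == .fin then [b] else []) = [b] := by
  rw [groupsOne, List.flatten_append, List.flatten_append, List.flatMap_append,
    List.flatMap_append]
  have h₁ : ((x.1.1.map (clauseGroup 1)).flatten.flatMap
      fun y => if y.1.typ == .fin then [b] else []) = [] := by
    rw [List.flatMap_eq_nil_iff]
    intro y hy
    obtain ⟨γ, hγ, hy⟩ := List.mem_flatten.1 hy
    obtain ⟨c, -, rfl⟩ := List.mem_map.1 hγ
    exact List.flatMap_eq_nil_iff.1 (flatMap_clauseGroup b 1 c) y hy
  have h₂ : ((x.2.map atomGroup).flatten.flatMap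
      fun y => if y.1.typ == .fin then [b] else []) = [] := by
    rw [List.flatMap_eq_nil_iff]
    intro y hy
    obtain ⟨γ, hγ, hy⟩ := List.mem_flatten.1 hy
    obtain ⟨p, -, rfl⟩ := List.mem_map.1 hγ
    rw [List.mem_singleton.1 hy]
    rfl
  rw [h₁, h₂]
  rfl

theorem flatMap_tokensOne {C : Type} (x : KromTheory × List ℕ) (b : C) :
    ((tokensOne x).flatMap fun t => if t.kind.typ == .fin then [b] else []) = [b] :=
  (flatMap_number_fin b _ 0 0).trans (flatMap_groupsOne x b)

theorem flatMap_tokensTwo {C : Type} (x : KromTheory × KromTheory × List ℕ) (b : C) :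
    ((tokensTwo x).flatMap fun t => if t.kind.typ == .fin then [b] else []) = [b] := by
  refine (flatMap_number_fin b _ 0 0).trans ?_
  have h : ((x.1.1.map (clauseGroup 0)).flatten.flatMap
      fun y => if y.1.typ == .fin then [b] else []) = [] := by
    rw [List.flatMap_eq_nil_iff]
    intro y hy
    obtain ⟨γ, hγ, hy⟩ := List.mem_flatten.1 hy
    obtain ⟨c, -, rfl⟩ := List.mem_map.1 hγ
    exact List.flatMap_eq_nil_iff.1 (flatMap_clauseGroup b 0 c) y hy
  rw [groupsTwo, List.flatten_append, List.flatMap_append, h, List.nil_append, flatMap_groupsOne]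

/-! ### Polynomial-time algorithms -/

theorem tractable_one {c : Cmd Bool} (hc : c.emits = false) {p : KromTheory × List ℕ → Prop}
    (h : ∀ x (s : St Bool), s.T .vm = forgotten (tokensOne x) → (∀ t, s.T .acc t = true) →
      ∀ t, (run (tokensOne x) c s).T .acc t = true ↔ p x) : Tractable encodeOne p := by
  classical
  exact ⟨fun x => decide (p x), fun x => decide_eq_true_iff,
    polyTimeComputable_one (decision c) fun x =>
      decision_out (represents_one x).layout (flatMap_tokensOne x) hc (h x) _ decide_eq_true_iff⟩

theorem tractable_two {c : Cmd Bool} (hc : c.emits = false)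
    {p : KromTheory × KromTheory × List ℕ → Prop}
    (h : ∀ x (s : St Bool), s.T .vm = forgotten (tokensTwo x) → (∀ t, s.T .acc t = true) →
      ∀ t, (run (tokensTwo x) c s).T .acc t = true ↔ p x) : Tractable encodeTwo p := by
  classical
  exact ⟨fun x => decide (p x), fun x => decide_eq_true_iff,
    polyTimeComputable_two (decision c) fun x =>
      decision_out (represents_two_left x).layout (flatMap_tokensTwo x) hc (h x) _
        decide_eq_true_iff⟩

section Checks

variable {xs : List Info} {gP gS : Kind → Bool} {P S : KromTheory} {V : List ℕ}

open Formula

theorem Represents.checkPairs_iff (hP : Represents xs gP P V) (hS : Represents xs gS S V)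
    (s : St Bool) (hvm : s.T .vm = forgotten xs) (t : Info) :
    (run xs (checkPairs gP gS) s).T .acc t = true ↔
      s.T .acc t = true ∧ Entails P.toFormula (forget S.toFormula V) := by
  rw [checkPairs_T hP.layout hP.binary hS.binary s hvm, hP.entails_forget_iff hS]

theorem Represents.checkClauses_iff (hP : Represents xs gP P V) (hS : Represents xs gS S V)
    (s : St Bool) (hvm : s.T .vm = forgotten xs) (t : Info) :
    (run xs (checkClauses gP gS) s).T .acc t = true ↔
      s.T .acc t = true ∧ Entails (forget P.toFormula V) S.toFormula := by
  rw [checkClauses_T hP.layout hP.binary s hvm, hP.forget_entails_iff hS]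

end Checks

/-- The theory of the implied clauses with at most two literals over the remaining atoms. -/
noncomputable def forgetTheory (x : KromTheory × List ℕ) : KromTheory :=
  ⟨impliedClauses (tokensOne x) (inSection 1),
    fun _ => isKromClause_of_mem (represents_one x).layout⟩

theorem polyTimeComputable_forgetTheory :
    PolyTimeComputable encodeOne encodeTheory forgetTheory :=
  polyTimeComputable_one (writePairs (inSection 1)) fun x =>
    writePairs_out (represents_one x).layout (represents_one x).binary (flatMap_tokensOne x)

end KromForget

/-! ### The six decision problems and the forgetting function. -/

open KromForget KromForget.Formula in
theorem mainTheorem9 :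
    -- (i) `P ⊨ Forget(S, V)`
    Tractable encodeTwo (fun x : KromTheory × KromTheory × List ℕ =>
      Entails x.1.toFormula (forget x.2.1.toFormula x.2.2)) ∧
    -- (ii) `Forget(P, V) ⊨ S`
    Tractable encodeTwo (fun x : KromTheory × KromTheory × List ℕ =>
      Entails (forget x.1.toFormula x.2.2) x.2.1.toFormula) ∧
    -- (iii) `Forget(P, V) ⊨ Forget(S, V)`
    Tractable encodeTwo (fun x : KromTheory × KromTheory × List ℕ =>
      Entails (forget x.1.toFormula x.2.2) (forget x.2.1.toFormula x.2.2)) ∧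
    -- (iv) `P ≡ Forget(S, V)`
    Tractable encodeTwo (fun x : KromTheory × KromTheory × List ℕ =>
      Equivalent x.1.toFormula (forget x.2.1.toFormula x.2.2)) ∧
    -- (v) `Forget(P, V) ≡ Forget(S, V)`
    Tractable encodeTwo (fun x : KromTheory × KromTheory × List ℕ =>
      Equivalent (forget x.1.toFormula x.2.2) (forget x.2.1.toFormula x.2.2)) ∧
    -- (vi) `Forget(P, V) ≡ P`
    Tractable encodeOne (fun x : KromTheory × List ℕ =>
      Equivalent (forget x.1.toFormula x.2) x.1.toFormula) ∧
    -- `Forget(S, V)` is computable in polynomial time, as the theory of all implied clauses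
    -- with at most two literals over the remaining atoms
    (∃ F : KromTheory × List ℕ → KromTheory,
      PolyTimeComputable encodeOne encodeTheory F ∧
      ∀ (S : KromTheory) (V : List ℕ),
        Equivalent (F (S, V)).toFormula (forget S.toFormula V) ∧
        ∀ c : List Literal, IsKromClause c →
          ((∃ d ∈ (F (S, V)).1, ∀ l, l ∈ d ↔ l ∈ c) ↔
            ((∀ l ∈ c, l.atom ∈ vars S.toFormula ∧ l.atom ∉ V) ∧
              Entails S.toFormula (disj c)))) := by
  refine ⟨?_, ?_, ?_, ?_, ?_, ?_, forgetTheory, polyTimeComputable_forgetTheory, fun S V =>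
    ⟨(represents_one (S, V)).equivalent_impliedClauses,
      fun c hc => (represents_one (S, V)).exists_mem_impliedClauses_iff hc⟩⟩
  · refine tractable_two (c := checkPairs (inSection 0) (inSection 1)) rfl fun x s hvm hacc t => ?_
    rw [(represents_two_left x).checkPairs_iff (represents_two_right x) s hvm,
      and_iff_right (hacc t)]
  · refine tractable_two (c := checkClauses (inSection 0) (inSection 1)) rfl
      fun x s hvm hacc t => ?_
    rw [(represents_two_left x).checkClauses_iff (represents_two_right x) s hvm,
      and_iff_right (hacc t)]
  -- The same program as for (i): forgetting on the left does not change the answer.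
  · refine tractable_two (c := checkPairs (inSection 0) (inSection 1)) rfl fun x s hvm hacc t => ?_
    rw [(represents_two_left x).checkPairs_iff (represents_two_right x) s hvm,
      and_iff_right (hacc t), forget_entails_forget_iff]
  -- The two directions are checked in turn, the second with the roles of the theories exchanged.
  -- The mark `acc` is not reset in between, so it ends as their conjunction.
  · refine tractable_two (c := .seq (checkPairs (inSection 0) (inSection 1))
      (checkClauses (inSection 1) (inSection 0))) rfl fun x s hvm hacc t => ?_
    rw [run_seq, (represents_two_right x).checkClauses_iff (represents_two_left x) _
      ((run_T rfl _).trans hvm),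
      (represents_two_left x).checkPairs_iff (represents_two_right x) s hvm,
      and_iff_right (hacc t), Equivalent]
  · refine tractable_two (c := .seq (checkPairs (inSection 0) (inSection 1))
      (checkPairs (inSection 1) (inSection 0))) rfl fun x s hvm hacc t => ?_
    rw [run_seq, (represents_two_right x).checkPairs_iff (represents_two_left x) _
      ((run_T rfl _).trans hvm),
      (represents_two_left x).checkPairs_iff (represents_two_right x) s hvm,
      and_iff_right (hacc t), Equivalent, forget_entails_forget_iff, forget_entails_forget_iff]
  -- Only `Forget(P, V) ⊨ P` needs checking, with the theory in both roles; the converse always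
  -- holds.
  · refine tractable_one (c := checkClauses (inSection 1) (inSection 1)) rfl
      fun x s hvm hacc t => ?_
    rw [(represents_one x).checkClauses_iff (represents_one x) s hvm,
      and_iff_right (hacc t), Equivalent, and_iff_left (entails_forget _ _)]
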